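/- **Setting.** *Trees and networks.* Let $\bar\tau=(\tau_1,\dots,\tau_m)$, $m\ge 2$, be an ordered tree with pairwise different leaves (leaves are trees; ordered $m$-tuples, $m\ge2$, of trees with disjoint sets of leaves are trees). Each leaf $l$ has a dimension $n_l$, and $n_\tau=\prod_i n_{\tau_i}$ for $\tau=(\tau_1,\dots,\tau_m)$. A tree tensor network (TTN) consists of basis matrices $U_l\in\mathbb C^{n_l\times r_l}$ and connection tensors $C_\tau\in\mathbb C^{r_\tau\times r_{\tau_1}\times\dots\times r_{\tau_m}}$, with $r_{\bar\tau}=1$; it represents $X_\tau=C_\tau\times_0 I\bigtimes_i U_{\tau_i}\in\mathcal V_\tau=\mathbb C^{r_\tau\times n_{\tau_1}\times\dots\times n_{\tau_m}}$, where $U_\tau=\mathrm{mat}_0(X_\tau)^\top$. It has full tree rank $(r_\tau)$ if each $U_l$ has rank $r_l$ and each $C_\tau$ has full multilinear rank $(r_\tau,r_{\tau_1},\dots,r_{\tau_m})$, and it is orthonormal if $U_\tau$ has orthonormal columns for all $\tau<\bar\tau$. The tensors in $\mathcal V=\mathcal V_{\bar\tau}$ that have a TTN of full tree rank $(r_\tau)$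 form a manifold. All norms are Euclidean tensor norms. *One step $t_0\to t_1$ of the rank-adaptive integrator* for $\dot A=F(t,A)$, starting from a TTN $Y^0_{\bar\tau}$ with factors $C^0_\tau$, $U^0_\tau$. The differential equations below are solved exactly. (a) *Rank augmentation*, for a tree $\tau=(\tau_1,\dots,\tau_m)$, function $F_\tau$ and TTN $Y^0_\tau=C_\tau^0\times_0 I\bigtimes_i U^0_{\tau_i}$ (initially $\tau=\bar\tau$, $F_{\bar\tau}=F$). For each $i$, take a QR decomposition $\mathrm{mat}_i(C^0_\tau)^\top=Q_iS_i^\top$, put $V_i=\mathrm{mat}_i(\mathrm{ten}_i(Q_i^\top)\times_0I\bigtimes_{j\ne i}U^0_{\tau_j})^\top$, $\pi_i(Y)=\mathrm{ten}_i((V_i\,\mathrm{mat}_0(Y))^\top)$, let $\pi_i^\dagger$ be the adjoint of $\pi_i$, and put $F_{\tau_i}=\pi_i^\dagger\circ F_\tau\circ\pi_i$, $Y^0_{\tau_i}=X^0_{\tau_i}\times_0S_i^\top$, where $X^0_{\tau_i}$ is the sub-TTN of $U^0_{\tau_i}$. If $\tau_i=l$ is a leaf, solve $\dot Y_l=F_l(t,Y_l)$,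 $Y_l(t_0)=Y_l^0$, on $[t_0,t_1]$, and let the columns of $\widehat U_l$ be an orthonormal basis of the range of $(Y_l(t_1)^\top,U_l^0)$. Otherwise apply (a) to $\tau_i,F_{\tau_i},Y^0_{\tau_i}$, obtaining bases $\widehat U_\sigma$ for the direct subtrees $\sigma$ of $\tau_i$ and tensors $\widehat C^0_{\tau_i},\widehat C^1_{\tau_i}$; let the columns of $\widehat Q$ be an orthonormal basis of the range of $(\mathrm{mat}_0(\widehat C^1_{\tau_i})^\top,\mathrm{mat}_0(\widehat C^0_{\tau_i})^\top)$, and let $\widehat U_{\tau_i}$ be given by the TTN with connection tensor $\widehat C_{\tau_i}=\mathrm{ten}_0(\widehat Q^\top)$ and bases $\widehat U_\sigma$. Finally put $\widehat C^0_\tau=C^0_\tau\bigtimes_i\widehat U_{\tau_i}^*U^0_{\tau_i}$, solve $\dot{\widehat C}_\tau=F_\tau(t,\widehat C_\tau\bigtimes_i\widehat U_{\tau_i})\bigtimes_i\widehat U_{\tau_i}^*$, $\widehat C_\tau(t_0)=\widehat C_\tau^0$, on $[t_0,t_1]$, and put $\widehat C^1_\tau=\widehat C_\tau(t_1)$. The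 result on $\bar\tau$ is the TTN $\widehat C^1_{\bar\tau}\bigtimes_i\widehat U_{\tau_i}$. (b) *Rank truncation* with tolerance $\vartheta\ge0$, recursively from the root to the leaves. At $\tau=(\tau_1,\dots,\tau_m)$ with connection tensor $\widehat C_\tau$, take for each $i$ a singular value decomposition of $\mathrm{mat}_i(\widehat C_\tau)$ with singular values $\sigma_1\ge\sigma_2\ge\dots$, let $r_{\tau_i}$ be the smallest integer with $(\sum_{k>r_{\tau_i}}\sigma_k^2)^{1/2}\le\vartheta$, and let $P_{\tau_i}$ be the matrix of the first $r_{\tau_i}$ left singular vectors. Put $C_\tau=\widehat C_\tau\bigtimes_iP_{\tau_i}^*$; replace $\widehat U_l$ by $\widehat U_lP_l$ if $\tau_i=l$ is a leaf; otherwise replace the connection tensor $\widehat C_{\tau_i}$ by $\widehat C_{\tau_i}\times_0P_{\tau_i}^\top$ and continue with $\tau_i$. The numerical solution with step size $h>0$ starts from an orthonormal TTN $Y^0$. With $t_k=kh$, the TTN $Y^{k+1}$ is the result of the step from $t_k$ to $t_{k+1}$ starting from $Y^k$; it may, but need not, be replaced by an orthonormal TTN of the same tensor. The starting TTN $Y^k$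 of each time step is assumed to have full tree rank, and $\mathcal M^k\subset\mathcal V$ denotes the manifold of the tensors that have a TTN of the same full tree rank as $Y^k$. **Theorem.** Let $\bar\tau$ be given and let $L,B,t^*\ge0$. There are constants $c_0,c_1,c_2,c_3\ge 0$ that depend only on $L$, $B$, $t^*$ and the tree $\bar\tau$ (in particular not on the dimensions, the ranks, or the singular values of matricizations of connection tensors) such that the following holds. Let $F:[0,t^*]\times\mathcal V\to\mathcal V$ satisfy, for all $t\in[0,t^*]$, $$\|F(t,Y)-F(t,\widetilde Y)\|\le L\|Y-\widetilde Y\|,\qquad \|F(t,Y)\|\le B\qquad\text{for all }Y,\widetilde Y\in\mathcal V.$$ Let $A$ solve $\dot A(t)=F(t,A(t))$, $A(0)=A^0$, on $[0,t^*]$, and let $\rho'<\rho$ with $\|A(t)\|\le\rho'$ for $0\le t\le t^*$. Let $k\ge0$ with $t_k\le t^*$, and let $Y^0,\dots,Y^k$ be the numerical solution with step size $h>0$ and tolerance $\vartheta\ge0$. Let $\varepsilon\ge0$ be such that for all $j<k$ $$\|F(t,Y)-P_Y^jF(t,Y)\|\le\varepsilon\qquad\text{for all }t\in[t_j,t_{j+1}]\text{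 and }Y\in\mathcal M^j\text{ with }\|Y\|\le\rho,$$ where $P_Y^j$ is the orthogonal projection onto the tangent space $T_Y\mathcal M^j$, and let $\|Y^0-A^0\|\le\delta$. If $\delta,\varepsilon,h$ and $\vartheta/h$ are so small that $$c_0\delta+c_1\varepsilon+c_2h+c_3(1+\rho)\,\vartheta/h\le\rho-\rho',$$ then $$\|Y^k-A(t_k)\|\le c_0\delta+c_1\varepsilon+c_2h+c_3(1+\rho)\,\vartheta/h .$$ -/

import Mathlib

open scoped Matrix
open Set Filter Topology

noncomputable section

namespace RankAdaptiveTTN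

/-! ### Trees -/

/-- Ordered trees with leaves labelled by `𝓛`; `node c` is the ordered tuple of the trees `c i`. -/
inductive OTree (𝓛 : Type*) where
  | leaf (l : 𝓛) : OTree 𝓛
  | node {m : ℕ} (c : Fin m → OTree 𝓛) : OTree 𝓛

variable {𝓛 : Type*}

/-- The set `L(τ)` of leaves of a tree. -/
def OTree.leaves : OTree 𝓛 → Set 𝓛
  | .leaf l => {l}
  | .node c => ⋃ i, (c i).leaves

/-- Ordered trees with unequal leaves: every inner vertex has at least two direct subtrees, and
the direct subtrees have pairwise disjoint sets of leaves. -/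
def OTree.Admissible : OTree 𝓛 → Prop
  | .leaf _ => True
  | .node (m := m) c =>
      2 ≤ m ∧ (∀ i j, i ≠ j → Disjoint (c i).leaves (c j).leaves) ∧ ∀ i, (c i).Admissible

/-- The index set of `ℂ^{n_τ}`: for a leaf `l` this is `{1, …, n_l}`, and for `τ = (τ₁, …, τ_m)`
it is the product of the index sets of the `τ_i`, so that `n_τ = ∏ n_{τ_i}`. -/
@[reducible] def Idx (n : 𝓛 → ℕ) : OTree 𝓛 → Type
  | .leaf l => Fin (n l)
  | .node c => ∀ i, Idx n (c i)

/-- The index sets are finite. -/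
instance Idx.fintype (n : 𝓛 → ℕ) : (τ : OTree 𝓛) → Fintype (Idx n τ)
  | .leaf l => inferInstanceAs (Fintype (Fin (n l)))
  | .node c =>
      letI : ∀ i, Fintype (Idx n (c i)) := fun i => Idx.fintype n (c i)
      inferInstanceAs (Fintype (∀ i, Idx n (c i)))

/-- The tensor space `𝒱_τ = ℂ^{r × n_{τ₁} × ⋯ × n_{τ_m}}` (for a leaf: `ℂ^{r × n_l}`) with the
Euclidean norm of tensors. The first component of an index belongs to mode `0`. -/
abbrev TSpace (n : 𝓛 → ℕ) (τ : OTree 𝓛) (r : ℕ) : Type :=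
  EuclideanSpace ℂ (Fin r × Idx n τ)

/-- The matrix `mat₀(Y)ᵀ ∈ ℂ^{n_τ × r}`. -/
def mat0T {n : 𝓛 → ℕ} {τ : OTree 𝓛} {r : ℕ} (Y : TSpace n τ r) :
    Matrix (Idx n τ) (Fin r) ℂ :=
  Matrix.of fun x k => Y (k, x)

/-! ### Tensor operations. A tensor with a distinguished mode `0` is a function `κ → (∀ i, α i) → ℂ`. -/

section Tensors

variable {κ ι : Type*} [Fintype ι] [DecidableEq ι] {α β : ι → Type*}

/-- The tensor `C ×₀ I ⨉_i M_i`. -/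
def modeProd [∀ i, Fintype (α i)] (C : κ → (∀ i, α i) → ℂ) (M : ∀ i, Matrix (β i) (α i) ℂ) :
    κ → (∀ i, β i) → ℂ :=
  fun k b => ∑ a : ∀ i, α i, C k a * ∏ i, M i (b i) (a i)

/-- The `i`-th matricization `mat_i(C)`, whose columns are indexed by the modes other than `i`,
including mode `0`. -/
def matMode (i : ι) (C : κ → (∀ i, α i) → ℂ) :
    Matrix (α i) (κ × ∀ j : {j // j ≠ i}, α j) ℂ :=
  Matrix.of fun a p => C p.1 ((Equiv.piSplitAt i α).symm (a, p.2))

/-- The transposed `0`-th matricization `mat₀(C)ᵀ`. -/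
def coreMat0T (C : κ → (∀ i, α i) → ℂ) : Matrix (∀ i, α i) κ ℂ :=
  Matrix.of fun a k => C k a

end Tensors

/-! ### Tree tensor networks -/

/-- The data of a tree tensor network at an inner vertex: ranks `r_{τ_i}`, the connection tensor
`C_τ ∈ ℂ^{r × r_{τ₁} × ⋯ × r_{τ_m}}`, and the networks on the direct subtrees. -/
structure NodeData {m : ℕ} (Sub : Fin m → ℕ → Type) (r : ℕ) : Type where
  /-- the ranks of the direct subtrees -/
  rank : Fin m → ℕ
  /-- the connection tensor -/
  core : Fin r → (∀ i, Fin (rank i)) → ℂ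
  /-- the networks on the direct subtrees -/
  sub : ∀ i, Sub i (rank i)

/-- Tree tensor networks in factorized form on the tree `τ`, with rank `r` at the root of `τ`:
a basis matrix `U_l ∈ ℂ^{n_l × r_l}` for each leaf and a connection tensor for each inner vertex. -/
@[reducible] def TTN (n : 𝓛 → ℕ) : OTree 𝓛 → ℕ → Type
  | .leaf l, r => Matrix (Fin (n l)) (Fin r) ℂ
  | .node c, r => NodeData (fun i => TTN n (c i)) r

section Networks

variable {n : 𝓛 → ℕ}

/-- The view of a network on `(τ₁, …, τ_m)` through its factors. -/
abbrev TTN.data {m : ℕ} {c : Fin m → OTree 𝓛} {r : ℕ} (X : TTN n (.node c) r) :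
    NodeData (fun i => TTN n (c i)) r := X

/-- The matrix `U_τ ∈ ℂ^{n_τ × r_τ}` of a network: `U_l` at a leaf, and
`U_τ = mat₀(C_τ ×₀ I ⨉_i U_{τ_i})ᵀ` at an inner vertex. -/
def basisMat : (τ : OTree 𝓛) → {r : ℕ} → TTN n τ r → Matrix (Idx n τ) (Fin r) ℂ
  | .leaf _, _, U => U
  | .node c, _, X =>
      Matrix.of fun x k => modeProd X.data.core (fun i => basisMat (c i) (X.data.sub i)) k x

/-- The tensor `X_τ ∈ 𝒱_τ` represented by a network, `mat₀(X_τ)ᵀ = U_τ`. -/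
def toTensor {τ : OTree 𝓛} {r : ℕ} (X : TTN n τ r) : TSpace n τ r :=
  WithLp.toLp 2 fun p => basisMat τ X p.2 p.1

/-- The network `X ×₀ Sᵀ`, with matrix `U_τ S`: only the factor at the root of `τ` changes. -/
def rootMul : {τ : OTree 𝓛} → {r s : ℕ} → TTN n τ r → Matrix (Fin r) (Fin s) ℂ → TTN n τ s
  | .leaf l, r, _, U, S => ((show Matrix (Fin (n l)) (Fin r) ℂ from U) * S :)
  | .node _, _, _, X, S =>
      { rank := X.data.rank
        core := fun q a => ∑ k, S k q * X.data.core k a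
        sub := X.data.sub }

/-- Full tree rank: every basis matrix `U_l` has rank `r_l`, and every connection tensor `C_τ`
has full multilinear rank `(r_τ, r_{τ₁}, …, r_{τ_m})`. -/
def FullRank : (τ : OTree 𝓛) → {r : ℕ} → TTN n τ r → Prop
  | .leaf l, r, U => (show Matrix (Fin (n l)) (Fin r) ℂ from U).rank = r
  | .node c, r, X =>
      (coreMat0T X.data.core)ᵀ.rank = r ∧
      (∀ i, (matMode i X.data.core).rank = X.data.rank i) ∧
      ∀ i, FullRank (c i) (X.data.sub i)

/-- A network is orthonormal if `U_σ` has orthonormal columns for every proper subtree `σ < τ`. -/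
def IsOrthonormal : (τ : OTree 𝓛) → {r : ℕ} → TTN n τ r → Prop
  | .leaf _, _, _ => True
  | .node c, _, X =>
      ∀ i, (basisMat (c i) (X.data.sub i))ᴴ * basisMat (c i) (X.data.sub i) = 1 ∧
        IsOrthonormal (c i) (X.data.sub i)

end Networks

/-- Families `(r_σ)_{σ ≤ τ}` of ranks. -/
@[reducible] def TreeRank : OTree 𝓛 → Type
  | .leaf _ => ℕ
  | .node c => ℕ × ∀ i, TreeRank (c i)

/-- The family of ranks `(r_σ)_{σ ≤ τ}` of a network. -/
def treeRank {n : 𝓛 → ℕ} : (τ : OTree 𝓛) → {r : ℕ} → TTN n τ r → TreeRank τ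
  | .leaf _, r, _ => r
  | .node c, r, X => (r, fun i => treeRank (c i) (X.data.sub i))

/-- The manifold `ℳ_τ = ℳ(τ, (n_l), (r_σ))` of the tensors in `𝒱_τ` with a network of full tree
rank `(r_σ)_{σ ≤ τ}`. -/
def ttnManifold (n : 𝓛 → ℕ) (τ : OTree 𝓛) (r : ℕ) (R : TreeRank τ) : Set (TSpace n τ r) :=
  {Y | ∃ X : TTN n τ r, FullRank τ X ∧ treeRank τ X = R ∧ toTensor X = Y}

/-- The tangent space at `Y` of an embedded complex manifold `M`, spanned by the velocities
`γ'(0)` of the curves `γ` in `M` through `γ(0) = Y`. -/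
def tangentSpaceAt {E : Type*} [NormedAddCommGroup E] [NormedSpace ℝ E] [Module ℂ E]
    (M : Set E) (Y : E) : Submodule ℂ E :=
  Submodule.span ℂ {v | ∃ γ : ℝ → E, γ 0 = Y ∧ (∀ᶠ s in 𝓝 0, γ s ∈ M) ∧ HasDerivAt γ v 0}

/-! ### Matrix decompositions and differential equations used by the integrator -/

/-- `A = Q R` is a (reduced) QR decomposition: `Q` has orthonormal columns and `R` is upper
triangular. -/
def IsQR {α : Type*} [Fintype α] {r : ℕ} (A Q : Matrix α (Fin r) ℂ)
    (R : Matrix (Fin r) (Fin r) ℂ) : Prop :=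
  Qᴴ * Q = 1 ∧ R.BlockTriangular id ∧ A = Q * R

/-- The columns of `Q` form an orthonormal basis of the range of the matrix `(A, B)`. -/
def IsOrthBasisOfRange {α : Type*} [Fintype α] {p q r : ℕ} (Q : Matrix α (Fin r) ℂ)
    (A : Matrix α (Fin p) ℂ) (B : Matrix α (Fin q) ℂ) : Prop :=
  Qᴴ * Q = 1 ∧
    LinearMap.range Q.mulVecLin = LinearMap.range (Matrix.fromCols A B).mulVecLin

/-- `A = P Σ Q*` is a singular value decomposition: `P` is a unitary matrix of left singular
vectors, `Σ = diag(σ)` with decreasing `σ_k ≥ 0`, and the columns of `Q` that belong to nonzero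
singular values are orthonormal. (The other columns of `Q` do not matter; if `A` has fewer columns
than rows, they cannot be chosen orthonormal.) -/
def IsSVD {α : Type*} [Fintype α] {r : ℕ} (A : Matrix (Fin r) α ℂ)
    (P : Matrix (Fin r) (Fin r) ℂ) (σ : Fin r → ℝ) (Q : Matrix α (Fin r) ℂ) : Prop :=
  Pᴴ * P = 1 ∧ Antitone σ ∧ (∀ k, 0 ≤ σ k) ∧
    (∀ j k, σ j ≠ 0 → σ k ≠ 0 → (Qᴴ * Q) j k = if j = k then 1 else 0) ∧
    A = P * Matrix.diagonal (fun k => (σ k : ℂ)) * Qᴴ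

/-- `P` consists of the first `s` left singular vectors of `A`, where `s` is the smallest integer
with `(∑_{k > s} σ_k²)^{1/2} ≤ ϑ`. -/
def IsTruncationBasis {α : Type*} [Fintype α] {r s : ℕ} (ϑ : ℝ) (A : Matrix (Fin r) α ℂ)
    (P : Matrix (Fin r) (Fin s) ℂ) : Prop :=
  ∃ (Phat : Matrix (Fin r) (Fin r) ℂ) (σ : Fin r → ℝ) (Q : Matrix α (Fin r) ℂ),
    IsSVD A Phat σ Q ∧
    IsLeast {s : ℕ | Real.sqrt (∑ k with s ≤ Fin.val k, σ k ^ 2) ≤ ϑ} s ∧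
    ∃ hs : s ≤ r, P = Phat.submatrix id (Fin.castLE hs)

/-- `y` solves `y'(t) = f(t, y(t))` on `[t₀, t₁]`. -/
def SolvesODE {E : Type*} [NormedAddCommGroup E] [NormedSpace ℝ E] (f : ℝ → E → E) (t₀ t₁ : ℝ)
    (y : ℝ → E) : Prop :=
  ∀ t ∈ Icc t₀ t₁, HasDerivWithinAt y (f t (y t)) (Icc t₀ t₁) t

section Integrator

variable {n : 𝓛 → ℕ} {m : ℕ} {c : Fin m → OTree 𝓛} {r : ℕ}

/-! ### Restriction to subtrees -/

/-- The matrix `V_{τ_i} = mat_i(ten_i(Qᵀ) ×₀ I ⨉_{j ≠ i} U_{τ_j})ᵀ`. -/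
def prolMat {rk : Fin m → ℕ} (U : ∀ j, Matrix (Idx n (c j)) (Fin (rk j)) ℂ) (i : Fin m)
    (Q : Matrix (Fin r × ∀ j : {j // j ≠ i}, Fin (rk j)) (Fin (rk i)) ℂ) :
    Matrix (Fin r × ∀ j : {j // j ≠ i}, Idx n (c j)) (Fin (rk i)) ℂ :=
  Matrix.of fun p q =>
    modeProd (fun k (a : ∀ j : {j // j ≠ i}, Fin (rk j)) => Q (k, a) q)
      (fun j : {j // j ≠ i} => U j) p.1 p.2

/-- The prolongation `π_{τ,i} : 𝒱_{τ_i} → 𝒱_τ`, `π_{τ,i}(Y) = ten_i((V mat₀(Y))ᵀ)`. -/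
def prolongation {s : ℕ} (i : Fin m)
    (V : Matrix (Fin r × ∀ j : {j // j ≠ i}, Idx n (c j)) (Fin s) ℂ)
    (Y : TSpace n (c i) s) : TSpace n (.node c) r :=
  WithLp.toLp 2 fun p : Fin r × Idx n (.node c) =>
    ∑ q, V (p.1, fun j => (show ∀ i, Idx n (c i) from p.2) j) q *
      Y (q, (show ∀ i, Idx n (c i) from p.2) i)

/-- The restriction `π_{τ,i}† : 𝒱_τ → 𝒱_{τ_i}`, the adjoint of the prolongation:
`mat₀(π_{τ,i}†(Z))ᵀ = mat_i(Z) V̄`. -/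
def restriction {s : ℕ} (i : Fin m)
    (V : Matrix (Fin r × ∀ j : {j // j ≠ i}, Idx n (c j)) (Fin s) ℂ)
    (Z : TSpace n (.node c) r) : TSpace n (c i) s :=
  WithLp.toLp 2 fun p =>
    ∑ y, matMode i (fun k (x : ∀ i, Idx n (c i)) => Z (k, x)) p.2 y * star (V y p.1)

/-- The function `F_{τ_i} = π_{τ,i}† ∘ F_τ ∘ π_{τ,i}`. -/
def subFun {s : ℕ} (i : Fin m)
    (V : Matrix (Fin r × ∀ j : {j // j ≠ i}, Idx n (c j)) (Fin s) ℂ)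
    (F : ℝ → TSpace n (.node c) r → TSpace n (.node c) r) :
    ℝ → TSpace n (c i) s → TSpace n (c i) s :=
  fun t Y => restriction i V (F t (prolongation i V Y))

/-! ### The integrator -/

/-- The right-hand side `C ↦ F_τ(t, C ⨉_i Û_{τ_i}) ⨉_i Û_{τ_i}*` of the differential equation for
the connection tensor. -/
def galerkinRHS {rk : Fin m → ℕ} (Uhat : ∀ i, Matrix (Idx n (c i)) (Fin (rk i)) ℂ)
    (F : ℝ → TSpace n (.node c) r → TSpace n (.node c) r) (t : ℝ)
    (C : Fin r → (∀ i, Fin (rk i)) → ℂ) : Fin r → (∀ i, Fin (rk i)) → ℂ :=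
  modeProd
    (fun k (x : ∀ i, Idx n (c i)) =>
      F t (WithLp.toLp 2 fun p : Fin r × Idx n (.node c) => modeProd C Uhat p.1 p.2) (k, x))
    (fun i => (Uhat i)ᴴ)

/-- One rank-augmenting integration step on `τ = (τ₁, …, τ_m)` from the network `Y0` for the
function `F = F_τ`. The results are the networks `Xhat i` of the augmented bases `Û_{τ_i}` and the
connection tensors `C0 = Ĉ_τ⁰` and `C1 = Ĉ_τ¹`. The relation `Φ i X S G X'` is the basis update on
the direct subtree `τ_i`: the basis of `X` is updated to the basis of `X'` by solving the
differential equation with right-hand side `G = F_{τ_i}` from the starting value `X ×₀ Sᵀ`. -/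
def RankAugment
    (Φ : ∀ (i : Fin m) {s s' : ℕ}, TTN n (c i) s → Matrix (Fin s) (Fin s) ℂ →
      (ℝ → TSpace n (c i) s → TSpace n (c i) s) → TTN n (c i) s' → Prop)
    (Y0 : TTN n (.node c) r) (F : ℝ → TSpace n (.node c) r → TSpace n (.node c) r) (t₀ t₁ : ℝ)
    {rk : Fin m → ℕ} (Xhat : ∀ i, TTN n (c i) (rk i))
    (C0 C1 : Fin r → (∀ i, Fin (rk i)) → ℂ) : Prop :=
  (∀ i : Fin m, ∃ Q S, IsQR (matMode i Y0.data.core)ᵀ Q Sᵀ ∧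
    Φ i (Y0.data.sub i) S
      (subFun i (prolMat (fun j => basisMat (c j) (Y0.data.sub j)) i Q) F) (Xhat i)) ∧
  C0 = modeProd Y0.data.core
    (fun i => (basisMat (c i) (Xhat i))ᴴ * basisMat (c i) (Y0.data.sub i)) ∧
  ∃ C : ℝ → Fin r → (∀ i, Fin (rk i)) → ℂ,
    SolvesODE (galerkinRHS (fun i => basisMat (c i) (Xhat i)) F) t₀ t₁ C ∧
    C t₀ = C0 ∧ C t₁ = C1

/-- The basis update and augmentation `Φ_τ^{(i)}`, for the subtree `σ = τ_i`: from the network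
`X0 = X_σ⁰`, the triangular factor `S` and the function `F = F_σ` to the network `Xhat` of `Û_σ`.
At a leaf, the differential equation is solved, and `Û_l` is an orthonormal basis of the range of
`(Y_l(t₁)ᵀ, U_l⁰)`. At an inner vertex, the rank-augmenting step is done recursively from
`Y_σ⁰ = X_σ⁰ ×₀ Sᵀ`, and the new connection tensor `Ĉ_σ` is given by an orthonormal basis of the
range of `(mat₀(Ĉ_σ¹)ᵀ, mat₀(Ĉ_σ⁰)ᵀ)`. -/
def BasisUpdate (t₀ t₁ : ℝ) : (σ : OTree 𝓛) → {s s' : ℕ} → TTN n σ s →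
    Matrix (Fin s) (Fin s) ℂ → (ℝ → TSpace n σ s → TSpace n σ s) → TTN n σ s' → Prop
  | .leaf l, s, _, X0, S, F, Xhat =>
      ∃ y : ℝ → TSpace n (.leaf l) s,
        SolvesODE F t₀ t₁ y ∧ y t₀ = toTensor (rootMul X0 S) ∧
        IsOrthBasisOfRange (basisMat (.leaf l) Xhat) (mat0T (y t₁)) (basisMat (.leaf l) X0)
  | .node c, _, _, X0, S, F, Xhat =>
      ∃ C0 C1,
        RankAugment (fun i => BasisUpdate t₀ t₁ (c i)) (rootMul X0 S) F t₀ t₁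
          Xhat.data.sub C0 C1 ∧
        IsOrthBasisOfRange (coreMat0T Xhat.data.core) (coreMat0T C1) (coreMat0T C0)

/-- The rank truncation `X = Θ_τ(Xhat, ϑ)`, recursively from the root to the leaves:
`C_τ = Ĉ_τ ⨉_i P_{τ_i}*` with the truncated matrices `P_{τ_i}` of left singular vectors of
`mat_i(Ĉ_τ)`, and `X_{τ_i} = Θ_{τ_i}(X̂_{τ_i} ×₀ P_{τ_i}ᵀ, ϑ)`, which at a leaf is
`U_l = Û_l P_l`. -/
def Truncation (ϑ : ℝ) : (τ : OTree 𝓛) → {r : ℕ} → TTN n τ r → TTN n τ r → Prop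
  | .leaf _, _, Xhat, X => X = Xhat
  | .node c, _, Xhat, X =>
      ∃ P : ∀ i, Matrix (Fin (Xhat.data.rank i)) (Fin (X.data.rank i)) ℂ,
        (∀ i : Fin _, IsTruncationBasis ϑ (matMode i Xhat.data.core) (P i)) ∧
        X.data.core = modeProd Xhat.data.core (fun i => (P i)ᴴ) ∧
        ∀ i, Truncation ϑ (c i) (rootMul (Xhat.data.sub i) (P i)) (X.data.sub i)

/-- One time step from `t₀` to `t₁` of the rank-adaptive integrator: the rank-augmenting step for
`F` gives `Ŷ¹ = Ĉ¹ ⨉_i Û_{τ_i}`, which is then truncated with tolerance `ϑ`. -/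
def IntegratorStep (F : ℝ → TSpace n (.node c) 1 → TSpace n (.node c) 1) (ϑ t₀ t₁ : ℝ)
    (Y0 Y1 : TTN n (.node c) 1) : Prop :=
  ∃ (Yhat : TTN n (.node c) 1) (C0 : Fin 1 → (∀ i, Fin (Yhat.data.rank i)) → ℂ),
    RankAugment (fun i => BasisUpdate t₀ t₁ (c i)) Y0 F t₀ t₁
      Yhat.data.sub C0 Yhat.data.core ∧
    Truncation ϑ (.node c) Yhat Y1

/-- The networks `Y 0, …, Y k` arise by `k` time steps of the rank-adaptive integrator with step
size `h` and tolerance `ϑ`. The starting network `Y 0` is orthonormal, and the starting network of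
each time step has full tree rank. The network `Y (j + 1)` is the truncated network, or an
orthonormal network of the same tensor (reorthonormalization is optional). -/
def IntegratorRun (F : ℝ → TSpace n (.node c) 1 → TSpace n (.node c) 1) (ϑ h : ℝ) (k : ℕ)
    (Y : ℕ → TTN n (.node c) 1) : Prop :=
  IsOrthonormal (.node c) (Y 0) ∧
  ∀ j < k, FullRank (.node c) (Y j) ∧
    ∃ Y1 : TTN n (.node c) 1,
      IntegratorStep F ϑ (j * h) ((j + 1) * h) (Y j) Y1 ∧
      (Y (j + 1) = Y1 ∨
        (IsOrthonormal (.node c) (Y (j + 1)) ∧ toTensor (Y (j + 1)) = toTensor Y1))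

end Integrator

end RankAdaptiveTTN

end

/-!
The increment of the numerical solution over one time step is compared with the increment of the
exact solution `A` itself. The function `F` need not be continuous in `t`, so that no solution through
the numerical value `Yʲ` is available; every estimate of an increment is a mean value inequality along
`A` or along one of the solutions that occur in the integrator.

The tensors tangent at `Yʲ` have an explicit form (`IsTangent`, `isTangent_of_mem_tangentSpaceAt`):
for each subtree `τ_i`, the `i`-th matricization is a tangent tensor of the subtree times the
environment of `τ_i`, plus a matrix with columns in the range of `U_{τ_i}`. Up to the errors `ε`,
`L ‖Yʲ - A(t_j)‖` and `L B h`, the velocity of `A` is tangent at `Yʲ`. In the rows orthogonal to the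
row space of the environment, the increment of `A` therefore lies in the range of `U_{τ_i}`, which
the augmented basis contains. In the other rows, it is the increment of the curve restricted to the
subtree, whose velocity is close to the restricted function `F_{τ_i}`, which is again nearly tangential
(`IsTangent.restrict`). By induction over the tree, the ranges of the augmented bases capture the
increments of all curves that move approximately with the function (`fro_defect_matI_le`,
`updateCaptures`): at a leaf because both endpoints of the solution on the leaf lie in the range, at
an inner vertex because those of the Galerkin approximation do. No singular value enters, since the
environment occurs only through the QR factor `Q_i`. This gives the error of the rank-augmenting step
(`RankAugment.spec_of_updateCaptures`).

The truncation changes the tensor by a multiple of `(1 + ‖Ŷ‖) ϑ`, and leaves bases whose Gram matrices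
differ from the identity by a multiple of `ϑ` (`Truncation.spec`). A network that is only nearly
orthonormal (`NearOrth`) suffices for the next step, as long as these Gram matrices have controlled
inverses (`exists_gram_inverse`), which holds if `c₃` is large enough. The errors of the single steps
(`IntegratorStep.error_le`) are summed by the discrete Gronwall inequality (`gronwall_step`), together
with the bound `‖Yʲ‖ ≤ ρ` that the assumption on `F` requires.
-/

noncomputable section

namespace RankAdaptiveTTN

/-! ### Frobenius norm and operator bounds of matrices -/

section MatrixNorms

variable {α β γ : Type*} [Fintype α] [Fintype β] [Fintype γ]

/-- The Frobenius norm, as the Euclidean norm of the family of entries. -/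
def fro (A : Matrix α β ℂ) : ℝ :=
  ‖(WithLp.toLp 2 fun p : α × β => A p.1 p.2 : EuclideanSpace ℂ (α × β))‖

/-- `M` has spectral norm at most `b`. -/
def OpBound (M : Matrix α β ℂ) (b : ℝ) : Prop :=
  ∀ x : β → ℂ, ‖(WithLp.toLp 2 (M *ᵥ x) : EuclideanSpace ℂ α)‖ ≤
    b * ‖(WithLp.toLp 2 x : EuclideanSpace ℂ β)‖

lemma fro_nonneg (A : Matrix α β ℂ) : 0 ≤ fro A := norm_nonneg _

lemma fro_sq (A : Matrix α β ℂ) : fro A ^ 2 = ∑ a, ∑ b, ‖A a b‖ ^ 2 := by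
  rw [fro, EuclideanSpace.norm_sq_eq, Fintype.sum_prod_type]

lemma fro_zero : fro (0 : Matrix α β ℂ) = 0 := by
  have := fro_sq (0 : Matrix α β ℂ)
  simpa using this

lemma fro_add_le (A B : Matrix α β ℂ) : fro (A + B) ≤ fro A + fro B :=
  norm_add_le (WithLp.toLp 2 fun p : α × β => A p.1 p.2 : EuclideanSpace ℂ (α × β))
    (WithLp.toLp 2 fun p : α × β => B p.1 p.2)

lemma fro_sub_le (A B : Matrix α β ℂ) : fro (A - B) ≤ fro A + fro B :=
  norm_sub_le (WithLp.toLp 2 fun p : α × β => A p.1 p.2 : EuclideanSpace ℂ (α × β))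
    (WithLp.toLp 2 fun p : α × β => B p.1 p.2)

lemma fro_eq_of_sq {α' β' : Type*} [Fintype α'] [Fintype β'] {A : Matrix α β ℂ}
    {B : Matrix α' β' ℂ} (h : ∑ a, ∑ b, ‖A a b‖ ^ 2 = ∑ a, ∑ b, ‖B a b‖ ^ 2) :
    fro A = fro B := by
  rw [← fro_sq, ← fro_sq] at h
  exact (pow_left_inj₀ (fro_nonneg _) (fro_nonneg _) two_ne_zero).1 h

lemma fro_conjTranspose (A : Matrix α β ℂ) : fro Aᴴ = fro A := by
  apply fro_eq_of_sq
  rw [Finset.sum_comm]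
  simp

lemma fro_sq_cols (A : Matrix α β ℂ) :
    fro A ^ 2 = ∑ b, ‖(WithLp.toLp 2 fun a => A a b : EuclideanSpace ℂ α)‖ ^ 2 := by
  rw [fro_sq, Finset.sum_comm]
  simp [EuclideanSpace.norm_sq_eq]

lemma OpBound.fro_mul_le {M : Matrix α β ℂ} {b : ℝ} (hM : OpBound M b) (hb : 0 ≤ b)
    (X : Matrix β γ ℂ) : fro (M * X) ≤ b * fro X := by
  refine le_of_sq_le_sq ?_ (mul_nonneg hb (fro_nonneg _))
  rw [mul_pow, fro_sq_cols, fro_sq_cols X, Finset.mul_sum]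
  refine Finset.sum_le_sum fun j _ => ?_
  rw [← mul_pow]
  exact pow_le_pow_left₀ (norm_nonneg _) (hM fun k => X k j) 2

/-- The spectral norm is at most the Frobenius norm. -/
lemma opBound_fro (M : Matrix α β ℂ) : OpBound M (fro M) := by
  intro x
  refine le_of_sq_le_sq ?_ (mul_nonneg (fro_nonneg _) (norm_nonneg _))
  rw [mul_pow, fro_sq, EuclideanSpace.norm_sq_eq, EuclideanSpace.norm_sq_eq, Finset.sum_mul]
  refine Finset.sum_le_sum fun a _ => ?_
  refine le_trans ?_ (Finset.sum_mul_sq_le_sq_mul_sq Finset.univ (fun b => ‖M a b‖) fun b => ‖x b‖)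
  refine pow_le_pow_left₀ (norm_nonneg _) ?_ 2
  refine (norm_sum_le _ _).trans (Finset.sum_le_sum fun b _ => ?_)
  rw [norm_mul]

/-- For a matrix with one column, Frobenius and spectral norm agree. -/
lemma OpBound.fro_le {M : Matrix α (Fin 1) ℂ} {b : ℝ} (hM : OpBound M b) : fro M ≤ b := by
  have h := hM fun _ => 1
  have h1 : ‖(WithLp.toLp 2 fun _ => 1 : EuclideanSpace ℂ (Fin 1))‖ = 1 := by
    simp [EuclideanSpace.norm_eq]
  rw [h1, mul_one] at h
  refine le_trans (le_of_eq ?_) h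
  rw [fro, EuclideanSpace.norm_eq, EuclideanSpace.norm_eq, Fintype.sum_prod_type]
  simp [Matrix.mulVec, dotProduct]

lemma OpBound.mono {M : Matrix α β ℂ} {a b : ℝ} (hM : OpBound M a) (h : a ≤ b) : OpBound M b :=
  fun x => (hM x).trans (mul_le_mul_of_nonneg_right h (norm_nonneg _))

lemma OpBound.mul {M : Matrix α β ℂ} {N : Matrix β γ ℂ} {a b : ℝ} (hM : OpBound M a)
    (hN : OpBound N b) (ha : 0 ≤ a) : OpBound (M * N) (a * b) := by
  intro x
  rw [← Matrix.mulVec_mulVec, mul_assoc]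
  exact (hM _).trans (mul_le_mul_of_nonneg_left (hN x) ha)

lemma OpBound.add {M N : Matrix α β ℂ} {a b : ℝ} (hM : OpBound M a)
    (hN : OpBound N b) : OpBound (M + N) (a + b) := by
  intro x
  rw [Matrix.add_mulVec, WithLp.toLp_add, add_mul]
  exact (norm_add_le _ _).trans (add_le_add (hM x) (hN x))

lemma OpBound.neg {M : Matrix α β ℂ} {a : ℝ} (hM : OpBound M a) : OpBound (-M) a := by
  intro x
  rw [Matrix.neg_mulVec, WithLp.toLp_neg, norm_neg]
  exact hM x

lemma OpBound.sub {M N : Matrix α β ℂ} {a b : ℝ} (hM : OpBound M a)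
    (hN : OpBound N b) : OpBound (M - N) (a + b) := by
  rw [sub_eq_add_neg]
  exact hM.add hN.neg

lemma opBound_one [DecidableEq α] : OpBound (1 : Matrix α α ℂ) 1 := by
  intro x
  rw [Matrix.one_mulVec, one_mul]

lemma opBound_zero : OpBound (0 : Matrix α β ℂ) 0 := by
  intro x
  simp

lemma inner_mulVec (M : Matrix α β ℂ) (x : β → ℂ) (y : α → ℂ) :
    inner ℂ (WithLp.toLp 2 (M *ᵥ x) : EuclideanSpace ℂ α) (WithLp.toLp 2 y) =
      inner ℂ (WithLp.toLp 2 x : EuclideanSpace ℂ β) (WithLp.toLp 2 (Mᴴ *ᵥ y)) := by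
  simp only [EuclideanSpace.inner_eq_star_dotProduct]
  rw [Matrix.star_mulVec, dotProduct_comm y, ← Matrix.dotProduct_mulVec, dotProduct_comm]

/-- `‖Mx‖² ≤ ‖x‖ ‖MᴴMx‖`. -/
lemma norm_mulVec_sq_le (M : Matrix α β ℂ) (x : β → ℂ) :
    ‖(WithLp.toLp 2 (M *ᵥ x) : EuclideanSpace ℂ α)‖ ^ 2 ≤
      ‖(WithLp.toLp 2 x : EuclideanSpace ℂ β)‖ *
        ‖(WithLp.toLp 2 ((Mᴴ * M) *ᵥ x) : EuclideanSpace ℂ β)‖ := by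
  rw [← Matrix.mulVec_mulVec, ← @inner_self_eq_norm_sq ℂ, inner_mulVec]
  exact (RCLike.re_le_norm _).trans (norm_inner_le_norm _ _)

lemma OpBound.conjTranspose {M : Matrix α β ℂ} {b : ℝ} (hM : OpBound M b) (hb : 0 ≤ b) :
    OpBound Mᴴ b := by
  intro x
  have h := norm_mulVec_sq_le Mᴴ x
  rw [Matrix.conjTranspose_conjTranspose, ← Matrix.mulVec_mulVec] at h
  have h2 := hM (Mᴴ *ᵥ x)
  have h3 := norm_nonneg (WithLp.toLp 2 x : EuclideanSpace ℂ α)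
  have h4 := norm_nonneg (WithLp.toLp 2 (Mᴴ *ᵥ x) : EuclideanSpace ℂ β)
  rcases h4.eq_or_lt with h0 | h0
  · rw [← h0]; positivity
  · have h5 := h.trans (mul_le_mul_of_nonneg_left h2 h3)
    nlinarith

lemma OpBound.fro_mul_right_le {M : Matrix β γ ℂ} {b : ℝ} (hM : OpBound M b) (hb : 0 ≤ b)
    (X : Matrix α β ℂ) : fro (X * M) ≤ fro X * b := by
  rw [← fro_conjTranspose, Matrix.conjTranspose_mul, ← fro_conjTranspose X, mul_comm]
  exact (hM.conjTranspose hb).fro_mul_le hb _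

lemma OpBound.of_gram {M : Matrix α β ℂ} {b : ℝ} (hb : 0 ≤ b) (h : OpBound (Mᴴ * M) (b ^ 2)) :
    OpBound M b := by
  intro x
  refine le_of_sq_le_sq ?_ (mul_nonneg hb (norm_nonneg _))
  have h1 := norm_mulVec_sq_le M x
  have h2 := h x
  have h3 := norm_nonneg (WithLp.toLp 2 x : EuclideanSpace ℂ β)
  nlinarith

lemma opBound_of_isometry [DecidableEq β] {M : Matrix α β ℂ} (h : Mᴴ * M = 1) : OpBound M 1 := by
  apply OpBound.of_gram zero_le_one
  rw [h, one_pow]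
  exact opBound_one

lemma OpBound.map_star {M : Matrix α β ℂ} {b : ℝ} (hM : OpBound M b) :
    OpBound (M.map star) b := by
  intro x
  have h := hM (star x)
  have e : M.map star *ᵥ x = star (M *ᵥ star x) := by
    ext i
    simp [Matrix.mulVec, dotProduct]
  have hs : ∀ {δ : Type _} [Fintype δ] (y : δ → ℂ),
      ‖(WithLp.toLp 2 (star y) : EuclideanSpace ℂ δ)‖ = ‖(WithLp.toLp 2 y : EuclideanSpace ℂ δ)‖ := by
    intro δ _ y
    simp [EuclideanSpace.norm_eq]
  rw [e, hs]
  have e2 : ‖(WithLp.toLp 2 (star x) : EuclideanSpace ℂ β)‖ =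
      ‖(WithLp.toLp 2 x : EuclideanSpace ℂ β)‖ := by
    simp [EuclideanSpace.norm_eq]
  rwa [e2] at h

/-- The complementary projection `1 - UUᴴ` of a matrix with orthonormal columns does not increase
the Frobenius norm by more than the factor `2`. -/
lemma fro_sub_proj_le [DecidableEq β] {U : Matrix α β ℂ} (hU : Uᴴ * U = 1) (X : Matrix α γ ℂ) :
    fro (X - U * (Uᴴ * X)) ≤ 2 * fro X := by
  have h1 := opBound_of_isometry hU
  have h2 := h1.fro_mul_le zero_le_one (Uᴴ * X)
  have h3 := (h1.conjTranspose zero_le_one).fro_mul_le zero_le_one X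
  have h4 := fro_sub_le X (U * (Uᴴ * X))
  linarith

/-- A matrix close to the identity is invertible, with controlled inverse. -/
lemma OpBound.exists_inverse [DecidableEq α] {W : Matrix α α ℂ} {a : ℝ}
    (hW : OpBound (1 - W) a) (ha2 : a ≤ 1 / 2) :
    ∃ W' : Matrix α α ℂ, W * W' = 1 ∧ W' * W = 1 ∧ OpBound W' 2 ∧ OpBound (1 - W') (2 * a) := by
  have lower : ∀ x : α → ℂ, ‖(WithLp.toLp 2 x : EuclideanSpace ℂ α)‖ ≤
      2 * ‖(WithLp.toLp 2 (W *ᵥ x) : EuclideanSpace ℂ α)‖ := by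
    intro x
    have h := hW x
    rw [Matrix.sub_mulVec, Matrix.one_mulVec, WithLp.toLp_sub] at h
    have h2 := norm_sub_norm_le (WithLp.toLp 2 x : EuclideanSpace ℂ α) (WithLp.toLp 2 (W *ᵥ x))
    have h3 := norm_nonneg (WithLp.toLp 2 x : EuclideanSpace ℂ α)
    nlinarith
  have hinj : Function.Injective W.mulVec := by
    intro x y hxy
    have h := lower (x - y)
    rw [Matrix.mulVec_sub, show W *ᵥ x = W *ᵥ y from hxy, sub_self] at h
    simp only [WithLp.toLp_zero, norm_zero, mul_zero] at h
    have h0 := norm_le_zero_iff.1 h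
    rw [WithLp.toLp_eq_zero] at h0
    exact sub_eq_zero.1 h0
  have hu := Matrix.mulVec_injective_iff_isUnit.1 hinj
  have hdet := (Matrix.isUnit_iff_isUnit_det _).1 hu
  have h1 := Matrix.mul_nonsing_inv W hdet
  have h2 := Matrix.nonsing_inv_mul W hdet
  have hb : OpBound W⁻¹ 2 := by
    intro x
    have h := lower (W⁻¹ *ᵥ x)
    rwa [Matrix.mulVec_mulVec, h1, Matrix.one_mulVec] at h
  refine ⟨W⁻¹, h1, h2, hb, ?_⟩
  have e : 1 - W⁻¹ = -(W⁻¹ * (1 - W)) := by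
    rw [mul_sub, h2, mul_one]; abel
  rw [e]
  exact (hb.mul hW zero_le_two).neg

end MatrixNorms

/-- Mean value inequality for linear images of a curve. -/
lemma fro_linear_sub_le {E : Type*} [NormedAddCommGroup E] [NormedSpace ℝ E] [FiniteDimensional ℝ E]
    {α β : Type*} [Fintype α] [Fintype β] (ℓ : E →ₗ[ℝ] Matrix α β ℂ) {z z' : ℝ → E}
    {t₀ t₁ C : ℝ} (hz : ∀ t ∈ Icc t₀ t₁, HasDerivWithinAt z (z' t) (Icc t₀ t₁) t)
    (hC : ∀ t ∈ Icc t₀ t₁, fro (ℓ (z' t)) ≤ C) {s t : ℝ} (hs : s ∈ Icc t₀ t₁)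
    (ht : t ∈ Icc t₀ t₁) (hst : s ≤ t) :
    fro (ℓ (z t - z s)) ≤ C * (t - s) := by
  let ψ : Matrix α β ℂ →ₗ[ℝ] EuclideanSpace ℂ (α × β) :=
    { toFun := fun A => WithLp.toLp 2 fun p : α × β => A p.1 p.2
      map_add' := fun _ _ => rfl
      map_smul' := fun _ _ => rfl }
  let Λ : E →L[ℝ] EuclideanSpace ℂ (α × β) := LinearMap.toContinuousLinearMap (ψ ∘ₗ ℓ)
  have h := Convex.norm_image_sub_le_of_norm_hasDerivWithin_le (f := Λ ∘ z)
    (f' := fun t => Λ (z' t)) (s := Icc t₀ t₁) (C := C)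
    (fun t ht => Λ.hasFDerivAt.comp_hasDerivWithinAt t (hz t ht)) (fun t ht => hC t ht)
    (convex_Icc t₀ t₁) hs ht
  rw [Real.norm_of_nonneg (sub_nonneg.2 hst), Function.comp, Function.comp, ← map_sub] at h
  exact h

/-! ### Tensor products of matrices and matricizations -/

lemma fro_col {α : Type*} [Fintype α] (X : Matrix α (Fin 1) ℂ) :
    fro X = ‖(WithLp.toLp 2 fun a => X a 0 : EuclideanSpace ℂ α)‖ := by
  refine (pow_left_inj₀ (fro_nonneg _) (norm_nonneg _) two_ne_zero).1 ?_
  rw [fro_sq_cols]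
  simp

lemma OpBound.of_fro_mul_le {α β : Type*} [Fintype α] [Fintype β] {M : Matrix α β ℂ} {b : ℝ}
    (h : ∀ X : Matrix β (Fin 1) ℂ, fro (M * X) ≤ b * fro X) : OpBound M b := by
  intro x
  have h1 := h (Matrix.of fun b _ => x b)
  rw [fro_col, fro_col] at h1
  exact h1

lemma piSplitAt_symm_self {ι : Type*} [DecidableEq ι] {α : ι → Type*} (i : ι)
    (p : α i × ∀ j : {j // j ≠ i}, α j) :
    (Equiv.piSplitAt i α).symm p i = p.1 := by
  simp [Equiv.piSplitAt_symm_apply]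

lemma piSplitAt_symm_ne {ι : Type*} [DecidableEq ι] {α : ι → Type*} (i : ι)
    (p : α i × ∀ j : {j // j ≠ i}, α j) (j : {j // j ≠ i}) :
    (Equiv.piSplitAt i α).symm p j = p.2 j := by
  rw [Equiv.piSplitAt_symm_apply, dif_neg j.2]

section Kron

variable {κ ι : Type*} [Fintype ι] {α β γ : ι → Type*}

/-- The tensor product `⨂_i M_i`, acting on all modes other than mode `0`. -/
def kr (M : ∀ i, Matrix (β i) (α i) ℂ) : Matrix (∀ i, β i) (∀ i, α i) ℂ :=
  Matrix.of fun b a => ∏ i, M i (b i) (a i)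

lemma coreMat0T_modeProd [DecidableEq ι] [∀ i, Fintype (α i)] (C : κ → (∀ i, α i) → ℂ)
    (M : ∀ i, Matrix (β i) (α i) ℂ) : coreMat0T (modeProd C M) = kr M * coreMat0T C := by
  ext b k
  simp only [coreMat0T, modeProd, kr, Matrix.mul_apply, Matrix.of_apply]
  exact Finset.sum_congr rfl fun a _ => mul_comm _ _

lemma kr_mul [DecidableEq ι] [∀ i, Fintype (α i)] (M : ∀ i, Matrix (β i) (α i) ℂ)
    (N : ∀ i, Matrix (α i) (γ i) ℂ) : kr M * kr N = kr fun i => M i * N i := by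
  ext b a
  simp only [kr, Matrix.mul_apply, Matrix.of_apply]
  rw [Finset.prod_univ_sum, Fintype.piFinset_univ]
  exact Finset.sum_congr rfl fun c _ => Finset.prod_mul_distrib.symm

lemma kr_conjTranspose (M : ∀ i, Matrix (β i) (α i) ℂ) : (kr M)ᴴ = kr fun i => (M i)ᴴ := by
  ext b a
  simp [kr, Matrix.conjTranspose_apply]

lemma kr_one [∀ i, DecidableEq (α i)] : kr (fun i => (1 : Matrix (α i) (α i) ℂ)) = 1 := by
  ext b a
  simp only [kr, Matrix.of_apply, Matrix.one_apply]
  by_cases h : b = a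
  · simp [h]
  · obtain ⟨i, hi⟩ := Function.ne_iff.1 h
    rw [if_neg h]
    exact Finset.prod_eq_zero (Finset.mem_univ i) (if_neg hi)

variable [DecidableEq ι]

lemma isometry_kr [∀ i, DecidableEq (α i)] [∀ i, Fintype (β i)]
    {M : ∀ i, Matrix (β i) (α i) ℂ}
    (hM : ∀ i, (M i)ᴴ * M i = 1) : (kr M)ᴴ * kr M = 1 := by
  rw [kr_conjTranspose, kr_mul]
  simp only [hM, kr_one]

/-- The modes other than `i`, including mode `0`, of the tensor `C ×₀ I ⨉_j M_j`. -/
def envMat (κ : Type*) [DecidableEq κ] (i : ι) (M : ∀ i, Matrix (β i) (α i) ℂ) :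
    Matrix (κ × ∀ j : {j // j ≠ i}, β j) (κ × ∀ j : {j // j ≠ i}, α j) ℂ :=
  Matrix.kroneckerMap (· * ·) (1 : Matrix κ κ ℂ) (kr fun j : {j // j ≠ i} => M j)

lemma kr_piSplitAt (M : ∀ i, Matrix (β i) (α i) ℂ) (i : ι)
    (p : β i × ∀ j : {j // j ≠ i}, β j) (q : α i × ∀ j : {j // j ≠ i}, α j) :
    kr M ((Equiv.piSplitAt i β).symm p) ((Equiv.piSplitAt i α).symm q) =
      M i p.1 q.1 * kr (fun j : {j // j ≠ i} => M j) p.2 q.2 := by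
  change ∏ j, M j ((Equiv.piSplitAt i β).symm p j) ((Equiv.piSplitAt i α).symm q j) =
    M i p.1 q.1 * ∏ j : {j // j ≠ i}, M j (p.2 j) (q.2 j)
  rw [Fintype.prod_eq_mul_prod_subtype_ne _ i, piSplitAt_symm_self, piSplitAt_symm_self]
  congr 1
  exact Finset.prod_congr rfl fun j _ => by rw [piSplitAt_symm_ne, piSplitAt_symm_ne]

lemma matMode_modeProd [∀ i, Fintype (α i)] [Fintype κ] [DecidableEq κ]
    (C : κ → (∀ i, α i) → ℂ) (M : ∀ i, Matrix (β i) (α i) ℂ) (i : ι) :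
    matMode i (modeProd C M) = M i * matMode i C * (envMat κ i M)ᵀ := by
  ext b p
  have e1 : matMode i (modeProd C M) b p = ∑ q : α i × ∀ j : {j // j ≠ i}, α j,
      C p.1 ((Equiv.piSplitAt i α).symm q) *
        (M i b q.1 * kr (fun j : {j // j ≠ i} => M j) p.2 q.2) := by
    have : matMode i (modeProd C M) b p = ∑ a, C p.1 a *
      kr M ((Equiv.piSplitAt i β).symm (b, p.2)) a := rfl
    rw [this, ← (Equiv.piSplitAt i α).symm.sum_comp]
    exact Finset.sum_congr rfl fun q _ => by rw [kr_piSplitAt]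
  have e2 : (M i * matMode i C * (envMat κ i M)ᵀ) b p =
      ∑ q : κ × ∀ j : {j // j ≠ i}, α j, (∑ a, M i b a *
        C q.1 ((Equiv.piSplitAt i α).symm (a, q.2))) *
        ((1 : Matrix κ κ ℂ) p.1 q.1 * kr (fun j : {j // j ≠ i} => M j) p.2 q.2) := rfl
  rw [e1, e2, Fintype.sum_prod_type, Fintype.sum_prod_type, Finset.sum_comm,
    Finset.sum_eq_single p.1]
  · refine Finset.sum_congr rfl fun y _ => ?_
    rw [Finset.sum_mul]
    refine Finset.sum_congr rfl fun a _ => ?_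
    rw [Matrix.one_apply_eq]
    ring
  · intro k _ hk
    refine Finset.sum_eq_zero fun y _ => ?_
    rw [Matrix.one_apply_ne (Ne.symm hk), zero_mul, mul_zero]
  · intro h
    exact absurd (Finset.mem_univ _) h

lemma fro_matMode [∀ i, Fintype (α i)] [Fintype κ] (C : κ → (∀ i, α i) → ℂ) (i : ι) :
    fro (matMode i C) = fro (coreMat0T C) := by
  apply fro_eq_of_sq
  simp only [matMode, coreMat0T, Matrix.of_apply]
  rw [← (Equiv.piSplitAt i α).symm.sum_comp, Fintype.sum_prod_type]
  refine Finset.sum_congr rfl fun a _ => ?_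
  rw [Fintype.sum_prod_type, Finset.sum_comm]

lemma envMat_one [DecidableEq κ] [∀ i, DecidableEq (α i)] (i : ι)
    {M : ∀ i, Matrix (α i) (α i) ℂ} (hM : ∀ j, j ≠ i → M j = 1) :
    envMat κ i M = 1 := by
  have : (fun j : {j // j ≠ i} => M j) = fun _ => 1 := funext fun j => hM j j.2
  rw [envMat, this, kr_one, Matrix.one_kronecker_one]

variable [∀ i, Fintype (α i)] [∀ i, Fintype (β i)]

/-- The action of a matrix on mode `i` only, in terms of the `i`-th matricization. -/
lemma matMode_modeProd_update [∀ i, DecidableEq (α i)] [Fintype κ] [DecidableEq κ]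
    (C : κ → (∀ i, α i) → ℂ) (i : ι) (N : Matrix (α i) (α i) ℂ) :
    matMode i (modeProd C (Function.update (fun _ => 1) i N)) = N * matMode i C := by
  rw [matMode_modeProd, envMat_one i fun j hj => Function.update_of_ne hj _ _,
    Function.update_self, Matrix.transpose_one, Matrix.mul_one]

lemma opBound_kr_update [∀ i, DecidableEq (α i)] (i : ι) {N : Matrix (α i) (α i) ℂ} {b : ℝ}
    (hN : OpBound N b) (hb : 0 ≤ b) : OpBound (kr (Function.update (fun _ => 1) i N)) b := by
  refine OpBound.of_fro_mul_le fun X => ?_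
  have h := hN.fro_mul_le hb (matMode i fun k a => X a k)
  rw [← matMode_modeProd_update, fro_matMode, fro_matMode, coreMat0T_modeProd] at h
  exact h

lemma opBound_kr_mem [∀ i, DecidableEq (α i)] {N : ∀ i, Matrix (α i) (α i) ℂ} {b : ι → ℝ}
    (hN : ∀ i, OpBound (N i) (b i)) (hb : ∀ i, 0 ≤ b i) (s : Finset ι) :
    OpBound (kr fun i => if i ∈ s then N i else 1) (∏ i ∈ s, b i) := by
  induction s using Finset.induction_on with
  | empty =>
    simp only [Finset.notMem_empty, if_false, kr_one, Finset.prod_empty]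
    exact opBound_one
  | insert a s ha ih =>
    have e : kr (fun i => if i ∈ insert a s then N i else 1) =
        kr (Function.update (fun _ => 1) a (N a)) * kr fun i => if i ∈ s then N i else 1 := by
      rw [kr_mul]
      congr 1
      funext i
      by_cases hi : i = a
      · subst hi; simp [ha]
      · simp [hi]
    rw [e, Finset.prod_insert ha]
    exact (opBound_kr_update a (hN a) (hb a)).mul ih (hb a)

/-- The spectral norm of a tensor product is at most the product of the spectral norms. -/
lemma opBound_kr {M : ∀ i, Matrix (β i) (α i) ℂ} {b : ι → ℝ}
    (hM : ∀ i, OpBound (M i) (b i)) (hb : ∀ i, 0 ≤ b i) : OpBound (kr M) (∏ i, b i) := by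
  classical
  refine OpBound.of_gram (Finset.prod_nonneg fun i _ => hb i) ?_
  rw [kr_conjTranspose, kr_mul, ← Finset.prod_pow]
  have h := opBound_kr_mem (N := fun i => (M i)ᴴ * M i) (b := fun i => b i ^ 2)
    (fun i => by rw [sq]; exact ((hM i).conjTranspose (hb i)).mul (hM i) (hb i))
    (fun i => sq_nonneg _) Finset.univ
  simpa using h

lemma opBound_kr_one {M : ∀ i, Matrix (β i) (α i) ℂ} (hM : ∀ i, OpBound (M i) 1) :
    OpBound (kr M) 1 := by
  simpa using opBound_kr hM fun _ => zero_le_one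

/-- Tensor products of contractions depend on the factors in a Lipschitz continuous way. -/
lemma opBound_kr_sub {M N : ∀ i, Matrix (β i) (α i) ℂ} {b : ι → ℝ}
    (hM : ∀ i, OpBound (M i) 1) (hN : ∀ i, OpBound (N i) 1)
    (h : ∀ i, OpBound (M i - N i) (b i)) (hb : ∀ i, 0 ≤ b i) :
    OpBound (kr M - kr N) (∑ i, b i) := by
  have key : ∀ s : Finset ι,
      OpBound ((kr fun i => if i ∈ s then M i else N i) - kr N) (∑ i ∈ s, b i) := by
    intro s
    induction s using Finset.induction_on with
    | empty => simpa using (opBound_zero (α := ∀ i, β i) (β := ∀ i, α i))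
    | insert a s ha ih =>
      rw [Finset.sum_insert ha]
      have e : (kr fun i => if i ∈ insert a s then M i else N i) - kr N =
          kr (Function.update (fun i => if i ∈ s then M i else N i) a (M a - N a)) +
            ((kr fun i => if i ∈ s then M i else N i) - kr N) := by
        rw [← add_sub_assoc]
        congr 1
        ext x y
        simp only [kr, Matrix.add_apply, Matrix.of_apply]
        rw [Fintype.prod_eq_mul_prod_subtype_ne _ a, Fintype.prod_eq_mul_prod_subtype_ne _ a,
          Fintype.prod_eq_mul_prod_subtype_ne _ a]
        have e1 : ∀ j : {j // j ≠ a}, (j.1 ∈ insert a s) = (j.1 ∈ s) := fun j => by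
          simp [j.2]
        have e2 : ∀ j : {j // j ≠ a}, Function.update (fun i => if i ∈ s then M i else N i) a
            (M a - N a) j = if j.1 ∈ s then M j else N j := fun j => Function.update_of_ne j.2 _ _
        simp only [e1, e2, Function.update_self, ha, Finset.mem_insert_self, if_true, if_false,
          Matrix.sub_apply]
        ring
      rw [e]
      refine OpBound.add ?_ ih
      have h3 := opBound_kr (M := Function.update (fun i => if i ∈ s then M i else N i) a
          (M a - N a)) (b := Function.update (fun _ => 1) a (b a)) ?_ ?_
      · rwa [Finset.prod_update_of_mem (Finset.mem_univ _), Finset.prod_const_one, mul_one] at h3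
      · intro i
        by_cases hi : i = a
        · subst hi; simpa using h i
        · rw [Function.update_of_ne hi, Function.update_of_ne hi]
          split_ifs
          exacts [hM i, hN i]
      · intro i
        by_cases hi : i = a
        · subst hi; simpa using hb i
        · rw [Function.update_of_ne hi]; exact zero_le_one
  simpa using key Finset.univ

/-- The error of the projection in all modes is bounded by the sum of the errors of the projections
in the single modes: the projections onto the single modes are contractions, and they are applied
one after the other. -/
lemma fro_sub_kr_proj_le [∀ i, DecidableEq (α i)] [Fintype κ] [DecidableEq κ]
    {U : ∀ i, Matrix (β i) (α i) ℂ} (hU : ∀ i, (U i)ᴴ * U i = 1) (C : κ → (∀ i, β i) → ℂ) :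
    fro (coreMat0T C - kr U * ((kr U)ᴴ * coreMat0T C)) ≤
      ∑ i, fro (matMode i C - U i * ((U i)ᴴ * matMode i C)) := by
  classical
  have hP : ∀ i, OpBound (U i * (U i)ᴴ) 1 := fun i => by
    have h := opBound_of_isometry (hU i)
    simpa using h.mul (h.conjTranspose zero_le_one) zero_le_one
  have key : ∀ s : Finset ι,
      fro (coreMat0T C - (kr fun i => if i ∈ s then U i * (U i)ᴴ else 1) * coreMat0T C) ≤
        ∑ i ∈ s, fro (matMode i C - U i * ((U i)ᴴ * matMode i C)) := by
    intro s
    induction s using Finset.induction_on with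
    | empty => simp [kr_one, fro_zero]
    | insert a s ha ih =>
      set K := kr fun i => if i ∈ s then U i * (U i)ᴴ else 1 with hK
      set E := kr (Function.update (fun i => (1 : Matrix (β i) (β i) ℂ)) a (U a * (U a)ᴴ)) with hE
      have e : kr (fun i => if i ∈ insert a s then U i * (U i)ᴴ else 1) = K * E := by
        rw [hK, hE, kr_mul]
        congr 1
        funext i
        by_cases hi : i = a
        · subst hi; simp [ha]
        · simp [hi]
      have e2 : coreMat0T C - K * E * coreMat0T C =
          K * (coreMat0T C - E * coreMat0T C) + (coreMat0T C - K * coreMat0T C) := by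
        rw [Matrix.mul_sub, Matrix.mul_assoc]; abel
      have hK1 : OpBound K 1 := opBound_kr_one fun i => by
        split_ifs
        exacts [hP i, opBound_one]
      rw [e, e2, Finset.sum_insert ha]
      refine (fro_add_le _ _).trans (add_le_add ?_ ih)
      refine (hK1.fro_mul_le zero_le_one _).trans (le_of_eq ?_)
      rw [one_mul, hE, ← coreMat0T_modeProd]
      have e3 := fro_matMode (C - modeProd C (Function.update (fun _ => 1) a (U a * (U a)ᴴ))) a
      have e4 : matMode a (C - modeProd C (Function.update (fun _ => 1) a (U a * (U a)ᴴ))) =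
          matMode a C - matMode a (modeProd C (Function.update (fun _ => 1) a (U a * (U a)ᴴ))) :=
        rfl
      rw [e4, matMode_modeProd_update, Matrix.mul_assoc] at e3
      exact e3.symm
  have h := key Finset.univ
  simp only [Finset.mem_univ, if_true] at h
  rw [← kr_mul, Matrix.mul_assoc, ← kr_conjTranspose] at h
  exact h

end Kron

/-- The spectral norm of `1 ⊗ K`. -/
lemma OpBound.one_kronecker {κ α β : Type*} [Fintype κ] [DecidableEq κ] [Fintype α] [Fintype β]
    {K : Matrix α β ℂ} {b : ℝ} (hK : OpBound K b) (hb : 0 ≤ b) :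
    OpBound (Matrix.kroneckerMap (· * ·) (1 : Matrix κ κ ℂ) K) b := by
  refine OpBound.of_fro_mul_le fun X => ?_
  have h := hK.fro_mul_le hb (Matrix.of fun b k => X (k, b) 0)
  refine le_trans (le_of_eq ?_) (h.trans (le_of_eq ?_))
  · apply fro_eq_of_sq
    rw [Fintype.sum_prod_type, Finset.sum_comm]
    refine Finset.sum_congr rfl fun a _ => Finset.sum_congr rfl fun k _ => ?_
    simp [Matrix.mul_apply, Fintype.sum_prod_type, Matrix.one_apply]
  · congr 1
    apply fro_eq_of_sq
    rw [Fintype.sum_prod_type, Finset.sum_comm]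
    simp

/-! ### Matricizations in the tensor spaces of a tree -/

variable {𝓛 : Type*} {n : 𝓛 → ℕ}

/-- The tensor with `mat₀(Y)ᵀ = A`. -/
def ofMat0T {τ : OTree 𝓛} {r : ℕ} (A : Matrix (Idx n τ) (Fin r) ℂ) : TSpace n τ r :=
  WithLp.toLp 2 fun p => A p.2 p.1

lemma mat0T_ofMat0T {τ : OTree 𝓛} {r : ℕ} (A : Matrix (Idx n τ) (Fin r) ℂ) :
    mat0T (ofMat0T A) = A := rfl

lemma ofMat0T_mat0T {τ : OTree 𝓛} {r : ℕ} (Y : TSpace n τ r) : ofMat0T (mat0T Y) = Y := rfl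

lemma mat0T_toTensor {τ : OTree 𝓛} {r : ℕ} (X : TTN n τ r) :
    mat0T (toTensor X) = basisMat τ X := rfl

lemma fro_mat0T {τ : OTree 𝓛} {r : ℕ} (Y : TSpace n τ r) : fro (mat0T Y) = ‖Y‖ := by
  refine (pow_left_inj₀ (fro_nonneg _) (norm_nonneg _) two_ne_zero).1 ?_
  rw [fro_sq, Finset.sum_comm, EuclideanSpace.norm_sq_eq, Fintype.sum_prod_type]
  rfl

lemma mat0T_add {τ : OTree 𝓛} {r : ℕ} (Y Z : TSpace n τ r) :
    mat0T (Y + Z) = mat0T Y + mat0T Z := rfl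

lemma mat0T_sub {τ : OTree 𝓛} {r : ℕ} (Y Z : TSpace n τ r) :
    mat0T (Y - Z) = mat0T Y - mat0T Z := rfl

lemma mat0T_injective {τ : OTree 𝓛} {r : ℕ} {Y Z : TSpace n τ r} (h : mat0T Y = mat0T Z) :
    Y = Z := by
  rw [← ofMat0T_mat0T Y, h, ofMat0T_mat0T]

section Node

variable {m : ℕ} {c : Fin m → OTree 𝓛} {r s : ℕ}

/-- The `i`-th matricization of a tensor in `𝒱_τ`, `τ = (τ₁, …, τ_m)`. -/
def matI (i : Fin m) (Z : TSpace n (.node c) r) :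
    Matrix (Idx n (c i)) (Fin r × ∀ j : {j // j ≠ i}, Idx n (c j)) ℂ :=
  matMode i fun k (x : ∀ i, Idx n (c i)) => Z (k, x)

lemma matI_add (i : Fin m) (Y Z : TSpace n (.node c) r) :
    matI i (Y + Z) = matI i Y + matI i Z := rfl

lemma matI_sub (i : Fin m) (Y Z : TSpace n (.node c) r) :
    matI i (Y - Z) = matI i Y - matI i Z := rfl

lemma matI_smul (i : Fin m) (a : ℂ) (Z : TSpace n (.node c) r) :
    matI i (a • Z) = a • matI i Z := rfl

lemma fro_matI (i : Fin m) (Z : TSpace n (.node c) r) : fro (matI i Z) = ‖Z‖ := by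
  rw [← fro_mat0T]
  exact fro_matMode (fun k (x : ∀ i, Idx n (c i)) => Z (k, x)) i

lemma basisMat_node (X : TTN n (.node c) r) :
    basisMat (.node c) X =
      kr (fun i => basisMat (c i) (X.data.sub i)) * coreMat0T X.data.core := by
  rw [← coreMat0T_modeProd]
  rfl

lemma matI_toTensor (X : TTN n (.node c) r) (i : Fin m) :
    matI i (toTensor X) = basisMat (c i) (X.data.sub i) * (matMode i X.data.core *
      (envMat (Fin r) i fun j => basisMat (c j) (X.data.sub j))ᵀ) := by
  rw [← Matrix.mul_assoc]
  exact matMode_modeProd X.data.core (fun j => basisMat (c j) (X.data.sub j)) i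

lemma prolMat_eq {rk : Fin m → ℕ} (U : ∀ j, Matrix (Idx n (c j)) (Fin (rk j)) ℂ) (i : Fin m)
    (Q : Matrix (Fin r × ∀ j : {j // j ≠ i}, Fin (rk j)) (Fin (rk i)) ℂ) :
    prolMat U i Q = envMat (Fin r) i U * Q := by
  ext p q
  simp only [prolMat, modeProd, Matrix.of_apply, Matrix.mul_apply, envMat,
    Matrix.kroneckerMap_apply, kr, Fintype.sum_prod_type]
  rw [Finset.sum_eq_single p.1]
  · exact Finset.sum_congr rfl fun a _ => by rw [Matrix.one_apply_eq, one_mul, mul_comm]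
  · intro k _ hk
    exact Finset.sum_eq_zero fun a _ => by rw [Matrix.one_apply_ne (Ne.symm hk)]; ring
  · intro h
    exact absurd (Finset.mem_univ _) h

lemma mat0T_restriction (i : Fin m)
    (V : Matrix (Fin r × ∀ j : {j // j ≠ i}, Idx n (c j)) (Fin s) ℂ)
    (Z : TSpace n (.node c) r) : mat0T (restriction i V Z) = matI i Z * V.map star := rfl

lemma matI_prolongation (i : Fin m)
    (V : Matrix (Fin r × ∀ j : {j // j ≠ i}, Idx n (c j)) (Fin s) ℂ)
    (Y : TSpace n (c i) s) : matI i (prolongation i V Y) = mat0T Y * Vᵀ := by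
  ext x p
  change ∑ q, V (p.1, fun j : {j // j ≠ i} =>
      (Equiv.piSplitAt i fun j => Idx n (c j)).symm (x, p.2) j) q *
    Y (q, (Equiv.piSplitAt i fun j => Idx n (c j)).symm (x, p.2) i) = ∑ q, Y (q, x) * V p q
  refine Finset.sum_congr rfl fun q _ => ?_
  have e : (fun j : {j // j ≠ i} =>
      (Equiv.piSplitAt i fun j => Idx n (c j)).symm (x, p.2) j) = p.2 :=
    funext fun j => piSplitAt_symm_ne (α := fun j => Idx n (c j)) i (x, p.2) j
  rw [e, piSplitAt_symm_self (α := fun j => Idx n (c j)) i (x, p.2), mul_comm]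

lemma matI_injective (i : Fin m) {Y Z : TSpace n (.node c) r} (h : matI i Y = matI i Z) :
    Y = Z := by
  have h2 := fro_matI i (Y - Z)
  rw [matI_sub, h, sub_self, fro_zero] at h2
  exact sub_eq_zero.1 (norm_eq_zero.1 h2.symm)

end Node

/-! ### Multiplication at the root -/

section RootMul

variable {κ κ' κ'' α δ : Type*} [Fintype κ]

/-- Multiplication of the component of the column index that belongs to mode `0`. -/
def rmul0 (A : Matrix α (κ × δ) ℂ) (S : Matrix κ κ' ℂ) : Matrix α (κ' × δ) ℂ :=
  Matrix.of fun a p => ∑ k, S k p.1 * A a (k, p.2)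

lemma rmul0_mul {β : Type*} [Fintype β] (A : Matrix α β ℂ) (B : Matrix β (κ × δ) ℂ)
    (S : Matrix κ κ' ℂ) : rmul0 (A * B) S = A * rmul0 B S := by
  ext a p
  simp only [rmul0, Matrix.mul_apply, Matrix.of_apply, Finset.mul_sum]
  rw [Finset.sum_comm]
  exact Finset.sum_congr rfl fun _ _ => Finset.sum_congr rfl fun _ _ => by ring

lemma rmul0_add (A B : Matrix α (κ × δ) ℂ) (S : Matrix κ κ' ℂ) :
    rmul0 (A + B) S = rmul0 A S + rmul0 B S := by
  ext a p
  simp [rmul0, mul_add, Finset.sum_add_distrib]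

lemma rmul0_rmul0 [Fintype κ'] (A : Matrix α (κ × δ) ℂ) (S : Matrix κ κ' ℂ)
    (S' : Matrix κ' κ'' ℂ) : rmul0 (rmul0 A S) S' = rmul0 A (S * S') := by
  ext a p
  simp only [rmul0, Matrix.mul_apply, Matrix.of_apply, Finset.mul_sum, Finset.sum_mul]
  rw [Finset.sum_comm]
  exact Finset.sum_congr rfl fun _ _ => Finset.sum_congr rfl fun _ _ => by ring

lemma rmul0_one [DecidableEq κ] (A : Matrix α (κ × δ) ℂ) : rmul0 A 1 = A := by
  ext a p
  simp [rmul0, Matrix.one_apply]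

lemma rmul0_mul_envMat {ι : Type*} [Fintype ι] [DecidableEq ι] {β γ : ι → Type*}
    [∀ i, Fintype (γ i)] [DecidableEq κ] [Fintype κ'] [DecidableEq κ'] (i : ι)
    (A : Matrix α (κ × ∀ j : {j // j ≠ i}, γ j) ℂ) (M : ∀ i, Matrix (β i) (γ i) ℂ)
    (S : Matrix κ κ' ℂ) :
    rmul0 (A * (envMat κ i M)ᵀ) S = rmul0 A S * (envMat κ' i M)ᵀ := by
  ext a p
  simp only [rmul0, Matrix.mul_apply, Matrix.of_apply, envMat, Matrix.transpose_apply,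
    Matrix.kroneckerMap_apply, Fintype.sum_prod_type, Matrix.one_apply, ite_mul, one_mul, zero_mul,
    mul_ite, mul_zero]
  have h1 : ∀ (k : κ) (f : κ → (∀ j : {j // j ≠ i}, γ j) → ℂ),
      ∑ k', ∑ y, (if k = k' then f k' y else 0) = ∑ y, f k y := fun k f => by
    rw [Finset.sum_comm]; simp
  have h2 : ∀ (k : κ') (f : κ' → (∀ j : {j // j ≠ i}, γ j) → ℂ),
      ∑ k', ∑ y, (if k = k' then f k' y else 0) = ∑ y, f k y := fun k f => by
    rw [Finset.sum_comm]; simp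
  simp only [h1, h2, Finset.mul_sum, Finset.sum_mul]
  rw [Finset.sum_comm]
  exact Finset.sum_congr rfl fun _ _ => Finset.sum_congr rfl fun _ _ => by ring

lemma rank_rmul0_le [DecidableEq κ] [Fintype κ'] [Fintype δ] (A : Matrix α (κ × δ) ℂ)
    (S : Matrix κ κ' ℂ) : (rmul0 A S).rank ≤ A.rank := by
  classical
  have : rmul0 A S = A * rmul0 (1 : Matrix (κ × δ) (κ × δ) ℂ) S := by rw [← rmul0_mul, Matrix.mul_one]
  rw [this]
  exact Matrix.rank_mul_le_left _ _

lemma rank_rmul0 [DecidableEq κ] [Fintype δ] (A : Matrix α (κ × δ) ℂ)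
    {S : Matrix κ κ ℂ} (hS : IsUnit S.det) : (rmul0 A S).rank = A.rank := by
  refine le_antisymm (rank_rmul0_le A S) ?_
  have h := rank_rmul0_le (rmul0 A S) S⁻¹
  rwa [rmul0_rmul0, Matrix.mul_nonsing_inv _ hS, rmul0_one] at h

end RootMul

lemma coreMat0T_rootMul {m : ℕ} {c : Fin m → OTree 𝓛} {r s : ℕ} (X : TTN n (.node c) r)
    (S : Matrix (Fin r) (Fin s) ℂ) :
    coreMat0T (TTN.data (rootMul X S)).core = coreMat0T X.data.core * S := by
  ext a q
  change ∑ k, S k q * X.data.core k a = ∑ k, X.data.core k a * S k q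
  exact Finset.sum_congr rfl fun _ _ => mul_comm _ _

lemma basisMat_rootMul {τ : OTree 𝓛} {r s : ℕ} (X : TTN n τ r) (S : Matrix (Fin r) (Fin s) ℂ) :
    basisMat τ (rootMul X S) = basisMat τ X * S := by
  cases τ with
  | leaf l => rfl
  | node c =>
    rw [basisMat_node, basisMat_node, Matrix.mul_assoc, ← coreMat0T_rootMul]
    rfl

lemma treeRank_rootMul {τ : OTree 𝓛} {r : ℕ} (X : TTN n τ r) (S : Matrix (Fin r) (Fin r) ℂ) :
    treeRank τ (rootMul X S) = treeRank τ X := by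
  cases τ <;> rfl

lemma FullRank.rootMul {τ : OTree 𝓛} {r : ℕ} {X : TTN n τ r} (hX : FullRank τ X)
    {S : Matrix (Fin r) (Fin r) ℂ} (hS : IsUnit S.det) : FullRank τ (rootMul X S) := by
  cases τ with
  | leaf l => exact (Matrix.rank_mul_eq_left_of_isUnit_det S X hS).trans hX
  | node c =>
    obtain ⟨h1, h2, h3⟩ := hX
    refine ⟨?_, fun i => ?_, h3⟩
    · have h : (coreMat0T X.data.core * S)ᵀ.rank = r := by
        rw [Matrix.rank_transpose, Matrix.rank_mul_eq_left_of_isUnit_det S _ hS,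
          ← Matrix.rank_transpose]
        exact h1
      rw [← coreMat0T_rootMul] at h
      exact h
    · exact (rank_rmul0 (matMode i X.data.core) hS).trans (h2 i)

/-! ### Tangent tensors -/

/-- Tensors tangent to the manifold at the tensor of the network `X`, described through the factors
of `X`: for every direct subtree `τ_i`, the `i`-th matricization is the sum of a tensor tangent at
`X_{τ_i}` times the environment of `τ_i` in `X`, and of a matrix with columns in the range of
`U_{τ_i}`. -/
def IsTangent : (τ : OTree 𝓛) → {r : ℕ} → TTN n τ r → TSpace n τ r → Prop
  | .leaf _, _, _, _ => True
  | .node c, r, X, T => ∀ i, ∃ (D : TSpace n (c i) (X.data.rank i))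
      (K : Matrix (Fin (X.data.rank i)) (Fin r × ∀ j : {j // j ≠ i}, Idx n (c j)) ℂ),
      IsTangent (c i) (X.data.sub i) D ∧
      matI i T = mat0T D * (matMode i X.data.core *
        (envMat (Fin r) i fun j => basisMat (c j) (X.data.sub j))ᵀ) +
          basisMat (c i) (X.data.sub i) * K

lemma IsTangent.add {τ : OTree 𝓛} {r : ℕ} {X : TTN n τ r} {T T' : TSpace n τ r}
    (h : IsTangent τ X T) (h' : IsTangent τ X T') : IsTangent τ X (T + T') := by
  induction τ generalizing r with
  | leaf l => trivial
  | node c ih =>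
    intro i
    obtain ⟨D, K, hD, hK⟩ := h i
    obtain ⟨D', K', hD', hK'⟩ := h' i
    refine ⟨D + D', K + K', ih i hD hD', ?_⟩
    rw [matI_add, hK, hK', mat0T_add, Matrix.add_mul, Matrix.mul_add]
    abel

lemma IsTangent.smul {τ : OTree 𝓛} {r : ℕ} {X : TTN n τ r} {T : TSpace n τ r} (a : ℂ)
    (h : IsTangent τ X T) : IsTangent τ X (a • T) := by
  induction τ generalizing r with
  | leaf l => trivial
  | node c ih =>
    intro i
    obtain ⟨D, K, hD, hK⟩ := h i
    refine ⟨a • D, a • K, ih i hD, ?_⟩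
    rw [matI_smul, hK, show mat0T (a • D) = a • mat0T D from rfl, smul_add, Matrix.smul_mul,
      Matrix.mul_smul]

lemma IsTangent.zero {τ : OTree 𝓛} {r : ℕ} (X : TTN n τ r) : IsTangent τ X 0 := by
  induction τ generalizing r with
  | leaf l => trivial
  | node c ih =>
    intro i
    refine ⟨0, 0, ih i _, ?_⟩
    rw [show mat0T (0 : TSpace n (c i) (X.data.rank i)) = 0 from rfl, Matrix.zero_mul,
      Matrix.mul_zero, add_zero]
    rfl

lemma matI_ofMat0T_mul {m : ℕ} {c : Fin m → OTree 𝓛} {r s : ℕ} (T : TSpace n (.node c) r)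
    (S : Matrix (Fin r) (Fin s) ℂ) (i : Fin m) :
    matI i (ofMat0T (mat0T T * S)) = rmul0 (matI i T) S := by
  ext x p
  change ∑ k, mat0T T _ k * S k p.1 = ∑ k, S k p.1 * _
  exact Finset.sum_congr rfl fun _ _ => mul_comm _ _

/-- The tangency relation is compatible with changes of the basis at the root. -/
lemma IsTangent.rootMul {τ : OTree 𝓛} {r s : ℕ} {X : TTN n τ r} {T : TSpace n τ r}
    (h : IsTangent τ X T) (S : Matrix (Fin r) (Fin s) ℂ) :
    IsTangent τ (rootMul X S) (ofMat0T (mat0T T * S)) := by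
  cases τ with
  | leaf l => trivial
  | node c =>
    intro i
    obtain ⟨D, K, hD, hK⟩ := h i
    refine ⟨D, rmul0 K S, hD, ?_⟩
    have e : matI i (ofMat0T (mat0T T * S)) = mat0T D * (rmul0 (matMode i X.data.core) S *
        (envMat (Fin s) i fun j => basisMat (c j) (X.data.sub j))ᵀ) +
          basisMat (c i) (X.data.sub i) * rmul0 K S := by
      rw [matI_ofMat0T_mul, hK, rmul0_add, rmul0_mul, rmul0_mul_envMat i (matMode i X.data.core)
        (fun j => basisMat (c j) (X.data.sub j)) S, rmul0_mul]
    exact e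

/-- Every tensor whose transposed `0`-th matricization has its columns in the range of `U_τ` is
tangent. -/
lemma isTangent_basisMat_mul {τ : OTree 𝓛} {r s : ℕ} (X : TTN n τ r)
    (S : Matrix (Fin r) (Fin s) ℂ) (K : Matrix (Fin r) (Fin s) ℂ) :
    IsTangent τ (rootMul X S) (ofMat0T (basisMat τ X * K)) := by
  cases τ with
  | leaf l => trivial
  | node c =>
    intro i
    refine ⟨0, rmul0 (matMode i X.data.core *
      (envMat (Fin r) i fun j => basisMat (c j) (X.data.sub j))ᵀ) K, IsTangent.zero _, ?_⟩
    rw [← mat0T_toTensor, matI_ofMat0T_mul, matI_toTensor, rmul0_mul,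
      show mat0T (0 : TSpace n (c i) ((TTN.data (RankAdaptiveTTN.rootMul X S)).rank i)) = 0 from
        rfl, Matrix.zero_mul, zero_add]
    rfl

/-! ### Velocities of curves are tangent -/

lemma exists_left_inverse_of_rank {α : Type*} [Fintype α] {r : ℕ} {A : Matrix α (Fin r) ℂ}
    (h : A.rank = r) : ∃ L : Matrix (Fin r) α ℂ, L * A = 1 := by
  classical
  have hker : LinearMap.ker A.mulVecLin = ⊥ := by
    have h1 := A.mulVecLin.finrank_range_add_finrank_ker
    rw [← Matrix.rank, h, Module.finrank_fin_fun] at h1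
    exact Submodule.finrank_eq_zero.1 (by omega)
  obtain ⟨g, hg⟩ := A.mulVecLin.exists_leftInverse_of_injective hker
  refine ⟨LinearMap.toMatrix' g, ?_⟩
  have h2 : LinearMap.toMatrix' (g ∘ₗ A.mulVecLin) = 1 := by rw [hg, LinearMap.toMatrix'_id]
  rw [LinearMap.toMatrix'_comp] at h2
  rwa [← Matrix.toLin'_apply', LinearMap.toMatrix'_toLin'] at h2

lemma exists_right_inverse_of_rank {α : Type*} [Fintype α] {r : ℕ} {A : Matrix (Fin r) α ℂ}
    (h : A.rank = r) : ∃ L : Matrix α (Fin r) ℂ, A * L = 1 := by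
  rw [← Matrix.rank_transpose] at h
  obtain ⟨L, hL⟩ := exists_left_inverse_of_rank h
  refine ⟨Lᵀ, ?_⟩
  have := congrArg Matrix.transpose hL
  rwa [Matrix.transpose_mul, Matrix.transpose_transpose, Matrix.transpose_one] at this

lemma FullRank.exists_left_inverse {τ : OTree 𝓛} {r : ℕ} {X : TTN n τ r} (hX : FullRank τ X) :
    ∃ L : Matrix (Fin r) (Idx n τ) ℂ, L * basisMat τ X = 1 := by
  induction τ generalizing r with
  | leaf l => exact exists_left_inverse_of_rank hX
  | node c ih =>
    obtain ⟨h1, -, h3⟩ := hX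
    choose L hL using fun i => ih i (h3 i)
    have h1' : (coreMat0T X.data.core).rank = r := by
      rw [← Matrix.rank_transpose]; exact h1
    obtain ⟨L0, hL0⟩ := exists_left_inverse_of_rank h1'
    refine ⟨L0 * kr L, ?_⟩
    rw [basisMat_node, Matrix.mul_assoc, ← Matrix.mul_assoc (kr L), kr_mul]
    simp only [hL]
    rw [kr_one, Matrix.one_mul, hL0]

/-- The rank of a network at the root. -/
def rootRank : {τ : OTree 𝓛} → TreeRank τ → ℕ
  | .leaf _, R => R
  | .node _, R => R.1

lemma rootRank_treeRank {τ : OTree 𝓛} {r : ℕ} (X : TTN n τ r) : rootRank (treeRank τ X) = r := by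
  cases τ <;> rfl

/-- A product of a differentiable function that vanishes at `0` and a continuous function that
vanishes at `0` has derivative zero. -/
lemma hasDerivAt_mul_of_vanish {a b : ℝ → ℂ} {a' : ℂ} (ha : HasDerivAt a a' 0) (ha0 : a 0 = 0)
    (hb : ContinuousAt b 0) (hb0 : b 0 = 0) : HasDerivAt (fun s => a s * b s) 0 0 := by
  rw [hasDerivAt_iff_tendsto_slope_zero] at ha ⊢
  have hb' : Tendsto (fun t => b (0 + t)) (𝓝[≠] 0) (𝓝 0) := by
    simp only [zero_add]
    have := hb.tendsto
    rw [hb0] at this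
    exact this.mono_left nhdsWithin_le_nhds
  have h := ha.mul hb'
  rw [mul_zero] at h
  refine h.congr fun t => ?_
  simp only [ha0, hb0, mul_zero, sub_zero, smul_mul_assoc]

/-- Entrywise derivatives of linear images of a curve. -/
lemma hasDerivAt_matrix_entry {E : Type*} [NormedAddCommGroup E] [NormedSpace ℝ E]
    [FiniteDimensional ℝ E] {α β : Type*} (ℓ : E →ₗ[ℝ] Matrix α β ℂ) {γ : ℝ → E} {v : E}
    (h : HasDerivAt γ v 0) (a : α) (b : β) : HasDerivAt (fun s => ℓ (γ s) a b) (ℓ v a b) 0 := by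
  let ψ : E →ₗ[ℝ] ℂ :=
    { toFun := fun x => ℓ x a b
      map_add' := fun x y => by rw [map_add]; rfl
      map_smul' := fun x y => by rw [map_smul]; rfl }
  exact (LinearMap.toContinuousLinearMap ψ).hasFDerivAt.comp_hasDerivAt 0 h

/-- A curve of matrices of rank `r` has no velocity components outside the column and row spaces of
the starting matrix: a matrix `M = UₛHₛ` near `UH` satisfies
`(1 - UL)M(1 - RH) = (1 - UL)MR · (LMR)⁻¹ · LM(1 - RH)`, and the outer factors vanish at `UH`. -/
lemma normal_component_eq_zero {E : Type*} [NormedAddCommGroup E] [NormedSpace ℝ E]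
    [FiniteDimensional ℝ E] {α β : Type*} [Fintype α] [Fintype β] {r : ℕ}
    (ℓ : E →ₗ[ℝ] Matrix α β ℂ) {γ : ℝ → E} {v : E} (hγ : HasDerivAt γ v 0)
    {U : Matrix α (Fin r) ℂ} {H : Matrix (Fin r) β ℂ} {L : Matrix (Fin r) α ℂ}
    {R : Matrix β (Fin r) ℂ} (hL : L * U = 1) (hR : H * R = 1) (h0 : ℓ (γ 0) = U * H)
    (hs : ∀ᶠ s in 𝓝 0, ∃ (Us : Matrix α (Fin r) ℂ) (Hs : Matrix (Fin r) β ℂ),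
      ℓ (γ s) = Us * Hs) :
    ℓ v = ℓ v * R * H + U * (L * ℓ v - L * ℓ v * R * H) := by
  classical
  have e : ∀ X : Matrix α β ℂ, X = X * R * H + U * (L * X - L * X * R * H) +
      (X - U * (L * X) - (X - U * (L * X)) * R * H) := fun X => by
    simp only [Matrix.mul_sub, Matrix.sub_mul, Matrix.mul_assoc]
    abel
  suffices hz : ℓ v - U * (L * ℓ v) - (ℓ v - U * (L * ℓ v)) * R * H = 0 by
    conv_lhs => rw [e (ℓ v)]
    rw [hz, add_zero]
  -- the component `f` normal to both spaces is the product of `a`, `g⁻¹` and `cc` near `0`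
  let a : E →ₗ[ℝ] Matrix α (Fin r) ℂ :=
    { toFun := fun x => (ℓ x - U * (L * ℓ x)) * R
      map_add' := fun x y => by
        simp only [map_add, Matrix.mul_add, Matrix.add_mul, Matrix.sub_mul]; abel
      map_smul' := fun t x => by
        simp [Matrix.sub_mul, smul_sub] }
  let cc : E →ₗ[ℝ] Matrix (Fin r) β ℂ :=
    { toFun := fun x => L * ℓ x - L * ℓ x * R * H
      map_add' := fun x y => by
        simp only [map_add, Matrix.mul_add, Matrix.add_mul]; abel
      map_smul' := fun t x => by
        simp [smul_sub] }
  let g : E →ₗ[ℝ] Matrix (Fin r) (Fin r) ℂ :=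
    { toFun := fun x => L * ℓ x * R
      map_add' := fun x y => by simp only [map_add, Matrix.mul_add, Matrix.add_mul]
      map_smul' := fun t x => by simp }
  let f : E →ₗ[ℝ] Matrix α β ℂ :=
    { toFun := fun x => ℓ x - U * (L * ℓ x) - (ℓ x - U * (L * ℓ x)) * R * H
      map_add' := fun x y => by
        simp only [map_add, Matrix.mul_add, Matrix.add_mul, Matrix.sub_mul]; abel
      map_smul' := fun t x => by
        simp [Matrix.sub_mul, smul_sub] }
  have hg0 : g (γ 0) = 1 := by
    change L * ℓ (γ 0) * R = 1
    rw [h0, ← Matrix.mul_assoc, hL, Matrix.one_mul, hR]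
  have ha0 : a (γ 0) = 0 := by
    change (ℓ (γ 0) - U * (L * ℓ (γ 0))) * R = 0
    rw [h0, ← Matrix.mul_assoc L, hL, Matrix.one_mul, sub_self, Matrix.zero_mul]
  have hc0 : cc (γ 0) = 0 := by
    change L * ℓ (γ 0) - L * ℓ (γ 0) * R * H = 0
    rw [h0, ← Matrix.mul_assoc L, hL, Matrix.one_mul, hR, Matrix.one_mul, sub_self]
  have hgc : ContinuousAt (fun s => g (γ s)) 0 := by
    have hl : Continuous g := g.continuous_of_finiteDimensional
    exact hl.continuousAt.comp hγ.continuousAt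
  have hgi : ContinuousAt (fun s => (g (γ s))⁻¹) 0 := by
    refine ContinuousAt.comp (g := fun A : Matrix (Fin r) (Fin r) ℂ => A⁻¹) ?_ hgc
    refine continuousAt_matrix_inv _ ?_
    rw [hg0, Matrix.det_one]
    exact NormedRing.inverse_continuousAt (1 : ℂˣ)
  have hdet : ∀ᶠ s in 𝓝 0, IsUnit (g (γ s)).det := by
    have h1 : ContinuousAt (fun s => (g (γ s)).det) 0 :=
      (continuous_id.matrix_det.continuousAt).comp hgc
    have h2 : (g (γ 0)).det ≠ 0 := by rw [hg0, Matrix.det_one]; exact one_ne_zero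
    filter_upwards [h1.eventually_ne h2] with s hs
    exact isUnit_iff_ne_zero.2 hs
  have hf : ∀ᶠ s in 𝓝 0, f (γ s) = a (γ s) * ((g (γ s))⁻¹ * cc (γ s)) := by
    filter_upwards [hs, hdet] with s hs hd
    obtain ⟨Us, Hs, hUH⟩ := hs
    have hg : g (γ s) = (L * Us) * (Hs * R) := by
      change L * ℓ (γ s) * R = _
      rw [hUH]; simp only [Matrix.mul_assoc]
    have hd' := hd
    rw [hg, Matrix.det_mul] at hd'
    have hd1 := isUnit_of_mul_isUnit_left hd'
    have hd2 := isUnit_of_mul_isUnit_right hd'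
    have ea : a (γ s) = (Us - U * (L * Us)) * (Hs * R) := by
      change (ℓ (γ s) - U * (L * ℓ (γ s))) * R = _
      rw [hUH]; simp only [Matrix.mul_assoc, Matrix.sub_mul]
    have ec : cc (γ s) = (L * Us) * (Hs - Hs * R * H) := by
      change L * ℓ (γ s) - L * ℓ (γ s) * R * H = _
      rw [hUH]; simp only [Matrix.mul_assoc, Matrix.mul_sub]
    have ef : f (γ s) = (Us - U * (L * Us)) * (Hs - Hs * R * H) := by
      change ℓ (γ s) - U * (L * ℓ (γ s)) - (ℓ (γ s) - U * (L * ℓ (γ s))) * R * H = _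
      rw [hUH]; simp only [Matrix.mul_assoc, Matrix.mul_sub, Matrix.sub_mul]
    rw [ef, ea, ec, hg, Matrix.mul_inv_rev]
    have e1 : (L * Us)⁻¹ * (L * Us) = 1 := Matrix.nonsing_inv_mul _ hd1
    have e2 : (Hs * R) * (Hs * R)⁻¹ = 1 := Matrix.mul_nonsing_inv _ hd2
    rw [Matrix.mul_assoc (Us - _), Matrix.mul_assoc (Hs * R)⁻¹, ← Matrix.mul_assoc (L * Us)⁻¹, e1,
      Matrix.one_mul, ← Matrix.mul_assoc (Hs * R), e2, Matrix.one_mul]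
  ext x y
  have hd1 : HasDerivAt (fun s => f (γ s) x y) (f v x y) 0 := hasDerivAt_matrix_entry f hγ x y
  have hd2 : HasDerivAt (fun s => ∑ k, a (γ s) x k * ((g (γ s))⁻¹ * cc (γ s)) k y) 0 0 := by
    have := HasDerivAt.fun_sum (u := Finset.univ) (A := fun (k : Fin r) s =>
      a (γ s) x k * ((g (γ s))⁻¹ * cc (γ s)) k y) (A' := fun _ => 0) (x := (0 : ℝ)) fun k _ => by
        refine hasDerivAt_mul_of_vanish (hasDerivAt_matrix_entry a hγ x k) ?_ ?_ ?_
        · rw [ha0]; rfl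
        · simp only [Matrix.mul_apply]
          refine tendsto_finsetSum _ fun l _ => ?_
          exact (continuousAt_pi.1 (continuousAt_pi.1 hgi k) l).mul
            (hasDerivAt_matrix_entry cc hγ l y).continuousAt
        · rw [hc0, Matrix.mul_zero]; rfl
    simpa using this
  have hd3 : HasDerivAt (fun s => f (γ s) x y) 0 0 := by
    refine hd2.congr_of_eventuallyEq ?_
    filter_upwards [hf] with s hs
    rw [hs]; rfl
  exact hd1.unique hd3

/-- The velocities of curves in the manifold through the tensor of a network of full tree rank are
tangent. A curve in the manifold is restricted to the subtree `τ_i` by multiplication with a right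
inverse of the environment of `τ_i`. -/
lemma isTangent_of_curve {τ : OTree 𝓛} {r : ℕ} {X : TTN n τ r} (hX : FullRank τ X)
    {γ : ℝ → TSpace n τ r} {v : TSpace n τ r} (h0 : γ 0 = toTensor X)
    (hγ : ∀ᶠ s in 𝓝 0, γ s ∈ ttnManifold n τ r (treeRank τ X)) (hv : HasDerivAt γ v 0) :
    IsTangent τ X v := by
  induction τ generalizing r with
  | leaf l => trivial
  | node c ih =>
    intro i
    obtain ⟨-, h2, h3⟩ := hX
    obtain ⟨L, hL⟩ := (h3 i).exists_left_inverse
    set U := fun j => basisMat (c j) (X.data.sub j) with hU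
    set H := matMode i X.data.core * (envMat (Fin r) i U)ᵀ with hH
    obtain ⟨R, hR⟩ : ∃ R : Matrix (Fin r × ∀ j : {j // j ≠ i}, Idx n (c j))
        (Fin (X.data.rank i)) ℂ, H * R = 1 := by
      obtain ⟨R0, hR0⟩ := exists_right_inverse_of_rank (h2 i)
      choose G hG using fun j => (h3 j).exists_left_inverse
      refine ⟨(envMat (Fin r) i G)ᵀ * R0, ?_⟩
      have e : envMat (Fin r) i G * envMat (Fin r) i U = 1 := by
        rw [envMat, envMat, ← Matrix.mul_kronecker_mul, Matrix.one_mul, kr_mul]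
        simp only [hU, hG]
        rw [kr_one, Matrix.one_kronecker_one]
      rw [hH, Matrix.mul_assoc, ← Matrix.mul_assoc (envMat (Fin r) i U)ᵀ,
        ← Matrix.transpose_mul, e, Matrix.transpose_one, Matrix.one_mul, hR0]
    let ℓ : TSpace n (.node c) r →ₗ[ℝ]
        Matrix (Idx n (c i)) (Fin r × ∀ j : {j // j ≠ i}, Idx n (c j)) ℂ :=
      { toFun := matI i
        map_add' := fun _ _ => rfl
        map_smul' := fun _ _ => rfl }
    have hℓ0 : ℓ (γ 0) = U i * H := by rw [h0]; exact matI_toTensor X i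
    -- the curve near `0`, in factors with the ranks of `X`
    have hs : ∀ᶠ s in 𝓝 0, ∃ (Xs : TTN n (c i) (X.data.rank i))
        (Hs : Matrix (Fin (X.data.rank i)) (Fin r × ∀ j : {j // j ≠ i}, Idx n (c j)) ℂ),
        FullRank (c i) Xs ∧ treeRank (c i) Xs = treeRank (c i) (X.data.sub i) ∧
          ℓ (γ s) = basisMat (c i) Xs * Hs := by
      filter_upwards [hγ] with s hs
      obtain ⟨Xs, hXs, hrank, hten⟩ := hs
      obtain ⟨-, -, hF⟩ := hXs
      have hr : ∀ j, treeRank (c j) (Xs.data.sub j) = treeRank (c j) (X.data.sub j) :=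
        fun j => congrFun (Prod.ext_iff.1 hrank).2 j
      have hm := matI_toTensor Xs i
      rw [hten] at hm
      obtain ⟨rk, core, sub⟩ := Xs
      have hrk : rk = X.data.rank := by
        funext j
        rw [← rootRank_treeRank (sub j), ← rootRank_treeRank (X.data.sub j)]
        exact congrArg rootRank (hr j)
      subst hrk
      exact ⟨sub i, _, hF i, hr i, hm⟩
    let ζ : ℝ → TSpace n (c i) (X.data.rank i) := fun s => ofMat0T (ℓ (γ s) * R)
    let Λ : TSpace n (.node c) r →ₗ[ℝ] TSpace n (c i) (X.data.rank i) :=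
      { toFun := fun Z => ofMat0T (ℓ Z * R)
        map_add' := fun x y => by rw [map_add, Matrix.add_mul]; rfl
        map_smul' := fun t x => by rw [map_smul, Matrix.smul_mul]; rfl }
    have hζ : HasDerivAt ζ (ofMat0T (ℓ v * R)) 0 :=
      (LinearMap.toContinuousLinearMap Λ).hasFDerivAt.comp_hasDerivAt 0 hv
    have hζ0 : ζ 0 = toTensor (X.data.sub i) := by
      change ofMat0T (ℓ (γ 0) * R) = _
      rw [hℓ0, Matrix.mul_assoc, hR, Matrix.mul_one]
      rfl
    have hdet : ∀ᶠ s in 𝓝 0, IsUnit (L * (ℓ (γ s) * R)).det := by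
      let ψ : TSpace n (.node c) r →ₗ[ℝ] Matrix (Fin (X.data.rank i)) (Fin (X.data.rank i)) ℂ :=
        { toFun := fun Z => L * (ℓ Z * R)
          map_add' := fun x y => by rw [map_add, Matrix.add_mul, Matrix.mul_add]
          map_smul' := fun t x => by rw [map_smul, Matrix.smul_mul, Matrix.mul_smul]; rfl }
      have hψ : ContinuousAt (fun s => ψ (γ s)) 0 :=
        (ψ.continuous_of_finiteDimensional).continuousAt.comp hv.continuousAt
      have h1 : ContinuousAt (fun s => (ψ (γ s)).det) 0 :=
        (continuous_id.matrix_det.continuousAt).comp hψ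
      have h2 : (ψ (γ 0)).det ≠ 0 := by
        change (L * (ℓ (γ 0) * R)).det ≠ 0
        rw [hℓ0, Matrix.mul_assoc, hR, Matrix.mul_one, hL, Matrix.det_one]
        exact one_ne_zero
      filter_upwards [h1.eventually_ne h2] with s hs
      exact isUnit_iff_ne_zero.2 hs
    have hζM : ∀ᶠ s in 𝓝 0, ζ s ∈ ttnManifold n (c i) (X.data.rank i)
        (treeRank (c i) (X.data.sub i)) := by
      filter_upwards [hs, hdet] with s hs hd
      obtain ⟨Xs, Hs, hF, hr, he⟩ := hs
      rw [he, Matrix.mul_assoc, ← Matrix.mul_assoc, Matrix.det_mul] at hd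
      refine ⟨rootMul Xs (Hs * R), hF.rootMul (isUnit_of_mul_isUnit_right hd), ?_, ?_⟩
      · rw [treeRank_rootMul, hr]
      · apply mat0T_injective
        rw [mat0T_toTensor, basisMat_rootMul, ← Matrix.mul_assoc, ← he]
        rfl
    refine ⟨ofMat0T (ℓ v * R), L * ℓ v - L * ℓ v * R * H, ih i (h3 i) hζ0 hζM hζ, ?_⟩
    refine normal_component_eq_zero ℓ hv hL hR hℓ0 ?_
    filter_upwards [hs] with s hs
    obtain ⟨Xs, Hs, -, -, he⟩ := hs
    exact ⟨_, _, he⟩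

/-- Tangent vectors of the manifold have the explicit form of `IsTangent`. Only this inclusion is
needed, since it is applied to the projection of `F(t, Y)` onto the tangent space. -/
lemma isTangent_of_mem_tangentSpaceAt {τ : OTree 𝓛} {r : ℕ} {X : TTN n τ r} (hX : FullRank τ X)
    {T : TSpace n τ r}
    (hT : T ∈ tangentSpaceAt (ttnManifold n τ r (treeRank τ X)) (toTensor X)) :
    IsTangent τ X T := by
  induction hT using Submodule.span_induction with
  | mem v hv =>
    obtain ⟨γ, h0, hγ, hd⟩ := hv
    exact isTangent_of_curve hX h0 hγ hd
  | zero => exact IsTangent.zero X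
  | add x y _ _ hx hy => exact hx.add hy
  | smul a x _ hx => exact hx.smul a

/-! ### Nearly orthonormal networks and the restriction to a subtree -/

/-- Networks whose matrices `U_σ`, `σ < τ`, are contractions with orthonormal columns up to the
error `η` in the Gram matrix. -/
def NearOrth (η : ℝ) : (τ : OTree 𝓛) → {r : ℕ} → TTN n τ r → Prop
  | .leaf _, _, _ => True
  | .node c, _, X => ∀ i, OpBound (basisMat (c i) (X.data.sub i)) 1 ∧
      OpBound (1 - (basisMat (c i) (X.data.sub i))ᴴ * basisMat (c i) (X.data.sub i)) η ∧
      NearOrth η (c i) (X.data.sub i)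

lemma NearOrth.rootMul {η : ℝ} {τ : OTree 𝓛} {r s : ℕ} {X : TTN n τ r} (h : NearOrth η τ X)
    (S : Matrix (Fin r) (Fin s) ℂ) : NearOrth η τ (rootMul X S) := by
  cases τ <;> exact h

lemma IsOrthonormal.rootMul {τ : OTree 𝓛} {r s : ℕ} {X : TTN n τ r} (h : IsOrthonormal τ X)
    (S : Matrix (Fin r) (Fin s) ℂ) : IsOrthonormal τ (rootMul X S) := by
  cases τ <;> exact h

lemma NearOrth.mono {η η' : ℝ} (hη : η ≤ η') {τ : OTree 𝓛} {r : ℕ} {X : TTN n τ r}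
    (h : NearOrth η τ X) : NearOrth η' τ X := by
  induction τ generalizing r with
  | leaf l => trivial
  | node c ih => exact fun i => ⟨(h i).1, (h i).2.1.mono hη, ih i (h i).2.2⟩

lemma IsOrthonormal.nearOrth {η : ℝ} (hη : 0 ≤ η) {τ : OTree 𝓛} {r : ℕ} {X : TTN n τ r}
    (h : IsOrthonormal τ X) : NearOrth η τ X := by
  induction τ generalizing r with
  | leaf l => trivial
  | node c ih =>
    refine fun i => ⟨opBound_of_isometry (h i).1, ?_, ih i (h i).2⟩
    rw [(h i).1, sub_self]
    exact opBound_zero.mono hη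

lemma opBound_envMat {m : ℕ} {α β : Fin m → Type*} [∀ i, Fintype (α i)] [∀ i, Fintype (β i)]
    {κ : Type*} [Fintype κ] [DecidableEq κ] (i : Fin m) {U : ∀ i, Matrix (β i) (α i) ℂ}
    (h1 : ∀ j, OpBound (U j) 1) : OpBound (envMat κ i U) 1 :=
  (opBound_kr_one fun j : {j // j ≠ i} => h1 j).one_kronecker zero_le_one

lemma opBound_envMat_gram {m : ℕ} {α β : Fin m → Type*} [∀ i, Fintype (α i)]
    [∀ i, Fintype (β i)] [∀ i, DecidableEq (α i)] {κ : Type*} [Fintype κ] [DecidableEq κ]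
    (i : Fin m) {U : ∀ i, Matrix (β i) (α i) ℂ} {η : ℝ} (hη : 0 ≤ η)
    (h1 : ∀ j, OpBound (U j) 1) (h2 : ∀ j, OpBound (1 - (U j)ᴴ * U j) η) :
    OpBound (1 - (envMat κ i U)ᴴ * envMat κ i U) (m * η) := by
  have e : 1 - (envMat κ i U)ᴴ * envMat κ i U = Matrix.kroneckerMap (· * ·) (1 : Matrix κ κ ℂ)
      (kr (fun j : {j // j ≠ i} => (1 : Matrix (α j) (α j) ℂ)) -
        kr fun j : {j // j ≠ i} => (U j)ᴴ * U j) := by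
    rw [envMat, Matrix.conjTranspose_kronecker, ← Matrix.mul_kronecker_mul,
      Matrix.conjTranspose_one, Matrix.one_mul, kr_conjTranspose, kr_mul, kr_one,
      ← Matrix.one_kronecker_one]
    ext p q
    simp only [Matrix.kroneckerMap_apply, Matrix.sub_apply, mul_sub]
  rw [e]
  have h := opBound_kr_sub (M := fun j : {j // j ≠ i} => (1 : Matrix (α j) (α j) ℂ))
    (N := fun j : {j // j ≠ i} => (U j)ᴴ * U j) (b := fun _ => η) (fun _ => opBound_one)
    (fun j => by simpa using ((h1 j).conjTranspose zero_le_one).mul (h1 j) zero_le_one)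
    (fun j => h2 j) fun _ => hη
  refine (h.mono ?_).one_kronecker (by positivity)
  rw [Finset.sum_const, nsmul_eq_mul]
  refine mul_le_mul_of_nonneg_right ?_ hη
  have h3 : (Finset.univ : Finset {j : Fin m // j ≠ i}).card ≤ m := by
    refine (Fintype.card_subtype_le _).trans ?_
    rw [Fintype.card_fin]
  exact_mod_cast h3

section Mode

variable {m : ℕ} {c : Fin m → OTree 𝓛} {r : ℕ}

/-- The conjugate of the matrix `V` of the prolongation from the `i`-th subtree. The restriction is
`mat₀(π†(Z))ᵀ = mat_i(Z) R`, and the prolongation `mat_i(π(Y)) = mat₀(Y)ᵀ Rᴴ`, for this matrix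
`R`. -/
def resMat (X : TTN n (.node c) r) (i : Fin m)
    (Q : Matrix (Fin r × ∀ j : {j // j ≠ i}, Fin (X.data.rank j)) (Fin (X.data.rank i)) ℂ) :
    Matrix (Fin r × ∀ j : {j // j ≠ i}, Idx n (c j)) (Fin (X.data.rank i)) ℂ :=
  (prolMat (fun j => basisMat (c j) (X.data.sub j)) i Q).map star

variable {X : TTN n (.node c) r} {i : Fin m}
  {Q : Matrix (Fin r × ∀ j : {j // j ≠ i}, Fin (X.data.rank j)) (Fin (X.data.rank i)) ℂ}
  {S : Matrix (Fin (X.data.rank i)) (Fin (X.data.rank i)) ℂ} {η : ℝ}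

lemma prolMat_transpose :
    (prolMat (fun j => basisMat (c j) (X.data.sub j)) i Q)ᵀ = (resMat X i Q)ᴴ := by
  ext a b
  simp [resMat]

/-- The environment of the `i`-th subtree in terms of the QR decomposition. -/
lemma environment_eq (hQ : IsQR (matMode i X.data.core)ᵀ Q Sᵀ) :
    matMode i X.data.core * (envMat (Fin r) i fun j => basisMat (c j) (X.data.sub j))ᵀ =
      S * (resMat X i Q)ᴴ := by
  have h := congrArg Matrix.transpose hQ.2.2
  rw [Matrix.transpose_mul, Matrix.transpose_transpose, Matrix.transpose_transpose] at h
  rw [h, ← prolMat_transpose, prolMat_eq, Matrix.transpose_mul, Matrix.mul_assoc]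

lemma isUnit_det_of_isQR (hX : (matMode i X.data.core).rank = X.data.rank i)
    (hQ : IsQR (matMode i X.data.core)ᵀ Q Sᵀ) : IsUnit S.det := by
  have h := congrArg Matrix.rank hQ.2.2
  rw [Matrix.rank_transpose, hX] at h
  have h1 : Sᵀ.rank = X.data.rank i := by
    refine le_antisymm ?_ ?_
    · have := Matrix.rank_le_card_width Sᵀ
      rwa [Fintype.card_fin] at this
    · conv_lhs => rw [h]
      exact Matrix.rank_mul_le_right _ _
  obtain ⟨L, hL⟩ := exists_left_inverse_of_rank h1
  have h2 : IsUnit Sᵀ := IsUnit.of_mul_eq_one_right L hL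
  rw [Matrix.isUnit_iff_isUnit_det, Matrix.det_transpose] at h2
  exact h2

lemma opBound_resMat (hX : NearOrth η (.node c) X) (hQ : Qᴴ * Q = 1) :
    OpBound (resMat X i Q) 1 := by
  refine OpBound.map_star ?_
  rw [prolMat_eq]
  simpa using (opBound_envMat (κ := Fin r) i fun j => (hX j).1).mul (opBound_of_isometry hQ)
    zero_le_one

/-- The Gram matrix `RᴴR` of `R = resMat X i Q` has an inverse `W` close to the identity, so that
`R W Rᴴ` is the orthogonal projection onto the range of `R`. The number `m` of direct subtrees enters
because the deviations of the `m - 1` other bases from orthonormality add up. -/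
lemma exists_gram_inverse (hη : 0 ≤ η) (hmη : m * η ≤ 1 / 2) (hX : NearOrth η (.node c) X)
    (hQ : Qᴴ * Q = 1) :
    ∃ W : Matrix (Fin (X.data.rank i)) (Fin (X.data.rank i)) ℂ,
      (resMat X i Q)ᴴ * resMat X i Q * W = 1 ∧ OpBound W 2 ∧ OpBound (1 - W) (2 * (m * η)) := by
  have e1 : 1 - (resMat X i Q)ᴴ * resMat X i Q =
      (Qᴴ * (1 - (envMat (Fin r) i fun j => basisMat (c j) (X.data.sub j))ᴴ *
        envMat (Fin r) i fun j => basisMat (c j) (X.data.sub j)) * Q).map star := by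
    rw [Matrix.mul_sub, Matrix.sub_mul, Matrix.mul_one, hQ, resMat, prolMat_eq]
    ext a b
    simp only [Matrix.sub_apply, Matrix.map_apply, star_sub]
    congr 1
    · simp [Matrix.one_apply, apply_ite]
    · have : ∀ A : Matrix (Fin r × ∀ j : {j // j ≠ i}, Idx n (c j)) (Fin (X.data.rank i)) ℂ,
          ((A.map star)ᴴ * A.map star) a b = star ((Aᴴ * A) a b) := fun A => by
        simp [Matrix.mul_apply]
      rw [this, Matrix.conjTranspose_mul]
      simp only [Matrix.mul_assoc]
  have hb : OpBound (1 - (resMat X i Q)ᴴ * resMat X i Q) (m * η) := by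
    rw [e1]
    refine OpBound.map_star ?_
    have h1 := opBound_envMat_gram (κ := Fin r) i hη (fun j => (hX j).1) fun j => (hX j).2.1
    have h2 := opBound_of_isometry hQ
    have h3 := ((h2.conjTranspose zero_le_one).mul h1 zero_le_one).mul h2 (by positivity)
    simpa using h3
  obtain ⟨W, hW1, -, hW2, hW3⟩ := hb.exists_inverse hmη
  exact ⟨W, hW1, hW2, hW3⟩

lemma mat0T_restriction_resMat (Z : TSpace n (.node c) r) :
    mat0T (restriction i (prolMat (fun j => basisMat (c j) (X.data.sub j)) i Q) Z) =
      matI i Z * resMat X i Q := rfl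

lemma norm_restriction_le (hR : OpBound (resMat X i Q) 1) (Z : TSpace n (.node c) r) :
    ‖restriction i (prolMat (fun j => basisMat (c j) (X.data.sub j)) i Q) Z‖ ≤ ‖Z‖ := by
  rw [← fro_mat0T, mat0T_restriction_resMat, ← fro_matI i Z]
  simpa using hR.fro_mul_right_le zero_le_one (matI i Z)

lemma restriction_sub {s : ℕ} (V : Matrix (Fin r × ∀ j : {j // j ≠ i}, Idx n (c j)) (Fin s) ℂ)
    (Z Z' : TSpace n (.node c) r) :
    restriction i V (Z - Z') = restriction i V Z - restriction i V Z' := by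
  apply mat0T_injective
  rw [mat0T_sub, mat0T_restriction, mat0T_restriction, mat0T_restriction, matI_sub, Matrix.sub_mul]

lemma norm_prolongation_sub_le (hR : OpBound (resMat X i Q) 1)
    (Y Z : TSpace n (c i) (X.data.rank i)) :
    ‖prolongation i (prolMat (fun j => basisMat (c j) (X.data.sub j)) i Q) Y -
      prolongation i (prolMat (fun j => basisMat (c j) (X.data.sub j)) i Q) Z‖ ≤ ‖Y - Z‖ := by
  rw [← fro_matI i, matI_sub, matI_prolongation, matI_prolongation, prolMat_transpose,
    ← Matrix.sub_mul, ← mat0T_sub, ← fro_mat0T]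
  simpa using (hR.conjTranspose zero_le_one).fro_mul_right_le zero_le_one (mat0T (Y - Z))

/-- The starting tensor on the subtree is prolongated to the starting tensor. -/
lemma prolongation_start (hQ : IsQR (matMode i X.data.core)ᵀ Q Sᵀ) :
    prolongation i (prolMat (fun j => basisMat (c j) (X.data.sub j)) i Q)
      (toTensor (rootMul (X.data.sub i) S)) = toTensor X := by
  apply matI_injective i
  rw [matI_prolongation, mat0T_toTensor, basisMat_rootMul, matI_toTensor, environment_eq hQ,
    prolMat_transpose, Matrix.mul_assoc]

/-- The restriction to a subtree of a tangent tensor is tangent up to the deviation of the network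
from orthonormality: the restriction with the additional factor `W = (RᴴR)⁻¹` is tangent. -/
lemma IsTangent.restrict {T : TSpace n (.node c) r} (hT : IsTangent (.node c) X T)
    (hη : 0 ≤ η) (hmη : m * η ≤ 1 / 2) (hX : NearOrth η (.node c) X)
    (hQ : IsQR (matMode i X.data.core)ᵀ Q Sᵀ) :
    ∃ T' : TSpace n (c i) (X.data.rank i),
      IsTangent (c i) (RankAdaptiveTTN.rootMul (X.data.sub i) S) T' ∧
      ‖restriction i (prolMat (fun j => basisMat (c j) (X.data.sub j)) i Q) T - T'‖ ≤
        2 * (m * η) * ‖T‖ := by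
  obtain ⟨W, hW, -, hW3⟩ := exists_gram_inverse (i := i) hη hmη hX hQ.1
  have hR := opBound_resMat (i := i) hX hQ.1
  obtain ⟨D, K, hD, hK⟩ := hT i
  rw [environment_eq hQ] at hK
  have e : matI i T * resMat X i Q * W =
      mat0T D * S + basisMat (c i) (X.data.sub i) * (K * resMat X i Q * W) := by
    rw [hK]
    simp only [Matrix.add_mul, Matrix.mul_assoc]
    rw [← Matrix.mul_assoc (resMat X i Q)ᴴ, hW, Matrix.mul_one]
  refine ⟨ofMat0T (matI i T * resMat X i Q * W), ?_, ?_⟩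
  · rw [e]
    exact (hD.rootMul S).add (isTangent_basisMat_mul _ S _)
  · rw [← fro_mat0T, mat0T_sub, mat0T_restriction_resMat, mat0T_ofMat0T, ← fro_matI i T]
    have e2 : matI i T * resMat X i Q - matI i T * resMat X i Q * W =
        matI i T * resMat X i Q * (1 - W) := by rw [Matrix.mul_sub, Matrix.mul_one]
    rw [e2]
    have h1 := hW3.fro_mul_right_le (by positivity) (matI i T * resMat X i Q)
    have h2 := hR.fro_mul_right_le zero_le_one (matI i T)
    rw [mul_one] at h2
    have h3 : 0 ≤ 2 * (m * η) := by positivity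
    nlinarith

end Mode

/-! ### The range captured by an augmented basis -/

/-- The part of `D` outside the range of `U`, if `U` has orthonormal columns. -/
def defect {α β γ : Type*} [Fintype α] [Fintype β] (U : Matrix α β ℂ) (D : Matrix α γ ℂ) :
    Matrix α γ ℂ :=
  D - U * (Uᴴ * D)

section Defect

variable {α β γ δ : Type*} [Fintype α] [Fintype β]

lemma defect_add (U : Matrix α β ℂ) (D D' : Matrix α γ ℂ) :
    defect U (D + D') = defect U D + defect U D' := by
  simp only [defect, Matrix.mul_add]; abel

lemma defect_sub (U : Matrix α β ℂ) (D D' : Matrix α γ ℂ) :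
    defect U (D - D') = defect U D - defect U D' := by
  simp only [defect, Matrix.mul_sub]; abel

lemma defect_smul (U : Matrix α β ℂ) (a : ℝ) (D : Matrix α γ ℂ) :
    defect U (a • D) = a • defect U D := by
  simp only [defect, Matrix.mul_smul, smul_sub]

lemma defect_mul [Fintype γ] (U : Matrix α β ℂ) (D : Matrix α γ ℂ) (K : Matrix γ δ ℂ) :
    defect U (D * K) = defect U D * K := by
  simp only [defect, Matrix.sub_mul, Matrix.mul_assoc]

lemma defect_self_mul [DecidableEq β] {U : Matrix α β ℂ} (hU : Uᴴ * U = 1) (K : Matrix β γ ℂ) :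
    defect U (U * K) = 0 := by
  rw [defect, ← Matrix.mul_assoc Uᴴ, hU, Matrix.one_mul, sub_self]

lemma fro_defect_le [Fintype γ] [DecidableEq β] {U : Matrix α β ℂ} (hU : Uᴴ * U = 1)
    (D : Matrix α γ ℂ) : fro (defect U D) ≤ 2 * fro D := fro_sub_proj_le hU D

end Defect

/-- The columns of an orthonormal basis of the range of `(A, B)` reproduce `A` and `B`. -/
lemma IsOrthBasisOfRange.exists_mul {α : Type*} [Fintype α] {p q r : ℕ} {Q : Matrix α (Fin r) ℂ}
    {A : Matrix α (Fin p) ℂ} {B : Matrix α (Fin q) ℂ} (h : IsOrthBasisOfRange Q A B) :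
    (∃ K : Matrix (Fin r) (Fin p) ℂ, A = Q * K) ∧ ∃ K : Matrix (Fin r) (Fin q) ℂ, B = Q * K := by
  have key : ∀ k : Fin p ⊕ Fin q, ∃ x : Fin r → ℂ, Q *ᵥ x = fun a => Matrix.fromCols A B a k := by
    intro k
    have h1 : (Matrix.fromCols A B).mulVecLin (Pi.single k 1) ∈ LinearMap.range Q.mulVecLin := by
      rw [h.2]
      exact LinearMap.mem_range_self _ _
    obtain ⟨x, hx⟩ := h1
    refine ⟨x, ?_⟩
    rw [Matrix.mulVecLin_apply, Matrix.mulVecLin_apply, Matrix.mulVec_single_one] at hx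
    exact hx
  choose x hx using key
  refine ⟨⟨Matrix.of fun a b => x (Sum.inl b) a, ?_⟩, Matrix.of fun a b => x (Sum.inr b) a, ?_⟩
  · ext a b
    exact (congrFun (hx (Sum.inl b)) a).symm
  · ext a b
    exact (congrFun (hx (Sum.inr b)) a).symm

/-- `Û` captures the increments of all curves on `[t₀, t₁]` whose velocity is close to `G`, up to
an error proportional to the length of the time interval. -/
def Captures {σ : OTree 𝓛} {s : ℕ} {β : Type*} [Fintype β] (G : ℝ → TSpace n σ s) (t₀ t₁ : ℝ)
    (U : Matrix (Idx n σ) β ℂ) (K e : ℝ) : Prop :=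
  ∀ (z z' : ℝ → TSpace n σ s) (κ : ℝ),
    (∀ t ∈ Icc t₀ t₁, HasDerivWithinAt z (z' t) (Icc t₀ t₁) t) →
    (∀ t ∈ Icc t₀ t₁, ‖z' t - G t‖ ≤ κ) →
    fro (defect U (mat0T (z t₁ - z t₀))) ≤ (t₁ - t₀) * (K * (κ + e))

/-! ### The augmented bases capture the exact increments -/

section Mode

variable {m : ℕ} {c : Fin m → OTree 𝓛} {r : ℕ} {X : TTN n (.node c) r} {i : Fin m}
  {Q : Matrix (Fin r × ∀ j : {j // j ≠ i}, Fin (X.data.rank j)) (Fin (X.data.rank i)) ℂ}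
  {S : Matrix (Fin (X.data.rank i)) (Fin (X.data.rank i)) ℂ} {η : ℝ}

lemma hasDerivWithinAt_restriction {z : ℝ → TSpace n (.node c) r} {z' : TSpace n (.node c) r}
    {s : ℕ} (V : Matrix (Fin r × ∀ j : {j // j ≠ i}, Idx n (c j)) (Fin s) ℂ) {I : Set ℝ} {t : ℝ}
    (h : HasDerivWithinAt z z' I t) :
    HasDerivWithinAt (fun t => restriction i V (z t)) (restriction i V z') I t := by
  let Λ : TSpace n (.node c) r →ₗ[ℝ] TSpace n (c i) s :=
    { toFun := restriction i V
      map_add' := fun x y => by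
        apply mat0T_injective
        rw [mat0T_add, mat0T_restriction, mat0T_restriction, mat0T_restriction, matI_add,
          Matrix.add_mul]
      map_smul' := fun a x => by
        apply mat0T_injective
        rw [mat0T_restriction, show matI i (a • x) = a • matI i x from rfl, Matrix.smul_mul]
        rfl }
  exact (LinearMap.toContinuousLinearMap Λ).hasFDerivAt.comp_hasDerivWithinAt t h

/-- The range of the augmented basis on the subtree `τ_i` captures the increments of the `i`-th
matricization. The rows in the row space of the environment are dealt with by restriction to the
subtree, and tangent tensors have no other rows outside the range of `U_{τ_i}`. -/
lemma fro_defect_matI_le {s' : ℕ} {U : Matrix (Idx n (c i)) (Fin s') ℂ} {t₀ t₁ ε K e κ : ℝ}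
    {F : ℝ → TSpace n (.node c) r → TSpace n (.node c) r}
    (ht : t₀ ≤ t₁) (hη : 0 ≤ η) (hmη : m * η ≤ 1 / 2) (hX : NearOrth η (.node c) X)
    (hQ : IsQR (matMode i X.data.core)ᵀ Q Sᵀ)
    (hT : ∀ t ∈ Icc t₀ t₁, ∃ T, IsTangent (.node c) X T ∧ ‖F t (toTensor X) - T‖ ≤ ε)
    (hU : Uᴴ * U = 1)
    (hU0 : U * (Uᴴ * basisMat (c i) (X.data.sub i)) = basisMat (c i) (X.data.sub i))
    (hcap : Captures (fun t => subFun i (prolMat (fun j => basisMat (c j) (X.data.sub j)) i Q) F t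
      (toTensor (rootMul (X.data.sub i) S))) t₀ t₁ U K e)
    {z z' : ℝ → TSpace n (.node c) r}
    (hz : ∀ t ∈ Icc t₀ t₁, HasDerivWithinAt z (z' t) (Icc t₀ t₁) t)
    (hz' : ∀ t ∈ Icc t₀ t₁, ‖z' t - F t (toTensor X)‖ ≤ κ) :
    fro (defect U (matI i (z t₁ - z t₀))) ≤
      (t₁ - t₀) * (6 * (κ + ε) + 2 * (K * (κ + e))) := by
  obtain ⟨W, hW, hW2, -⟩ := exists_gram_inverse (i := i) hη hmη hX hQ.1
  have hR := opBound_resMat (i := i) hX hQ.1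
  set R := resMat X i Q with hRdef
  have hproj : ∀ A : Matrix (Idx n (c i)) (Fin (X.data.rank i)) ℂ,
      fro (A * W * Rᴴ) ≤ 2 * fro A := fun A => by
    have h1 := hW2.fro_mul_right_le zero_le_two A
    have h2 := (hR.conjTranspose zero_le_one).fro_mul_right_le zero_le_one (A * W)
    linarith
  have hRle : ∀ Z : TSpace n (.node c) r, fro (matI i Z * R) ≤ ‖Z‖ := fun Z => by
    have := hR.fro_mul_right_le zero_le_one (matI i Z)
    rwa [mul_one, fro_matI] at this
  -- the rows orthogonal to the row space of the environment, which are `0` modulo `U` for tangent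
  -- tensors
  let ℓ : TSpace n (.node c) r →ₗ[ℝ]
      Matrix (Idx n (c i)) (Fin r × ∀ j : {j // j ≠ i}, Idx n (c j)) ℂ :=
    { toFun := fun Z => defect U (matI i Z - matI i Z * R * W * Rᴴ)
      map_add' := fun x y => by
        rw [← defect_add, matI_add]
        simp only [Matrix.add_mul]
        congr 1
        abel
      map_smul' := fun a x => by
        rw [show matI i (a • x) = a • matI i x from rfl]
        simp only [Matrix.smul_mul]
        rw [← smul_sub, defect_smul, RingHom.id_apply] }
  have hℓ : ∀ Z, fro (ℓ Z) ≤ 6 * ‖Z‖ := fun Z => by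
    have h1 := fro_defect_le hU (matI i Z - matI i Z * R * W * Rᴴ)
    have h2 := fro_sub_le (matI i Z) (matI i Z * R * W * Rᴴ)
    have h3 := hproj (matI i Z * R)
    have h4 := hRle Z
    rw [fro_matI] at h2
    have h5 : fro (ℓ Z) = fro (defect U (matI i Z - matI i Z * R * W * Rᴴ)) := rfl
    linarith
  have hℓT : ∀ T, IsTangent (.node c) X T → ℓ T = 0 := fun T hT => by
    obtain ⟨D, K, -, hK⟩ := hT i
    rw [environment_eq hQ, ← hRdef] at hK
    have e1 : matI i T - matI i T * R * W * Rᴴ =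
        U * (Uᴴ * basisMat (c i) (X.data.sub i) * (K - K * R * W * Rᴴ)) := by
      have e2 : mat0T D * (S * Rᴴ) * R * W * Rᴴ = mat0T D * (S * Rᴴ) := by
        have : mat0T D * (S * Rᴴ) * R * W * Rᴴ = mat0T D * (S * (Rᴴ * R * W * Rᴴ)) := by
          simp only [Matrix.mul_assoc]
        rw [this, hW, Matrix.one_mul]
      rw [← Matrix.mul_assoc, hU0, hK]
      simp only [Matrix.add_mul, e2, Matrix.mul_sub]
      simp only [Matrix.mul_assoc]
      abel
    change defect U (matI i T - matI i T * R * W * Rᴴ) = 0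
    rw [e1, defect_self_mul hU]
  have hfirst : fro (ℓ (z t₁ - z t₀)) ≤ 6 * (κ + ε) * (t₁ - t₀) := by
    refine fro_linear_sub_le ℓ hz (fun t htI => ?_) (left_mem_Icc.2 ht) (right_mem_Icc.2 ht) ht
    obtain ⟨T, hT1, hT2⟩ := hT t htI
    have e1 : ℓ (z' t) = ℓ (z' t - T) := by rw [map_sub, hℓT T hT1, sub_zero]
    rw [e1]
    refine (hℓ _).trans ?_
    have h1 := norm_sub_le_norm_sub_add_norm_sub (z' t) (F t (toTensor X)) T
    have h2 := hz' t htI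
    linarith
  -- the rows in the row space of the environment, which are determined by the restriction of `z`
  have hsecond : fro (defect U (matI i (z t₁ - z t₀) * R)) ≤ (t₁ - t₀) * (K * (κ + e)) := by
    have h1 := hcap (fun t => restriction i (prolMat (fun j => basisMat (c j) (X.data.sub j)) i Q)
        (z t)) (fun t => restriction i (prolMat (fun j => basisMat (c j) (X.data.sub j)) i Q)
        (z' t)) κ (fun t ht => hasDerivWithinAt_restriction _ (hz t ht)) fun t htI => by
      change ‖restriction i _ (z' t) - restriction i _ (F t (prolongation i _ _))‖ ≤ κ
      rw [prolongation_start hQ, ← restriction_sub]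
      exact (norm_restriction_le hR _).trans (hz' t htI)
    rw [← restriction_sub, mat0T_restriction_resMat] at h1
    exact h1
  have e1 : defect U (matI i (z t₁ - z t₀)) = ℓ (z t₁ - z t₀) +
      defect U (matI i (z t₁ - z t₀) * R) * W * Rᴴ := by
    change _ = defect U (matI i (z t₁ - z t₀) - matI i (z t₁ - z t₀) * R * W * Rᴴ) + _
    rw [defect_sub, defect_mul, defect_mul, defect_mul]
    abel
  rw [e1]
  refine (fro_add_le _ _).trans ?_
  have h3 := hproj (defect U (matI i (z t₁ - z t₀) * R))
  linarith

end Mode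

/-! ### The rank-augmenting step -/

section Augment

variable {m : ℕ} {c : Fin m → OTree 𝓛} {r : ℕ}

/-- The result of the rank-augmenting step: the augmented bases are orthonormal and contain the
previous bases, their tensor product captures increments, and the Galerkin solution has the same
increment as the projection of the curve up to the velocity differences `κ + d`. -/
structure AugmentSpec (Y0 : TTN n (.node c) r)
    (F : ℝ → TSpace n (.node c) r → TSpace n (.node c) r) (t₀ t₁ : ℝ) {rk : Fin m → ℕ}
    (Xhat : ∀ i, TTN n (c i) (rk i)) (C0 C1 : Fin r → (∀ i, Fin (rk i)) → ℂ) (K e d B : ℝ) :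
    Prop where
  isometry : ∀ i, (basisMat (c i) (Xhat i))ᴴ * basisMat (c i) (Xhat i) = 1
  orthonormal : ∀ i, IsOrthonormal (c i) (Xhat i)
  start : kr (fun i => basisMat (c i) (Xhat i)) * coreMat0T C0 = basisMat (.node c) Y0
  captures : Captures (fun t => F t (toTensor Y0)) t₀ t₁
    (kr fun i => basisMat (c i) (Xhat i)) K e
  increment : ∀ (z z' : ℝ → TSpace n (.node c) r) (κ : ℝ),
    (∀ t ∈ Icc t₀ t₁, HasDerivWithinAt z (z' t) (Icc t₀ t₁) t) →
    (∀ t ∈ Icc t₀ t₁, ‖z' t - F t (toTensor Y0)‖ ≤ κ) →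
    fro ((kr fun i => basisMat (c i) (Xhat i)) *
        ((kr fun i => basisMat (c i) (Xhat i))ᴴ * mat0T (z t₁ - z t₀)) -
      (kr (fun i => basisMat (c i) (Xhat i)) * coreMat0T C1 - basisMat (.node c) Y0)) ≤
        (t₁ - t₀) * (κ + d)
  growth : fro (kr (fun i => basisMat (c i) (Xhat i)) * coreMat0T C1 - basisMat (.node c) Y0) ≤
    B * (t₁ - t₀)

lemma norm_sub_start_le {σ : OTree 𝓛} {s : ℕ} {t₀ t₁ B : ℝ} {y y' : ℝ → TSpace n σ s}
    (hB0 : 0 ≤ B) (hy : ∀ t ∈ Icc t₀ t₁, HasDerivWithinAt y (y' t) (Icc t₀ t₁) t)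
    (hB : ∀ t ∈ Icc t₀ t₁, ‖y' t‖ ≤ B) {t : ℝ} (ht : t ∈ Icc t₀ t₁) :
    ‖y t - y t₀‖ ≤ B * (t₁ - t₀) := by
  have h := Convex.norm_image_sub_le_of_norm_hasDerivWithin_le hy hB (convex_Icc t₀ t₁)
    (left_mem_Icc.2 (ht.1.trans ht.2)) ht
  refine h.trans (mul_le_mul_of_nonneg_left ?_ hB0)
  rw [Real.norm_of_nonneg (sub_nonneg.2 ht.1)]
  linarith [ht.2]

/-- The rank-augmenting step in terms of the basis updates `Φ` on the direct subtrees. In the ambient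
space, the Galerkin approximation `y` solves `ẏ = P F(t, y)` with the projection `P` onto the range
of the tensor product of the augmented bases. -/
lemma RankAugment.spec
    {Φ : ∀ (i : Fin m) {s s' : ℕ}, TTN n (c i) s → Matrix (Fin s) (Fin s) ℂ →
      (ℝ → TSpace n (c i) s → TSpace n (c i) s) → TTN n (c i) s' → Prop}
    {Y0 : TTN n (.node c) r} {F : ℝ → TSpace n (.node c) r → TSpace n (.node c) r} {t₀ t₁ : ℝ}
    {rk : Fin m → ℕ} {Xhat : ∀ i, TTN n (c i) (rk i)} {C0 C1 : Fin r → (∀ i, Fin (rk i)) → ℂ}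
    (h : RankAugment Φ Y0 F t₀ t₁ Xhat C0 C1) {L B η ε a e : ℝ} {K : Fin m → ℝ}
    (ht : t₀ ≤ t₁) (hL : 0 ≤ L) (hB : 0 ≤ B) (hη : 0 ≤ η) (hmη : m * η ≤ 1 / 2)
    (hY : NearOrth η (.node c) Y0)
    (hFL : ∀ t ∈ Icc t₀ t₁, ∀ Z Z', ‖F t Z - F t Z'‖ ≤ L * ‖Z - Z'‖)
    (hFB : ∀ t ∈ Icc t₀ t₁, ∀ Z, ‖F t Z‖ ≤ B)
    (hT : ∀ t ∈ Icc t₀ t₁, ∃ T, IsTangent (.node c) Y0 T ∧ ‖F t (toTensor Y0) - T‖ ≤ ε)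
    (hΦ : ∀ (i : Fin m)
      (Q : Matrix (Fin r × ∀ j : {j // j ≠ i}, Fin (Y0.data.rank j)) (Fin (Y0.data.rank i)) ℂ)
      (S : Matrix (Fin (Y0.data.rank i)) (Fin (Y0.data.rank i)) ℂ),
      IsQR (matMode i Y0.data.core)ᵀ Q Sᵀ →
      Φ i (Y0.data.sub i) S
        (subFun i (prolMat (fun j => basisMat (c j) (Y0.data.sub j)) i Q) F) (Xhat i) →
      (basisMat (c i) (Xhat i))ᴴ * basisMat (c i) (Xhat i) = 1 ∧
      basisMat (c i) (Xhat i) * ((basisMat (c i) (Xhat i))ᴴ * basisMat (c i) (Y0.data.sub i)) =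
        basisMat (c i) (Y0.data.sub i) ∧
      IsOrthonormal (c i) (Xhat i) ∧
      Captures (fun t => subFun i (prolMat (fun j => basisMat (c j) (Y0.data.sub j)) i Q) F t
        (toTensor (rootMul (Y0.data.sub i) S))) t₀ t₁ (basisMat (c i) (Xhat i)) (K i) (a * e))
    (hK : ∀ i, 0 ≤ K i) (ha : 1 ≤ a) (hεe : ε ≤ e) :
    AugmentSpec Y0 F t₀ t₁ Xhat C0 C1 (∑ i, (6 + 2 * a * K i)) e (L * B * (t₁ - t₀)) B := by
  obtain ⟨hsub, hC0, C, hC, hCt0, hCt1⟩ := h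
  choose Q S hQS hΦi using hsub
  have hspec := fun i => hΦ i (Q i) (S i) (hQS i) (hΦi i)
  have hiso := fun i => (hspec i).1
  set 𝒰 := kr fun i => basisMat (c i) (Xhat i) with h𝒰
  have h𝒰iso : 𝒰ᴴ * 𝒰 = 1 := isometry_kr hiso
  have h𝒰1 : OpBound 𝒰 1 := opBound_of_isometry h𝒰iso
  have h𝒰2 : OpBound 𝒰ᴴ 1 := h𝒰1.conjTranspose zero_le_one
  have hPle : ∀ D : Matrix (∀ i, Idx n (c i)) (Fin r) ℂ, fro (𝒰 * (𝒰ᴴ * D)) ≤ fro D := fun D => by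
    have h1 := h𝒰1.fro_mul_le zero_le_one (𝒰ᴴ * D)
    have h2 := h𝒰2.fro_mul_le zero_le_one D
    linarith
  have hstart : 𝒰 * coreMat0T C0 = basisMat (.node c) Y0 := by
    rw [hC0, coreMat0T_modeProd, ← Matrix.mul_assoc, h𝒰, kr_mul, basisMat_node]
    congr 2
    funext i
    exact (hspec i).2.1
  let ℓC : (Fin r → (∀ i, Fin (rk i)) → ℂ) →ₗ[ℝ] TSpace n (.node c) r :=
    { toFun := fun C => ofMat0T (𝒰 * coreMat0T C)
      map_add' := fun x y => by
        rw [show coreMat0T (x + y) = coreMat0T x + coreMat0T y from rfl, Matrix.mul_add]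
        rfl
      map_smul' := fun b x => by
        rw [show coreMat0T (b • x) = b • coreMat0T x from rfl, Matrix.mul_smul]
        rfl }
  -- the Galerkin approximation in the ambient tensor space
  set y : ℝ → TSpace n (.node c) r := fun t => ofMat0T (𝒰 * coreMat0T (C t)) with hy
  have hrhs : ∀ t, ℓC (galerkinRHS (fun i => basisMat (c i) (Xhat i)) F t (C t)) =
      ofMat0T (𝒰 * (𝒰ᴴ * mat0T (F t (y t)))) := fun t => by
    change ofMat0T (τ := .node c)
      (𝒰 * coreMat0T (galerkinRHS (fun i => basisMat (c i) (Xhat i)) F t (C t))) = _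
    rw [galerkinRHS, coreMat0T_modeProd, ← kr_conjTranspose, ← h𝒰]
    have e1 : (WithLp.toLp 2 fun p : Fin r × Idx n (.node c) =>
        modeProd (C t) (fun i => basisMat (c i) (Xhat i)) p.1 p.2) = y t := by
      rw [hy]
      simp only
      rw [h𝒰, ← coreMat0T_modeProd]
      rfl
    rw [e1]
    rfl
  have hyd : ∀ t ∈ Icc t₀ t₁, HasDerivWithinAt y (ofMat0T (𝒰 * (𝒰ᴴ * mat0T (F t (y t)))))
      (Icc t₀ t₁) t := fun t htI => by
    rw [← hrhs]
    exact (LinearMap.toContinuousLinearMap ℓC).hasFDerivAt.comp_hasDerivWithinAt t (hC t htI)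
  have hy0 : y t₀ = toTensor Y0 := by
    apply mat0T_injective
    rw [mat0T_toTensor, ← hstart, ← hCt0]
    rfl
  have hyB : ∀ t ∈ Icc t₀ t₁, ‖y t - toTensor Y0‖ ≤ B * (t₁ - t₀) := fun t htI => by
    rw [← hy0]
    refine norm_sub_start_le hB hyd (fun t htI => ?_) htI
    rw [← fro_mat0T, mat0T_ofMat0T]
    refine (hPle _).trans ?_
    rw [fro_mat0T]
    exact hFB t htI _
  refine ⟨hiso, fun i => (hspec i).2.2.1, hstart, ?_, ?_, ?_⟩
  · intro z z' κ hz hz'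
    have hκ : 0 ≤ κ := (norm_nonneg _).trans (hz' t₀ (left_mem_Icc.2 ht))
    refine (fro_sub_kr_proj_le hiso fun k (x : ∀ i, Idx n (c i)) => (z t₁ - z t₀) (k, x)).trans ?_
    rw [Finset.sum_mul, Finset.mul_sum]
    refine Finset.sum_le_sum fun i _ => ?_
    refine (fro_defect_matI_le ht hη hmη hY (hQS i) hT (hiso i) (hspec i).2.1 (hspec i).2.2.2
      hz hz').trans (mul_le_mul_of_nonneg_left ?_ (sub_nonneg.2 ht))
    have h1 : K i * (κ + a * e) ≤ K i * (a * (κ + e)) :=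
      mul_le_mul_of_nonneg_left (by nlinarith) (hK i)
    linarith
  · intro z z' κ hz hz'
    let ℓ : TSpace n (.node c) r →ₗ[ℝ] Matrix (∀ i, Idx n (c i)) (Fin r) ℂ :=
      { toFun := fun Z => 𝒰 * (𝒰ᴴ * mat0T Z)
        map_add' := fun x y => by rw [mat0T_add, Matrix.mul_add, Matrix.mul_add]
        map_smul' := fun b x => by
          rw [show mat0T (b • x) = b • mat0T x from rfl, Matrix.mul_smul, Matrix.mul_smul]
          rfl }
    have hidem : ∀ D : Matrix (∀ i, Fin (rk i)) (Fin r) ℂ, 𝒰 * (𝒰ᴴ * (𝒰 * D)) = 𝒰 * D :=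
      fun D => by rw [← Matrix.mul_assoc 𝒰ᴴ, h𝒰iso, Matrix.one_mul]
    have hmain := fro_linear_sub_le ℓ (z := fun t => z t - y t)
      (z' := fun t => z' t - ofMat0T (𝒰 * (𝒰ᴴ * mat0T (F t (y t))))) (C := κ + L * B * (t₁ - t₀))
      (fun t htI => (hz t htI).sub (hyd t htI)) (fun t htI => by
        have e1 : ℓ (z' t - ofMat0T (𝒰 * (𝒰ᴴ * mat0T (F t (y t))))) =
            𝒰 * (𝒰ᴴ * mat0T (z' t - F t (y t))) := by
          change 𝒰 * (𝒰ᴴ * mat0T (z' t - ofMat0T (𝒰 * (𝒰ᴴ * mat0T (F t (y t)))))) = _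
          rw [mat0T_sub, mat0T_sub, mat0T_ofMat0T]
          simp only [Matrix.mul_sub, hidem]
        rw [e1]
        refine (hPle _).trans ?_
        rw [fro_mat0T]
        have h1 := norm_sub_le_norm_sub_add_norm_sub (z' t) (F t (toTensor Y0)) (F t (y t))
        have h2 := hFL t htI (toTensor Y0) (y t)
        rw [norm_sub_rev (toTensor Y0)] at h2
        have h3 := mul_le_mul_of_nonneg_left (hyB t htI) hL
        have h4 := hz' t htI
        linarith)
      (left_mem_Icc.2 ht) (right_mem_Icc.2 ht) ht
    rw [mul_comm] at hmain
    refine le_trans (le_of_eq ?_) hmain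
    congr 1
    change _ = 𝒰 * (𝒰ᴴ * mat0T (z t₁ - y t₁ - (z t₀ - y t₀)))
    have e2 : z t₁ - y t₁ - (z t₀ - y t₀) = (z t₁ - z t₀) - (y t₁ - y t₀) := by abel
    rw [e2, mat0T_sub (z t₁ - z t₀), mat0T_sub (y t₁), ← hstart, ← hCt0, ← hCt1]
    change _ = 𝒰 * (𝒰ᴴ * (mat0T (z t₁ - z t₀) -
      (𝒰 * coreMat0T (C t₁) - 𝒰 * coreMat0T (C t₀))))
    simp only [Matrix.mul_sub, hidem]
    rfl
  · have h1 := hyB t₁ (right_mem_Icc.2 ht)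
    rw [← fro_mat0T, mat0T_sub, mat0T_toTensor] at h1
    rw [← hCt1]
    exact h1

end Augment

/-- A bound for the number of direct subtrees at every vertex of a tree. -/
def arityBound : OTree 𝓛 → ℝ
  | .leaf _ => 0
  | .node (m := m) c => m + ∑ i, arityBound (c i)

lemma arityBound_nonneg (τ : OTree 𝓛) : 0 ≤ arityBound τ := by
  induction τ with
  | leaf l => exact le_rfl
  | node c ih => exact add_nonneg (Nat.cast_nonneg _) (Finset.sum_nonneg fun i _ => ih i)

lemma le_arityBound {m : ℕ} (c : Fin m → OTree 𝓛) : (m : ℝ) ≤ arityBound (.node c) :=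
  le_add_of_nonneg_right (Finset.sum_nonneg fun i _ => arityBound_nonneg (c i))

lemma arityBound_le {m : ℕ} (c : Fin m → OTree 𝓛) (i : Fin m) :
    arityBound (c i) ≤ arityBound (.node c) := by
  have h := Finset.single_le_sum (f := fun i => arityBound (c i))
    (fun i _ => arityBound_nonneg (c i)) (Finset.mem_univ i)
  exact h.trans (le_add_of_nonneg_left (Nat.cast_nonneg _))

/-- The constant in the error of the range captured by the augmented basis on a tree. At an inner
vertex, `2` accounts for the Galerkin approximation, and the sum for the projections in the modes. -/
def captureConst : OTree 𝓛 → ℝ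
  | .leaf _ => 2
  | .node (m := m) c => 2 + ∑ i, (6 + 2 * (2 + 2 * m) * captureConst (c i))

lemma captureConst_nonneg (τ : OTree 𝓛) : 0 ≤ captureConst τ := by
  induction τ with
  | leaf l => exact zero_le_two
  | node c ih =>
    refine add_nonneg zero_le_two (Finset.sum_nonneg fun i _ => ?_)
    have := ih i
    positivity

/-- The basis update on the tree `σ` gives an orthonormal basis that contains the previous basis and
captures the increments of all curves that move approximately with the restricted vector field. -/
def UpdateCaptures (n : 𝓛 → ℕ) (t₀ t₁ L B η : ℝ) (σ : OTree 𝓛) : Prop :=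
  ∀ {s s' : ℕ} {X0 : TTN n σ s} {S : Matrix (Fin s) (Fin s) ℂ}
    {G : ℝ → TSpace n σ s → TSpace n σ s} {Xhat : TTN n σ s'} {ε : ℝ},
    BasisUpdate t₀ t₁ σ X0 S G Xhat → IsUnit S.det → FullRank σ X0 → NearOrth η σ X0 →
    arityBound σ * η ≤ 1 / 2 →
    (∀ t ∈ Icc t₀ t₁, ∀ Z Z', ‖G t Z - G t Z'‖ ≤ L * ‖Z - Z'‖) →
    (∀ t ∈ Icc t₀ t₁, ∀ Z, ‖G t Z‖ ≤ B) → 0 ≤ ε →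
    (∀ t ∈ Icc t₀ t₁, ∃ T, IsTangent σ (rootMul X0 S) T ∧
      ‖G t (toTensor (rootMul X0 S)) - T‖ ≤ ε) →
    (basisMat σ Xhat)ᴴ * basisMat σ Xhat = 1 ∧
    basisMat σ Xhat * ((basisMat σ Xhat)ᴴ * basisMat σ X0) = basisMat σ X0 ∧
    IsOrthonormal σ Xhat ∧
    Captures (fun t => G t (toTensor (rootMul X0 S))) t₀ t₁ (basisMat σ Xhat) (captureConst σ)
      (ε + L * B * (t₁ - t₀) + η * B)

/-- The rank-augmenting step inherits its properties from the basis updates on the direct subtrees: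
the restricted vector fields satisfy the same bounds, and they are again nearly tangential. -/
lemma RankAugment.spec_of_updateCaptures {m : ℕ} {c : Fin m → OTree 𝓛} {r : ℕ}
    {Y0 : TTN n (.node c) r} {F : ℝ → TSpace n (.node c) r → TSpace n (.node c) r}
    {t₀ t₁ L B η ε : ℝ} {rk : Fin m → ℕ} {Xhat : ∀ i, TTN n (c i) (rk i)}
    {C0 C1 : Fin r → (∀ i, Fin (rk i)) → ℂ}
    (h : RankAugment (fun i => BasisUpdate t₀ t₁ (c i)) Y0 F t₀ t₁ Xhat C0 C1)
    (hsub : ∀ i, UpdateCaptures n t₀ t₁ L B η (c i))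
    (ht : t₀ ≤ t₁) (hL : 0 ≤ L) (hB : 0 ≤ B) (hη : 0 ≤ η) (hε : 0 ≤ ε)
    (hF : FullRank (.node c) Y0) (hY : NearOrth η (.node c) Y0)
    (hcη : arityBound (.node c) * η ≤ 1 / 2)
    (hFL : ∀ t ∈ Icc t₀ t₁, ∀ Z Z', ‖F t Z - F t Z'‖ ≤ L * ‖Z - Z'‖)
    (hFB : ∀ t ∈ Icc t₀ t₁, ∀ Z, ‖F t Z‖ ≤ B)
    (hT : ∀ t ∈ Icc t₀ t₁, ∃ T, IsTangent (.node c) Y0 T ∧ ‖F t (toTensor Y0) - T‖ ≤ ε) :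
    AugmentSpec Y0 F t₀ t₁ Xhat C0 C1 (∑ i, (6 + 2 * (2 + 2 * m) * captureConst (c i)))
      (ε + L * B * (t₁ - t₀) + η * B) (L * B * (t₁ - t₀)) B := by
  have hh : 0 ≤ t₁ - t₀ := sub_nonneg.2 ht
  have hmη : m * η ≤ 1 / 2 :=
    (mul_le_mul_of_nonneg_right (le_arityBound c) hη).trans hcη
  set e := ε + L * B * (t₁ - t₀) + η * B with he
  have hLB : 0 ≤ L * B * (t₁ - t₀) := mul_nonneg (mul_nonneg hL hB) hh
  have hηB : 0 ≤ η * B := mul_nonneg hη hB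
  refine h.spec (ε := ε) (a := 2 + 2 * m) (e := e) (K := fun i => captureConst (c i)) ht hL hB hη
    hmη hY hFL hFB hT (fun i Q S' hQ hΦ => by
      -- the restricted field deviates from a tangent tensor by `ε`, plus `2mη(B + ε) ≤ 2mηB + ε`
      -- for the deviation of the network from orthonormality
      have hR := opBound_resMat (i := i) hY hQ.1
      have h1 := hsub i (ε := 2 * ε + 2 * m * (η * B)) hΦ (isUnit_det_of_isQR (hF.2.1 i) hQ)
        (hF.2.2 i) (hY i).2.2
        ((mul_le_mul_of_nonneg_right (arityBound_le c i) hη).trans hcη)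
        (fun t htI Z Z' => by
          change ‖restriction i _ (F t _) - restriction i _ (F t _)‖ ≤ _
          rw [← restriction_sub]
          refine (norm_restriction_le hR _).trans ((hFL t htI _ _).trans ?_)
          exact mul_le_mul_of_nonneg_left (norm_prolongation_sub_le hR Z Z') hL)
        (fun t htI Z => (norm_restriction_le hR _).trans (hFB t htI _))
        (by positivity)
        (fun t htI => by
          obtain ⟨T, hT1, hT2⟩ := hT t htI
          obtain ⟨T', hT1', hT2'⟩ := hT1.restrict hη hmη hY hQ
          refine ⟨T', hT1', ?_⟩
          change ‖restriction i _ (F t (prolongation i _ _)) - T'‖ ≤ _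
          rw [prolongation_start hQ]
          have h2 := norm_sub_le_norm_sub_add_norm_sub
            (restriction i (prolMat (fun j => basisMat (c j) ((TTN.data Y0).sub j))
              i Q) (F t (toTensor Y0)))
            (restriction i (prolMat (fun j => basisMat (c j) ((TTN.data Y0).sub j))
              i Q) T) T'
          rw [← restriction_sub] at h2
          have h3 := norm_restriction_le hR (F t (toTensor Y0) - T)
          have h4 : ‖T‖ ≤ B + ε := by
            have h5 := norm_sub_norm_le T (F t (toTensor Y0))
            rw [norm_sub_rev] at h5
            have h6 := hFB t htI (toTensor Y0)
            linarith
          have h7 : 2 * (m * η) * ‖T‖ ≤ 2 * (m * η) * (B + ε) :=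
            mul_le_mul_of_nonneg_left h4 (by positivity)
          have h8 : 2 * (m * η) * ε ≤ 1 * ε := mul_le_mul_of_nonneg_right (by linarith) hε
          linarith)
      refine ⟨h1.1, h1.2.1, h1.2.2.1, fun z z' κ hz hz' => ?_⟩
      refine (h1.2.2.2 z z' κ hz hz').trans (mul_le_mul_of_nonneg_left
        (mul_le_mul_of_nonneg_left ?_ (captureConst_nonneg _)) hh)
      have hm0 : (0 : ℝ) ≤ m := Nat.cast_nonneg m
      have h9 : 0 ≤ m * ε := by positivity
      have h10 : 0 ≤ m * (L * B * (t₁ - t₀)) := by positivity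
      have h11 : (2 + 2 * (m : ℝ)) * e = 2 * ε + 2 * (L * B * (t₁ - t₀)) + 2 * (η * B) +
        2 * (m * ε) + 2 * (m * (L * B * (t₁ - t₀))) + 2 * m * (η * B) := by rw [he]; ring
      linarith)
    (fun i => captureConst_nonneg _) ?_ (by linarith)
  have : (0 : ℝ) ≤ m := Nat.cast_nonneg m
  linarith

/-- At a leaf, the increment of the curve is compared with that of the solution of the differential
equation, both endpoints of which lie in the range of the new basis. At an inner vertex, it is
compared with the increment of the Galerkin approximation. -/
lemma updateCaptures {t₀ t₁ L B η : ℝ} (ht : t₀ ≤ t₁) (hL : 0 ≤ L) (hB : 0 ≤ B) (hη : 0 ≤ η)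
    (σ : OTree 𝓛) : UpdateCaptures n t₀ t₁ L B η σ := by
  have hh : 0 ≤ t₁ - t₀ := sub_nonneg.2 ht
  induction σ with
  | leaf l =>
    intro s s' X0 S G Xhat ε h hS hF hX hση hGL hGB hε hT
    obtain ⟨y, hy, hy0, hr⟩ := h
    obtain ⟨⟨K1, hK1⟩, K0, hK0⟩ := hr.exists_mul
    have hU := hr.1
    set U := basisMat (.leaf l) Xhat with hUdef
    have hfix : U * (Uᴴ * basisMat (.leaf l) X0) = basisMat (.leaf l) X0 := by
      rw [hK0, ← Matrix.mul_assoc Uᴴ, hU, Matrix.one_mul]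
    refine ⟨hU, hfix, trivial, ?_⟩
    intro z z' κ hz hz'
    let ℓ : TSpace n (.leaf l) s →ₗ[ℝ] Matrix (Idx n (.leaf l)) (Fin s) ℂ :=
      { toFun := fun Z => defect U (mat0T Z)
        map_add' := fun x y => by rw [mat0T_add, defect_add]
        map_smul' := fun b x => by
          rw [show mat0T (b • x) = b • mat0T x from rfl, defect_smul]
          rfl }
    have hyB : ∀ t ∈ Icc t₀ t₁, ‖y t - toTensor (rootMul X0 S)‖ ≤ B * (t₁ - t₀) := fun t htI => by
      rw [← hy0]
      exact norm_sub_start_le hB hy (fun t ht => hGB t ht _) htI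
    have hmain := fro_linear_sub_le ℓ (z := fun t => z t - y t)
      (z' := fun t => z' t - G t (y t)) (C := 2 * (κ + L * B * (t₁ - t₀)))
      (fun t htI => (hz t htI).sub (hy t htI)) (fun t htI => by
        refine (fro_defect_le hU _).trans (mul_le_mul_of_nonneg_left ?_ zero_le_two)
        rw [fro_mat0T]
        have h1 := norm_sub_le_norm_sub_add_norm_sub (z' t) (G t (toTensor (rootMul X0 S)))
          (G t (y t))
        have h2 := hGL t htI (toTensor (rootMul X0 S)) (y t)
        rw [norm_sub_rev (toTensor (rootMul X0 S))] at h2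
        have h3 := mul_le_mul_of_nonneg_left (hyB t htI) hL
        have h4 := hz' t htI
        linarith)
      (left_mem_Icc.2 ht) (right_mem_Icc.2 ht) ht
    -- both `y t₁` and `y t₀` lie in the range of the new basis
    have e1 : defect U (mat0T (y t₁ - y t₀)) = 0 := by
      rw [mat0T_sub, defect_sub, hK1, defect_self_mul hU, hy0, mat0T_toTensor, basisMat_rootMul,
        hK0, Matrix.mul_assoc, defect_self_mul hU, sub_zero]
    have e2 : defect U (mat0T (z t₁ - z t₀)) = ℓ (z t₁ - y t₁ - (z t₀ - y t₀)) := by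
      change _ = defect U (mat0T (z t₁ - y t₁ - (z t₀ - y t₀)))
      have e3 : z t₁ - y t₁ - (z t₀ - y t₀) = (z t₁ - z t₀) - (y t₁ - y t₀) := by abel
      rw [e3, mat0T_sub (z t₁ - z t₀), defect_sub, e1, sub_zero]
    rw [e2]
    refine hmain.trans ?_
    rw [mul_comm]
    refine mul_le_mul_of_nonneg_left ?_ hh
    have h1 : 0 ≤ η * B := mul_nonneg hη hB
    change _ ≤ 2 * _
    linarith
  | node c ih =>
    rename_i m
    intro s s' X0 S G Xhat ε h hS hF hX hση hGL hGB hε hT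
    obtain ⟨C0, C1, hA, hr⟩ := h
    have hY : NearOrth η (.node c) (rootMul X0 S) := hX.rootMul S
    have hYF : FullRank (.node c) (rootMul X0 S) := hF.rootMul hS
    have hspec := hA.spec_of_updateCaptures ih ht hL hB hη hε hYF hY hση hGL hGB hT
    set e := ε + L * B * (t₁ - t₀) + η * B with he
    have hηB : 0 ≤ η * B := mul_nonneg hη hB
    obtain ⟨⟨K1, hK1⟩, K0, hK0⟩ := hr.exists_mul
    have hb := basisMat_node Xhat
    set 𝒰 := kr fun i => basisMat (c i) (Xhat.data.sub i) with h𝒰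
    set Qh := coreMat0T Xhat.data.core with hQh
    have h𝒰iso : 𝒰ᴴ * 𝒰 = 1 := isometry_kr hspec.isometry
    have hUiso : (basisMat (.node c) Xhat)ᴴ * basisMat (.node c) Xhat = 1 := by
      rw [hb, Matrix.conjTranspose_mul, Matrix.mul_assoc, ← Matrix.mul_assoc 𝒰ᴴ, h𝒰iso,
        Matrix.one_mul, hr.1]
    have hstart : basisMat (.node c) X0 * S = basisMat (.node c) Xhat * K0 := by
      rw [← basisMat_rootMul, ← hspec.start, hK0, hb, Matrix.mul_assoc]
    have hstart' : basisMat (.node c) X0 = basisMat (.node c) Xhat * (K0 * S⁻¹) := by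
      rw [← Matrix.mul_assoc, ← hstart, Matrix.mul_assoc, Matrix.mul_nonsing_inv _ hS,
        Matrix.mul_one]
    have hfix : ∀ {p : ℕ} (D : Matrix (Fin s') (Fin p) ℂ), basisMat (.node c) Xhat *
        ((basisMat (.node c) Xhat)ᴴ * (basisMat (.node c) Xhat * D)) =
          basisMat (.node c) Xhat * D := fun D => by
      rw [← Matrix.mul_assoc (basisMat (.node c) Xhat)ᴴ, hUiso, Matrix.one_mul]
    refine ⟨hUiso, ?_, fun i => ⟨hspec.isometry i, hspec.orthonormal i⟩, ?_⟩
    · rw [hstart', hfix]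
    · intro z z' κ hz hz'
      have h1 := hspec.captures z z' κ hz hz'
      have h2 := hspec.increment z z' κ hz hz'
      set D := mat0T (z t₁ - z t₀) with hD
      -- the Galerkin increment lies in the range of the new basis
      have e1 : 𝒰 * coreMat0T C1 - basisMat (.node c) (rootMul X0 S) =
          basisMat (.node c) Xhat * (K1 - K0) := by
        rw [basisMat_rootMul, hstart, hK1, Matrix.mul_sub, ← Matrix.mul_assoc, ← hb]
      have e2 : defect (basisMat (.node c) Xhat) D = defect 𝒰 D +
          defect (basisMat (.node c) Xhat) (𝒰 * (𝒰ᴴ * D) -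
            (𝒰 * coreMat0T C1 - basisMat (.node c) (rootMul X0 S))) := by
        have e3 : defect (basisMat (.node c) Xhat) (𝒰 * (𝒰ᴴ * D)) =
            𝒰 * (𝒰ᴴ * D) - basisMat (.node c) Xhat * ((basisMat (.node c) Xhat)ᴴ * D) := by
          rw [defect]
          congr 2
          rw [hb, Matrix.conjTranspose_mul, Matrix.mul_assoc, ← Matrix.mul_assoc 𝒰ᴴ, h𝒰iso,
            Matrix.one_mul, Matrix.mul_assoc]
        rw [defect_sub, e1, defect_self_mul hUiso, e3, sub_zero]
        simp only [defect]
        abel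
      rw [e2]
      refine (fro_add_le _ _).trans ?_
      have h3 := fro_defect_le hUiso (𝒰 * (𝒰ᴴ * D) -
        (𝒰 * coreMat0T C1 - basisMat (.node c) (rootMul X0 S)))
      have h4 : (t₁ - t₀) * (κ + L * B * (t₁ - t₀)) ≤ (t₁ - t₀) * (κ + e) :=
        mul_le_mul_of_nonneg_left (by linarith) hh
      change _ ≤
        (t₁ - t₀) * ((2 + ∑ i, (6 + 2 * (2 + 2 * (m : ℝ)) * captureConst (c i))) * (κ + e))
      have h5 : (t₁ - t₀) * ((2 + ∑ i, (6 + 2 * (2 + 2 * (m : ℝ)) * captureConst (c i))) * (κ + e))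
          = (t₁ - t₀) * ((∑ i, (6 + 2 * (2 + 2 * (m : ℝ)) * captureConst (c i))) * (κ + e)) +
            2 * ((t₁ - t₀) * (κ + e)) := by ring
      rw [h5]
      refine add_le_add h1 (h3.trans ?_)
      exact mul_le_mul_of_nonneg_left (h2.trans h4) zero_le_two

/-! ### Rank truncation -/

/-- The columns of a truncation basis are orthonormal, and the projection onto them changes the
matrix by at most the tolerance. -/
lemma IsTruncationBasis.spec {α : Type*} [Fintype α] {r s : ℕ} {ϑ : ℝ} {A : Matrix (Fin r) α ℂ}
    {P : Matrix (Fin r) (Fin s) ℂ} (h : IsTruncationBasis ϑ A P) :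
    Pᴴ * P = 1 ∧ fro (A - P * (Pᴴ * A)) ≤ ϑ := by
  obtain ⟨Ph, σ, Q, ⟨hPh, -, -, hQ, hA⟩, hleast, hs, hP⟩ := h
  set J : Matrix (Fin r) (Fin s) ℂ := (1 : Matrix (Fin r) (Fin r) ℂ).submatrix id (Fin.castLE hs)
    with hJ
  have hPJ : P = Ph * J := by
    rw [hP, hJ]
    ext a q
    simp [Matrix.mul_apply, Matrix.one_apply]
  have hJJ : Jᴴ * J = 1 := by
    ext q q'
    simp [hJ, Matrix.mul_apply, Matrix.one_apply, (Fin.castLE_injective hs).eq_iff]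
  constructor
  · rw [hPJ, Matrix.conjTranspose_mul, Matrix.mul_assoc, ← Matrix.mul_assoc Phᴴ, hPh,
      Matrix.one_mul, hJJ]
  · set Y := Matrix.diagonal (fun k => (σ k : ℂ)) * Qᴴ with hY
    have hAY : A = Ph * Y := by rw [hA, Matrix.mul_assoc]
    have e1 : A - P * (Pᴴ * A) = Ph * (Y - J * (Jᴴ * Y)) := by
      rw [hAY, hPJ, Matrix.conjTranspose_mul, Matrix.mul_assoc Jᴴ, ← Matrix.mul_assoc Phᴴ, hPh,
        Matrix.one_mul, Matrix.mul_sub, Matrix.mul_assoc]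
    have h1 := (opBound_of_isometry hPh).fro_mul_le zero_le_one (Y - J * (Jᴴ * Y))
    rw [e1]
    refine h1.trans ?_
    rw [one_mul]
    refine le_trans (Real.le_sqrt_of_sq_le ?_) hleast.1
    have hYe : ∀ k b, Y k b = σ k * star (Q b k) := fun k b => by
      rw [hY, Matrix.diagonal_mul, Matrix.conjTranspose_apply]
    have hJY : ∀ k b, (J * (Jᴴ * Y)) k b = if s ≤ k.val then 0 else Y k b := fun k b => by
      have e2 : ∀ q, (Jᴴ * Y) q b = Y (Fin.castLE hs q) b := fun q => by
        simp [hJ, Matrix.mul_apply, Matrix.one_apply]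
      rw [Matrix.mul_apply]
      simp only [e2]
      split_ifs with hk
      · refine Finset.sum_eq_zero fun q _ => ?_
        have : k ≠ Fin.castLE hs q := fun h => by
          rw [h] at hk
          exact absurd q.2 (not_lt.2 hk)
        simp [hJ, this]
      · rw [Finset.sum_eq_single ⟨k.val, not_le.1 hk⟩]
        · have : Fin.castLE hs ⟨k.val, not_le.1 hk⟩ = k := rfl
          rw [hJ, Matrix.submatrix_apply, this, id, Matrix.one_apply_eq, one_mul]
        · intro q _ hq
          have : k ≠ Fin.castLE hs q := fun h => hq (Fin.ext (congrArg Fin.val h).symm)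
          simp [hJ, this]
        · intro h
          exact absurd (Finset.mem_univ _) h
    rw [fro_sq, Finset.sum_filter]
    refine Finset.sum_le_sum fun k _ => ?_
    simp only [Matrix.sub_apply, hJY]
    by_cases hk : s ≤ k.val
    · simp only [hk, if_true, sub_zero, hYe, norm_mul, mul_pow, ← Finset.mul_sum]
      by_cases hσ : σ k = 0
      · simp [hσ]
      · have h2 := hQ k k hσ hσ
        rw [if_pos rfl, Matrix.mul_apply] at h2
        have h3 : ∑ b, ‖star (Q b k)‖ ^ 2 = 1 := by
          have h4 : ((∑ b, ‖star (Q b k)‖ ^ 2 : ℝ) : ℂ) = 1 := by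
            rw [← h2, Complex.ofReal_sum]
            refine Finset.sum_congr rfl fun b _ => ?_
            rw [norm_star, Matrix.conjTranspose_apply, Complex.ofReal_pow]
            exact (Complex.conj_mul' (Q b k)).symm
          exact_mod_cast h4
        rw [h3, mul_one, Complex.norm_real, Real.norm_eq_abs, sq_abs]
    · simp [hk]

/-- The constant in the error of the rank truncation of a tree. -/
def truncConst : OTree 𝓛 → ℝ
  | .leaf _ => 0
  | .node c => ∑ i, (1 + 2 * truncConst (c i))

lemma truncConst_nonneg (τ : OTree 𝓛) : 0 ≤ truncConst τ := by
  induction τ with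
  | leaf l => exact le_rfl
  | node c ih =>
    refine Finset.sum_nonneg fun i _ => ?_
    have := ih i
    positivity

lemma truncConst_le {m : ℕ} (c : Fin m → OTree 𝓛) (i : Fin m) :
    truncConst (c i) ≤ truncConst (.node c) := by
  have h := Finset.single_le_sum (f := fun i => 1 + 2 * truncConst (c i))
    (fun i _ => by have := truncConst_nonneg (c i); positivity) (Finset.mem_univ i)
  have h2 := truncConst_nonneg (c i)
  change _ ≤ ∑ i, (1 + 2 * truncConst (c i))
  linarith

/-- The rank truncation changes the matrix `U_τ` by a multiple of the tolerance, does not increase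
its spectral norm, and leaves the network nearly orthonormal. The truncated bases are not orthonormal
because the truncation inside `τ_i` follows the multiplication by `P_{τ_i}`. -/
lemma Truncation.spec {ϑ : ℝ} (hϑ : 0 ≤ ϑ) {τ : OTree 𝓛} {r : ℕ} {Xhat X : TTN n τ r}
    (h : Truncation ϑ τ Xhat X) (hO : IsOrthonormal τ Xhat) {b : ℝ} (hb0 : 0 ≤ b)
    (hb : OpBound (basisMat τ Xhat) b) :
    OpBound (basisMat τ X - basisMat τ Xhat) ((1 + b) * truncConst τ * ϑ) ∧
      OpBound (basisMat τ X) b ∧ NearOrth (4 * truncConst τ * ϑ) τ X := by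
  induction τ generalizing r b with
  | leaf l =>
    have h' : X = Xhat := h
    subst h'
    refine ⟨?_, hb, trivial⟩
    rw [sub_self]
    exact opBound_zero.mono (by simp [truncConst])
  | node c ih =>
    obtain ⟨P, hP, hcore, hsub⟩ := h
    have hPiso : ∀ i, (P i)ᴴ * P i = 1 := fun i => (hP i).spec.1
    have hEiso : ∀ i, (basisMat (c i) (rootMul (Xhat.data.sub i) (P i)))ᴴ *
        basisMat (c i) (rootMul (Xhat.data.sub i) (P i)) = 1 := fun i => by
      rw [basisMat_rootMul, Matrix.conjTranspose_mul, Matrix.mul_assoc,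
        ← Matrix.mul_assoc _ _ (P i), (hO i).1, Matrix.one_mul, hPiso]
    have hI := fun i => ih i (hsub i) ((hO i).2.rootMul (P i)) zero_le_one
      (opBound_of_isometry (hEiso i))
    have hT := fun i => truncConst_nonneg (c i)
    set W := fun i => basisMat (c i) (X.data.sub i) with hW
    set U := fun i => basisMat (c i) (Xhat.data.sub i) with hU
    set E := fun i => basisMat (c i) (rootMul (Xhat.data.sub i) (P i)) with hE
    set Chat := coreMat0T Xhat.data.core with hChat
    have hUiso : (kr U)ᴴ * kr U = 1 := isometry_kr fun i => (hO i).1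
    have hXhat : basisMat (.node c) Xhat = kr U * Chat := basisMat_node Xhat
    have hC : OpBound Chat b := by
      have e : Chat = (kr U)ᴴ * basisMat (.node c) Xhat := by
        rw [hXhat, ← Matrix.mul_assoc, hUiso, Matrix.one_mul]
      rw [e]
      simpa using ((opBound_of_isometry hUiso).conjTranspose zero_le_one).mul hb zero_le_one
    have hPC : OpBound ((kr P)ᴴ * Chat) b := by
      simpa using ((opBound_of_isometry (isometry_kr hPiso)).conjTranspose zero_le_one).mul hC
        zero_le_one
    have hX : basisMat (.node c) X = kr W * ((kr P)ᴴ * Chat) := by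
      rw [basisMat_node, hcore, coreMat0T_modeProd, ← kr_conjTranspose]
    have hW1 : ∀ i, OpBound (W i) 1 := fun i => (hI i).2.1
    have hWE : ∀ i, OpBound (W i - E i) (2 * truncConst (c i) * ϑ) := fun i =>
      (hI i).1.mono (le_of_eq (by ring))
    refine ⟨?_, ?_, fun i => ⟨hW1 i, ?_, ?_⟩⟩
    · have hEk : kr E = kr U * kr P := by
        rw [kr_mul]
        congr 1
        funext i
        exact basisMat_rootMul _ _
      -- the truncation inside the subtrees, and the truncation in the modes of the root tensor
      have e : basisMat (.node c) X - basisMat (.node c) Xhat =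
          (kr W - kr E) * ((kr P)ᴴ * Chat) - kr U * (Chat - kr P * ((kr P)ᴴ * Chat)) := by
        rw [hX, hXhat, hEk]
        simp only [Matrix.sub_mul, Matrix.mul_sub, Matrix.mul_assoc]
        abel
      have h1 := (opBound_kr_sub hW1 (fun i => opBound_of_isometry (hEiso i)) hWE
        fun i => by have := hT i; positivity).mul hPC
          (Finset.sum_nonneg fun i _ => by have := hT i; positivity)
      have h2 : fro (Chat - kr P * ((kr P)ᴴ * Chat)) ≤ ∑ _i : Fin _, ϑ :=
        (fro_sub_kr_proj_le hPiso Xhat.data.core).trans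
          (Finset.sum_le_sum fun i _ => (hP i).spec.2)
      have h3 := (opBound_of_isometry hUiso).mul (opBound_fro (Chat - kr P * ((kr P)ᴴ * Chat)))
        zero_le_one
      rw [e]
      refine (h1.sub h3).mono ?_
      rw [one_mul]
      refine (add_le_add le_rfl h2).trans ?_
      change _ ≤ (1 + b) * (∑ i, (1 + 2 * truncConst (c i))) * ϑ
      rw [Finset.sum_mul, ← Finset.sum_add_distrib, Finset.mul_sum, Finset.sum_mul]
      refine Finset.sum_le_sum fun i _ => ?_
      have h4 : 0 ≤ truncConst (c i) * ϑ := mul_nonneg (hT i) hϑ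
      have h5 : 0 ≤ b * ϑ := mul_nonneg hb0 hϑ
      nlinarith
    · rw [hX]
      simpa using (opBound_kr_one hW1).mul hPC zero_le_one
    · have e : 1 - (W i)ᴴ * W i = -((W i - E i)ᴴ * W i + (E i)ᴴ * (W i - E i)) := by
        rw [← hEiso i, Matrix.conjTranspose_sub, Matrix.sub_mul, Matrix.mul_sub]
        abel
      have h0 : 0 ≤ 2 * truncConst (c i) * ϑ := by have := hT i; positivity
      have h1 := ((hWE i).conjTranspose h0).mul (hW1 i) h0
      have h2 := ((opBound_of_isometry (hEiso i)).conjTranspose zero_le_one).mul (hWE i) zero_le_one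
      have e' : 1 - (basisMat (c i) (X.data.sub i))ᴴ * basisMat (c i) (X.data.sub i) =
        1 - (W i)ᴴ * W i := rfl
      rw [e', e]
      refine (h1.add h2).neg.mono ?_
      have h3 := mul_le_mul_of_nonneg_right (truncConst_le c i) hϑ
      linarith
    · refine (hI i).2.2.mono ?_
      have h3 := mul_le_mul_of_nonneg_right (truncConst_le c i) hϑ
      linarith

/-! ### The error of one time step -/

/-- Error propagation over one time step. The increment of the numerical solution before truncation is
compared with the increment of the exact solution `A`, whose velocity differs from `F(t, Y⁰)` by at
most `L(‖Y⁰ - A(t₀)‖ + Bh)`. -/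
lemma IntegratorStep.error_le {m : ℕ} {c : Fin m → OTree 𝓛}
    {F : ℝ → TSpace n (.node c) 1 → TSpace n (.node c) 1}
    {ϑ t₀ t₁ L B η ε : ℝ} {Y0 Y1 : TTN n (.node c) 1} (h : IntegratorStep F ϑ t₀ t₁ Y0 Y1)
    (ht : t₀ ≤ t₁) (hL : 0 ≤ L) (hB : 0 ≤ B) (hη : 0 ≤ η) (hε : 0 ≤ ε) (hϑ : 0 ≤ ϑ)
    (hF : FullRank (.node c) Y0) (hY : NearOrth η (.node c) Y0)
    (hcη : arityBound (.node c) * η ≤ 1 / 2)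
    (hFL : ∀ t ∈ Icc t₀ t₁, ∀ Z Z', ‖F t Z - F t Z'‖ ≤ L * ‖Z - Z'‖)
    (hFB : ∀ t ∈ Icc t₀ t₁, ∀ Z, ‖F t Z‖ ≤ B)
    (hT : ∀ t ∈ Icc t₀ t₁, ∃ T, IsTangent (.node c) Y0 T ∧ ‖F t (toTensor Y0) - T‖ ≤ ε)
    {A : ℝ → TSpace n (.node c) 1} (hA : SolvesODE F t₀ t₁ A) :
    ‖toTensor Y1 - A t₁‖ ≤
      (1 + captureConst (.node c) * L * (t₁ - t₀)) * ‖toTensor Y0 - A t₀‖ +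
        (t₁ - t₀) * (captureConst (.node c) * (2 * (L * B * (t₁ - t₀)) + ε + η * B)) +
        (1 + (‖toTensor Y0‖ + B * (t₁ - t₀))) * truncConst (.node c) * ϑ ∧
      NearOrth (4 * truncConst (.node c) * ϑ) (.node c) Y1 := by
  obtain ⟨Yhat, C0, hR, htr⟩ := h
  have hh : 0 ≤ t₁ - t₀ := sub_nonneg.2 ht
  have hspec := hR.spec_of_updateCaptures (fun i => updateCaptures ht hL hB hη (c i)) ht hL hB hη
    hε hF hY hcη hFL hFB hT
  have hb := basisMat_node Yhat
  rw [← mat0T_toTensor] at hb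
  have hO : IsOrthonormal (.node c) Yhat := fun i => ⟨hspec.isometry i, hspec.orthonormal i⟩
  obtain ⟨htr1, -, htr2⟩ := htr.spec hϑ hO (fro_nonneg _) (opBound_fro (basisMat (.node c) Yhat))
  refine ⟨?_, htr2⟩
  have htr3 := htr1.fro_le
  rw [← mat0T_toTensor, ← mat0T_toTensor, ← mat0T_sub, fro_mat0T, fro_mat0T] at htr3
  have hgrow := hspec.growth
  rw [← hb, ← mat0T_toTensor, ← mat0T_sub, fro_mat0T] at hgrow
  set e0 := ‖toTensor Y0 - A t₀‖ with he0
  have hAB : ∀ t ∈ Icc t₀ t₁, ‖A t - toTensor Y0‖ ≤ e0 + B * (t₁ - t₀) := fun t htI => by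
    have h1 := norm_sub_start_le hB hA (fun t ht => hFB t ht _) htI
    have h2 := norm_sub_le_norm_sub_add_norm_sub (A t) (A t₀) (toTensor Y0)
    rw [norm_sub_rev (A t₀)] at h2
    linarith
  have hκ : ∀ t ∈ Icc t₀ t₁, ‖F t (A t) - F t (toTensor Y0)‖ ≤ L * (e0 + B * (t₁ - t₀)) :=
    fun t htI => (hFL t htI _ _).trans (mul_le_mul_of_nonneg_left (hAB t htI) hL)
  have h1 := hspec.captures A (fun t => F t (A t)) _ hA hκ
  have h2 := hspec.increment A (fun t => F t (A t)) _ hA hκ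
  rw [← hb, ← mat0T_toTensor] at h2
  have h3 : ‖A t₁ - A t₀ - (toTensor Yhat - toTensor Y0)‖ ≤
      (t₁ - t₀) * ((∑ i, (6 + 2 * (2 + 2 * (m : ℝ)) * captureConst (c i))) *
        (L * (e0 + B * (t₁ - t₀)) + (ε + L * B * (t₁ - t₀) + η * B))) +
      (t₁ - t₀) * (L * (e0 + B * (t₁ - t₀)) + L * B * (t₁ - t₀)) := by
    have h4 := (fro_add_le _ _).trans (add_le_add h1 h2)
    rw [← fro_mat0T]
    refine le_trans (le_of_eq ?_) h4
    congr 1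
    rw [mat0T_sub (A t₁ - A t₀), mat0T_sub (toTensor Yhat)]
    unfold defect
    abel
  set Sc := ∑ i, (6 + 2 * (2 + 2 * (m : ℝ)) * captureConst (c i)) with hSc
  have hK : captureConst (.node c) = 2 + Sc := rfl
  have he0n : 0 ≤ e0 := norm_nonneg _
  have hLB : 0 ≤ L * B * (t₁ - t₀) := by positivity
  have hηB : 0 ≤ η * B := by positivity
  have hLe : 0 ≤ L * e0 := by positivity
  have h5 : (t₁ - t₀) * (Sc * (L * (e0 + B * (t₁ - t₀)) + (ε + L * B * (t₁ - t₀) + η * B))) +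
      (t₁ - t₀) * (L * (e0 + B * (t₁ - t₀)) + L * B * (t₁ - t₀)) ≤
      (t₁ - t₀) * ((2 + Sc) * (L * e0 + (2 * (L * B * (t₁ - t₀)) + ε + η * B))) := by
    rw [← mul_add]
    refine mul_le_mul_of_nonneg_left ?_ hh
    linarith
  have h6 : ‖toTensor Yhat - A t₁‖ ≤ e0 + ‖A t₁ - A t₀ - (toTensor Yhat - toTensor Y0)‖ := by
    have e : toTensor Yhat - A t₁ = (toTensor Y0 - A t₀) -
      (A t₁ - A t₀ - (toTensor Yhat - toTensor Y0)) := by abel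
    rw [e]
    exact norm_sub_le _ _
  have h7 : ‖toTensor Yhat‖ ≤ ‖toTensor Y0‖ + B * (t₁ - t₀) := by
    have := norm_sub_norm_le (toTensor Yhat) (toTensor Y0)
    linarith
  have h8 : (1 + ‖toTensor Yhat‖) * truncConst (.node c) * ϑ ≤
      (1 + (‖toTensor Y0‖ + B * (t₁ - t₀))) * truncConst (.node c) * ϑ := by
    have := truncConst_nonneg (OTree.node c)
    gcongr
  have h9 := norm_sub_le_norm_sub_add_norm_sub (toTensor Y1) (toTensor Yhat) (A t₁)
  have h10 : (1 + captureConst (.node c) * L * (t₁ - t₀)) * e0 +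
        (t₁ - t₀) * (captureConst (.node c) * (2 * (L * B * (t₁ - t₀)) + ε + η * B)) =
      e0 + (t₁ - t₀) * ((2 + Sc) * (L * e0 + (2 * (L * B * (t₁ - t₀)) + ε + η * B))) := by
    rw [hK]; ring
  linarith

/-! ### Error propagation over many time steps -/

/-- The discrete Gronwall inequality, one step. -/
lemma gronwall_step {a h δ D E E' : ℝ} (ha : 0 ≤ a) (hh : 0 ≤ h) (hD : 0 ≤ D)
    (j : ℕ) (hE : E ≤ Real.exp (a * (j * h)) * (δ + j * D)) (hE0 : 0 ≤ E)
    (hE' : E' ≤ (1 + a * h) * E + D) :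
    E' ≤ Real.exp (a * ((j + 1 : ℕ) * h)) * (δ + (j + 1 : ℕ) * D) := by
  have h1 : 1 + a * h ≤ Real.exp (a * h) := by
    rw [add_comm]; exact Real.add_one_le_exp _
  have h2 : 1 ≤ Real.exp (a * ((j + 1 : ℕ) * h)) := Real.one_le_exp (by positivity)
  have h3 : Real.exp (a * ((j + 1 : ℕ) * h)) = Real.exp (a * h) * Real.exp (a * (j * h)) := by
    rw [← Real.exp_add]
    congr 1
    push_cast
    ring
  have h4 : (1 + a * h) * E ≤ Real.exp (a * h) * (Real.exp (a * (j * h)) * (δ + j * D)) :=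
    mul_le_mul h1 hE hE0 (Real.exp_pos _).le
  have h5 : D ≤ Real.exp (a * ((j + 1 : ℕ) * h)) * D := by nlinarith
  have h6 : Real.exp (a * ((j + 1 : ℕ) * h)) * (δ + (j + 1 : ℕ) * D) =
      Real.exp (a * h) * (Real.exp (a * (j * h)) * (δ + j * D)) +
        Real.exp (a * ((j + 1 : ℕ) * h)) * D := by
    rw [h3]
    push_cast
    ring
  linarith

end RankAdaptiveTTN

end

theorem theorem5p1 {𝓛 : Type*} {m : ℕ} (c : Fin m → RankAdaptiveTTN.OTree 𝓛)
    (hτ : (RankAdaptiveTTN.OTree.node c).Admissible)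
    (L B tstar : ℝ) (hL : 0 ≤ L) (hB : 0 ≤ B) (htstar : 0 ≤ tstar) :
    ∃ c₀ c₁ c₂ c₃ : ℝ, 0 ≤ c₀ ∧ 0 ≤ c₁ ∧ 0 ≤ c₂ ∧ 0 ≤ c₃ ∧
      ∀ (n : 𝓛 → ℕ)
        (F : ℝ → RankAdaptiveTTN.TSpace n (.node c) 1 → RankAdaptiveTTN.TSpace n (.node c) 1)
        (A : ℝ → RankAdaptiveTTN.TSpace n (.node c) 1)
        (Y : ℕ → RankAdaptiveTTN.TTN n (.node c) 1)
        (δ ε h ϑ ρ ρ' : ℝ) (k : ℕ),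
        0 ≤ ε → 0 < h → 0 ≤ ϑ → k * h ≤ tstar →
        -- the exact solution
        RankAdaptiveTTN.SolvesODE F 0 tstar A →
        -- Lipschitz continuity and boundedness
        (∀ t ∈ Set.Icc 0 tstar, ∀ Z Z', ‖F t Z - F t Z'‖ ≤ L * ‖Z - Z'‖) →
        (∀ t ∈ Set.Icc 0 tstar, ∀ Z, ‖F t Z‖ ≤ B) →
        -- the numerical solution
        RankAdaptiveTTN.IntegratorRun F ϑ h k Y →
        -- the function is tangential to the manifolds of the time steps up to `ε`
        (∀ j < k, ∀ t ∈ Set.Icc (j * h) ((j + 1) * h),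
          ∀ Z ∈ RankAdaptiveTTN.ttnManifold n (.node c) 1
            (RankAdaptiveTTN.treeRank (.node c) (Y j)), ‖Z‖ ≤ ρ →
          ‖F t Z - (RankAdaptiveTTN.tangentSpaceAt (RankAdaptiveTTN.ttnManifold n (.node c) 1
            (RankAdaptiveTTN.treeRank (.node c) (Y j))) Z).starProjection (F t Z)‖ ≤ ε) →
        ρ' < ρ → (∀ t ∈ Set.Icc 0 tstar, ‖A t‖ ≤ ρ') →
        -- the starting values
        ‖RankAdaptiveTTN.toTensor (Y 0) - A 0‖ ≤ δ →
        -- the error bound keeps the numerical solution in the ball of radius `ρ`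
        c₀ * δ + c₁ * ε + c₂ * h + c₃ * (1 + ρ) * (ϑ / h) ≤ ρ - ρ' →
        ‖RankAdaptiveTTN.toTensor (Y k) - A (k * h)‖ ≤
          c₀ * δ + c₁ * ε + c₂ * h + c₃ * (1 + ρ) * (ϑ / h) := by
  obtain ⟨K, hKdef⟩ : ∃ K, K = RankAdaptiveTTN.captureConst (.node c) := ⟨_, rfl⟩
  obtain ⟨T, hTdef⟩ : ∃ T, T = RankAdaptiveTTN.truncConst (.node c) := ⟨_, rfl⟩
  obtain ⟨N, hNdef⟩ : ∃ N, N = RankAdaptiveTTN.arityBound (.node c) := ⟨_, rfl⟩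
  have hK : 0 ≤ K := hKdef ▸ RankAdaptiveTTN.captureConst_nonneg _
  have hT : 0 ≤ T := hTdef ▸ RankAdaptiveTTN.truncConst_nonneg _
  have hN : 0 ≤ N := hNdef ▸ RankAdaptiveTTN.arityBound_nonneg _
  obtain ⟨G, hG⟩ : ∃ G, G = Real.exp (K * L * tstar) := ⟨_, rfl⟩
  have hG1 : 1 ≤ G := hG ▸ Real.one_le_exp (by positivity)
  have hG0 : 0 ≤ G := zero_le_one.trans hG1
  -- The last summand of `c₃` forces the networks to be nearly orthonormal: the smallness assumption
  -- gives `8TN tstar (ϑ / h) (1 + ρ) ≤ ρ - ρ' ≤ 1 + ρ`, and hence `N (4Tϑ) ≤ 1 / 2` if `h ≤ tstar`.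
  refine ⟨G, G * (tstar * K), G * (tstar * K * (2 * (L * B))),
    G * (tstar * tstar * K * (4 * T * B) + tstar * ((1 + B * tstar) * T)) + 8 * T * N * tstar,
    hG0, by positivity, by positivity, by positivity, ?_⟩
  intro n F A Y δ ε h ϑ ρ ρ' k hε hh hϑ hk hA hFL hFB hrun htan hρ hAρ hδ hsmall
  have hρ'0 : 0 ≤ ρ' := (norm_nonneg _).trans (hAρ 0 ⟨le_rfl, htstar⟩)
  have hρ0 : 0 ≤ ρ := hρ'0.trans hρ.le
  have hδ0 : 0 ≤ δ := (norm_nonneg _).trans hδ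
  obtain ⟨θ, hθ⟩ : ∃ θ, θ = ϑ / h := ⟨_, rfl⟩
  have hθ0 : 0 ≤ θ := hθ ▸ div_nonneg hϑ hh.le
  have hϑθ : ϑ = h * θ := by rw [hθ]; field_simp
  rw [← hθ] at hsmall ⊢
  set D := h * (K * (2 * (L * B * h) + ε + 4 * T * ϑ * B)) + (1 + (ρ + B * tstar)) * T * ϑ with hD
  have hD0 : 0 ≤ D := by positivity
  have hkh : k * h * h ≤ tstar * tstar := by
    rcases Nat.eq_zero_or_pos k with h0 | h0
    · rw [h0]; simp only [Nat.cast_zero, zero_mul]; positivity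
    · have h1 : (1 : ℝ) ≤ k := by exact_mod_cast h0
      have h2 : h ≤ k * h := by nlinarith
      exact mul_le_mul hk (h2.trans hk) hh.le htstar
  have hkD : k * D ≤ tstar * K * ε + tstar * K * (2 * (L * B)) * h +
      (tstar * tstar * K * (4 * T * B) + tstar * ((1 + B * tstar) * T)) * (1 + ρ) * θ := by
    have h1 : k * D = k * h * (K * ε) + k * h * (K * (2 * (L * B)) * h) +
        k * h * h * (K * (4 * T * B) * θ) + k * h * ((1 + (ρ + B * tstar)) * T * θ) := by
      rw [hD, hϑθ]; ring
    have h2 : k * h * (K * ε) ≤ tstar * (K * ε) :=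
      mul_le_mul_of_nonneg_right hk (by positivity)
    have h3 : k * h * (K * (2 * (L * B)) * h) ≤ tstar * (K * (2 * (L * B)) * h) :=
      mul_le_mul_of_nonneg_right hk (by positivity)
    have h4 : k * h * h * (K * (4 * T * B) * θ) ≤ tstar * tstar * (K * (4 * T * B) * θ) :=
      mul_le_mul_of_nonneg_right hkh (by positivity)
    have h5 : k * h * ((1 + (ρ + B * tstar)) * T * θ) ≤
        tstar * ((1 + B * tstar) * (1 + ρ) * T * θ) := by
      refine mul_le_mul hk ?_ (by positivity) htstar
      have h6 : 1 + (ρ + B * tstar) ≤ (1 + B * tstar) * (1 + ρ) := by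
        have : 0 ≤ B * tstar * ρ := by positivity
        linarith
      gcongr
    have h6 : 0 ≤ tstar * tstar * (K * (4 * T * B) * θ) * ρ := by positivity
    rw [h1]
    linarith
  -- the accumulated error stays below the claimed bound, up to the time `t_k`
  have hbound : ∀ j ≤ k, Real.exp (K * L * (j * h)) * (δ + j * D) ≤
      G * δ + G * (tstar * K) * ε + G * (tstar * K * (2 * (L * B))) * h +
        (G * (tstar * tstar * K * (4 * T * B) + tstar * ((1 + B * tstar) * T)) +
          8 * T * N * tstar) * (1 + ρ) * θ := by
    intro j hj
    have hj' : (j : ℝ) ≤ k := by exact_mod_cast hj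
    have h1 : Real.exp (K * L * (j * h)) ≤ G := by
      rw [hG]
      refine Real.exp_le_exp.2 (mul_le_mul_of_nonneg_left ?_ (by positivity))
      exact (mul_le_mul_of_nonneg_right hj' hh.le).trans hk
    have h2 : δ + j * D ≤ δ + k * D := by
      have := mul_le_mul_of_nonneg_right hj' hD0
      linarith
    have h3 : Real.exp (K * L * (j * h)) * (δ + j * D) ≤ G * (δ + k * D) :=
      mul_le_mul h1 h2 (by positivity) hG0
    have h4 := mul_le_mul_of_nonneg_left hkD hG0
    have h5 : 0 ≤ 8 * T * N * tstar * (1 + ρ) * θ := by positivity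
    linarith
  have hη0 : 0 ≤ 4 * T * ϑ := by positivity
  have main : ∀ j ≤ k, RankAdaptiveTTN.NearOrth (4 * T * ϑ) (.node c) (Y j) ∧
      ‖RankAdaptiveTTN.toTensor (Y j) - A (j * h)‖ ≤
        Real.exp (K * L * (j * h)) * (δ + j * D) := by
    intro j
    induction j with
    | zero =>
      intro _
      refine ⟨hrun.1.nearOrth hη0, ?_⟩
      simpa using hδ
    | succ j ih =>
      intro hjk
      have hj : j < k := hjk
      obtain ⟨hno, herr⟩ := ih hj.le
      obtain ⟨hfull, Y1, hstep, hnext⟩ := hrun.2 j hj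
      have hj1 : ((j : ℝ) + 1) * h ≤ tstar := by
        have : ((j : ℝ) + 1) ≤ k := by exact_mod_cast hjk
        exact (mul_le_mul_of_nonneg_right this hh.le).trans hk
      have hj0 : 0 ≤ (j : ℝ) * h := by positivity
      have hhT : h ≤ tstar := by nlinarith
      have hI : Set.Icc ((j : ℝ) * h) ((j + 1) * h) ⊆ Set.Icc 0 tstar :=
        Set.Icc_subset_Icc hj0 hj1
      have hjh : (j : ℝ) * h ≤ (j + 1) * h := by linarith
      have hlen : ((j : ℝ) + 1) * h - j * h = h := by ring
      -- by the smallness assumption, the starting value is in the ball where `F` is nearly tangential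
      have hnorm : ‖RankAdaptiveTTN.toTensor (Y j)‖ ≤ ρ := by
        have h1 := herr.trans ((hbound j hj.le).trans hsmall)
        have h2 := hAρ (j * h) (hI (Set.left_mem_Icc.2 hjh))
        have h3 := norm_sub_norm_le (RankAdaptiveTTN.toTensor (Y j)) (A (j * h))
        linarith
      have hcη : RankAdaptiveTTN.arityBound (.node c) * (4 * T * ϑ) ≤ 1 / 2 := by
        rw [← hNdef]
        have h1 : 8 * T * N * tstar * θ * (1 + ρ) ≤ 1 * (1 + ρ) := by
          have h2 : 0 ≤ G * δ + G * (tstar * K) * ε + G * (tstar * K * (2 * (L * B))) * h +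
            G * (tstar * tstar * K * (4 * T * B) + tstar * ((1 + B * tstar) * T)) *
              (1 + ρ) * θ := by positivity
          linarith
        have h2 := le_of_mul_le_mul_right h1 (by linarith)
        have h3 : N * (4 * T * ϑ) * 2 ≤ 8 * T * N * tstar * θ := by
          have h4 : ϑ ≤ tstar * θ := by rw [hϑθ]; exact mul_le_mul_of_nonneg_right hhT hθ0
          have h5 := mul_le_mul_of_nonneg_left h4 (show 0 ≤ 8 * T * N by positivity)
          linarith
        linarith
      have hres := hstep.error_le hjh hL hB hη0 hε hϑ hfull hno hcη
        (fun t ht => hFL t (hI ht)) (fun t ht => hFB t (hI ht))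
        (fun t ht => ⟨_, RankAdaptiveTTN.isTangent_of_mem_tangentSpaceAt hfull
          (Submodule.starProjection_apply_mem _ _), htan j hj t ht _ ⟨Y j, hfull, rfl, rfl⟩ hnorm⟩)
        (A := A) (fun t ht => (hA t (hI ht)).mono hI)
      obtain ⟨herr1, hno1⟩ := hres
      rw [hlen, ← hKdef, ← hTdef] at herr1
      rw [← hTdef] at hno1
      have herr2 : ‖RankAdaptiveTTN.toTensor (Y (j + 1)) - A ((j + 1 : ℕ) * h)‖ ≤
          (1 + K * L * h) * ‖RankAdaptiveTTN.toTensor (Y j) - A (j * h)‖ + D := by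
        have e : RankAdaptiveTTN.toTensor (Y (j + 1)) = RankAdaptiveTTN.toTensor Y1 := by
          rcases hnext with h1 | h1
          · rw [h1]
          · exact h1.2
        rw [e]
        push_cast
        refine herr1.trans ?_
        rw [hD, add_assoc]
        gcongr
      refine ⟨?_, RankAdaptiveTTN.gronwall_step (by positivity) hh.le hD0 j herr (norm_nonneg _)
        herr2⟩
      rcases hnext with h1 | h1
      · rw [h1]
        exact hno1
      · exact h1.1.nearOrth hη0
  exact (main k le_rfl).2.trans (hbound k le_rfl)
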